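/- **Groups.** Let $G_s$ be one of the 17 wallpaper groups, written in coordinates of the plane $\mathbb{R}^2$ in which $T_1,T_2$ are the translations by $(1,0)$ and $(0,1)$. Its elements are $g=T_1^xT_2^yC^cM^m$ with $x,y\in\mathbb{Z}$, $0\le c<n$, $m\in\{0,1\}$ ($m=0$ if there is no $M$), acting by $v\mapsto(x,y)+R^c\mu^m(v)$. Here $C=C_n$ acts by $R$, where $R(a,b)$ is $(a,b)$, $(-a,-b)$, $(-b,a-b)$, $(-b,a)$, $(a-b,a)$ for $n=1,2,3,4,6$: $n=1$ for $p1,pm,pg,cm$; $n=2$ for $p2,pmm,pmg,pgg,cmm$; $n=3$ for $p3,p3m1,p31m$; $n=4$ for $p4,p4m,p4g$; $n=6$ for $p6,p6m$. There is no $M$ for $p1,p2,p3,p4,p6$; otherwise $M$ acts by $\mu$, with $\mu(a,b)=(-a,b)$ for $pm,pmm,p4m$; $(-a,b+\tfrac12)$ for $pg$; $(\tfrac12-a,b)$ for $pmg$; $(\tfrac12-a,b+\tfrac12)$ for $pgg$; $(b,a)$ for $cm,cmm,p31m,p6m$; $(b+\tfrac12,a+\tfrac12)$ for $p4g$; $(-b,-a)$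 for $p3m1$. (In $pg,pgg,p4g$ the generator $M$ is a glide reflection; in $pg$, $M^2=T_2$.) Let $\rho(g)=(-1)^m$ be the orientation character; a subscript $\rho$ means that $g$ acts on a coefficient group by $\rho(g)$ ($U(1)_\rho$: by complex conjugation if $\rho(g)=-1$). **Invariants.** For a 2-cocycle $\omega:G_s\times G_s\to\{\pm1\}$ (trivial action) put $\mathrm{rot}(g)=\frac{\omega(g,g)}{\omega(1,1)}$, $\ \mathrm{ax}(t,h)=\frac{\omega(t,h)}{\omega(h,t)}$, $\ \mathrm{cell}(t_1,t_2)=\frac{\omega(t_1,t_2)}{\omega(t_2,t_1)}$, $\ \mathrm{gl}(t,s)=\frac{\omega(ts^{-1},ts)\,\omega(t,s)}{\omega(s^{-1},s)\,\omega(t,s^{-1})}$, $\ \mathrm{mir}(h)=\frac{\omega(h,h)}{\omega(1,1)}$. The list $\alpha_1,\alpha_2,\dots$ is: - $p1$: $\mathrm{cell}(T_1,T_2)$. - $p2$: $\mathrm{rot}(C),\mathrm{rot}(T_1C),\mathrm{rot}(T_2C),\mathrm{rot}(T_1T_2C)$. - $pm$: $\mathrm{ax}(T_2,M),\mathrm{ax}(T_2,T_1M),\mathrm{mir}(M),\mathrm{mir}(T_1M)$.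 - $pg$: $\mathrm{gl}(T_1,M)$. - $cm$: $\mathrm{ax}(T_1T_2,M),\mathrm{mir}(M)$. - $pmm$: $\mathrm{rot}(C),\mathrm{rot}(T_1T_2C),\mathrm{rot}(T_1C),\mathrm{rot}(T_2C),\mathrm{mir}(M),\mathrm{mir}(CM),\mathrm{mir}(T_1M),\mathrm{mir}(T_2CM)$. - $pmg$: $\mathrm{rot}(C),\mathrm{rot}(T_1T_2C),\mathrm{ax}(T_2,M),\mathrm{mir}(M)$. - $pgg$: $\mathrm{rot}(C),\mathrm{rot}(T_1C)$. - $cmm$: $\mathrm{rot}(C),\mathrm{rot}(T_1T_2C),\mathrm{rot}(T_1C),\mathrm{mir}(M),\mathrm{mir}(CM)$. - $p4$: $\mathrm{rot}(C^2),\mathrm{rot}(T_1T_2C^2),\mathrm{rot}(T_1C^2)$. - $p4m$: $\mathrm{rot}(C^2),\mathrm{rot}(T_1T_2C^2),\mathrm{rot}(T_1C^2),\mathrm{mir}(M),\mathrm{mir}(T_1M),\mathrm{mir}(CM)$. - $p4g$: $\mathrm{rot}(C^2),\mathrm{rot}(T_1C^2),\mathrm{mir}(T_1^{-1}M)$. -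 $p3$: $\mathrm{cell}(T_1,T_2)$. - $p3m1$: $\mathrm{cell}(T_1,T_2),\mathrm{mir}(M)$. - $p31m$: $\mathrm{ax}(T_1T_2,M),\mathrm{mir}(M)$. - $p6$: $\mathrm{rot}(C^3),\mathrm{rot}(T_1C^3)$. - $p6m$: $\mathrm{rot}(C^3),\mathrm{rot}(T_1C^3),\mathrm{mir}(M),\mathrm{mir}(C^3M)$. The invariants $\mathrm{mir}(\cdot)$ are called *mirror-type*, all others *LSM-type*. **Basis cochains.** For $g_i=T_1^{x_i}T_2^{y_i}C^{c_i}M^{m_i}$ let $\lambda_j(g_1,g_2)\in\mathbb{Z}_2$ be given as follows, where $\delta_k=1$ if $c_1=k$ and $0$ otherwise, $\delta'_k$ is the same for $c_2$, $\bar m=1-m_1$, $S(e)=y_1x_2$ for even $e$ and $y_2(x_2+y_1)$ for odd $e$, and $\kappa_n=\frac1n\big(c_1+(-1)^{m_1}c_2-[c_1+(-1)^{m_1}c_2]_n\big)$ with $[a]_n\in\{0,\dots,n-1\}$ the residue of $a$ mod $n$: - $p1$: $y_1x_2$. - $p2$: $y_1x_2+c_1(x_2+y_2+c_2)$; $(y_1+c_1)x_2$;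 $y_1x_2+c_1y_2$; $y_1x_2$. - $pm$: $y_1x_2+m_1y_2$; $y_1x_2$; $m_1(x_2+m_2)$; $m_1x_2$. - $pg$: $m_1x_2$. - $cm$: $S(m_1)$; $m_1m_2$. - $pmm$: $(y_1+c_1)x_2+(c_1+m_1)(y_2+c_2)$; $y_1x_2$; $(y_1+c_1)x_2$; $y_1x_2+(c_1+m_1)y_2$; $m_1(x_2+c_2+m_2)$; $m_1(y_2+c_2)$; $m_1x_2$; $m_1y_2$. - $pmg$: $c_1(y_2+c_2)$; $c_1y_2$; $m_1y_2$; $m_1m_2$. - $pgg$: $c_1(x_2+y_2+c_2)+(c_1+c_2)m_1m_2+m_1x_2$; $c_1(x_2+y_2)+(c_1+c_2)m_1m_2+m_1x_2$. - $cmm$: $S(m_1)+c_1(x_2+y_2+c_2+m_2)$; $S(m_1)$; $c_1(x_2+y_2)$; $m_1(c_2+m_2)$; $m_1c_2$. - $p4$: $\lambda_2+\lambda_3+\kappa_4$; $\lambda_2=S(c_1)$; $\lambda_3=\delta_1x_2+\delta_2(x_2+y_2)+\delta_3y_2$. - $p4m$: $\lambda_2+\lambda_3+\kappa_4$; $\lambda_2=S(c_1)$;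 $\lambda_3=\delta_1x_2+\delta_2(x_2+y_2)+\delta_3y_2+m_1y_2$; $m_1(x_2+y_2+c_2+m_2)$; $m_1(x_2+y_2)$; $m_1c_2$. - $p4g$: $\lambda_2+\kappa_4$; $\lambda_2=\delta_0m_1(\delta'_3+d)+\delta_1[\bar my_2+m_1(x_2+1-\delta'_0+d)]+\delta_2[\bar m(x_2+y_2)+m_1(x_2+y_2+\delta'_1+d)]+\delta_3[\bar mx_2+m_1(y_2+\delta'_2+d)]$ with $d=(c_1-c_2)m_2$; $m_1m_2$. - $p3$: $\delta_0y_1x_2+\delta_1\big(\tfrac{y_2(y_2-1)}2+y_2(x_2+y_1)\big)+\delta_2\big(\tfrac{x_2(x_2-1)}2+y_1x_2+y_2(x_2+y_1)\big)$. - $p3m1$: $\delta_0S(m_1)+\delta_1\big[\bar m\big(\tfrac{y_2(y_2-1)}2+y_2(x_2+y_1)\big)+m_1\big(\tfrac{x_2(x_2+1)}2+y_1x_2\big)\big]+\delta_2\big[\bar m\big(\tfrac{x_2(x_2-1)}2+y_1x_2+y_2(x_2+y_1)\big)+m_1\big(\tfrac{y_2(y_2+1)}2+y_1(x_2+y_2)\big)\big]$;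 $m_1m_2$. - $p31m$: $\delta_0S(m_1)+\delta_1\big[\bar m\big(\tfrac{y_2(y_2+1)}2+x_2+y_2(x_2+y_1)\big)+m_1\big(\tfrac{x_2(x_2+1)}2+y_2+y_1x_2\big)\big]+\delta_2\big[\bar m\big(\tfrac{x_2(x_2-1)}2+y_2+y_1x_2+y_2(x_2+y_1)\big)+m_1\big(\tfrac{y_2(y_2-1)}2+x_2+y_1(x_2+y_2)\big)\big]$; $m_1m_2$. - $p6$: $h+\kappa_6$; $h$. $\ p6m$: $h+\kappa_6$; $h$; $m_1(c_2+m_2)$; $m_1c_2$. Here ($m_1=0$ for $p6$) $h=\delta_0S(m_1)+\delta_1\big[\bar m\big(\tfrac{x_2(x_2-1)}2+y_1x_2+y_2(x_2+y_1)\big)+m_1\big(\tfrac{y_2(y_2-1)}2+y_1(x_2+y_2)\big)\big]+\delta_2\big[\bar m\big(\tfrac{y_2(y_2+1)}2+x_2+y_2(x_2+y_1)\big)+m_1\big(\tfrac{x_2(x_2+1)}2+y_2+y_1x_2\big)\big]+\delta_3\big[\bar m(x_2+y_2+y_1x_2)+m_1(x_2+y_2+y_2(x_2+y_1))\big]+\delta_4\big[\bar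 m\big(\tfrac{x_2(x_2-1)}2+y_2+y_1x_2+y_2(x_2+y_1)\big)+m_1\big(\tfrac{y_2(y_2-1)}2+x_2+y_1(x_2+y_2)\big)\big]+\delta_5\big[\bar m\big(\tfrac{y_2(y_2+1)}2+y_2(x_2+y_1)\big)+m_1\big(\tfrac{x_2(x_2+1)}2+y_1x_2\big)\big]$. **The kernel.** Let $\tilde i:H^2(G_s,\mathbb{Z}_2)\to H^2_{\rm Borel}(G_s,U(1)_\rho)=H^3(G_s,\mathbb{Z}_\rho)$ be the map induced by $\mathbb{Z}_2=\{\pm1\}\subset U(1)$, that is, the induced map to $H^2(G_s,U(1)_\rho)$ with discrete coefficients followed by the connecting homomorphism of $0\to\mathbb{Z}_\rho\to\mathbb{R}_\rho\to U(1)_\rho\to0$. **Lattice homotopy.** A distribution is a $G_s$-invariant function $\sigma:\mathbb{R}^2\to\mathbb{Z}_2$ with locally finite support (the projective representation, PR, at each point). Distributions form a group under addition, and $A_{\rm LH}$ is its quotient by all differences $\sigma-\tau$ such that $\sigma$ can be deformed to $\tau$: there are a $G_s$-set $I$ and continuous paths $\gamma_i:[0,1]\to\mathbb{R}^2$ ($i\in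 I$) with $\gamma_{gi}=g\gamma_i$, only finitely many of which meet any given compact set, such that $\sigma(p)$ and $\tau(p)$ are the numbers mod 2 of $i$ with $\gamma_i(0)=p$ and $\gamma_i(1)=p$. **Theorem.** For each of the 17 wallpaper groups, with $N$ the number of listed invariants: 1. Every $\alpha_i[\omega]$ is unchanged when $\omega$ is multiplied by a $\{\pm1\}$-valued coboundary. 2. Two cocycles with the same values of all $\alpha_i$ are cohomologous, and $[\omega]\mapsto(\alpha_i[\omega])_i$ is an isomorphism $H^2(G_s,\mathbb{Z}_2)\cong\{\pm1\}^N$. 3. The $\lambda_j$ are 2-cocycles and $\alpha_i[(-1)^{\lambda_j}]=(-1)^{\delta_{ij}}$ for $1\le i,j\le N$. 4. $\ker\tilde i$ consists exactly of the classes on which all mirror-type invariants are trivial, and it is generated by the $[\lambda_j]$ with $\alpha_j$ of LSM-type. 5. There is an isomorphism $\Phi:A_{\rm LH}\to\ker\tilde i$ such that, for every distribution $\sigma$, every $\omega$ representing $\Phi[\sigma]$ and every LSM-type $\alpha_i$, one has $\alpha_i[\omega]=(-1)^{\sum_{q\in R}\sigma(q)}$ for each region $R$ belonging to $\alpha_i$: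 the fixed point of $g$ if $\alpha_i=\mathrm{rot}(g)$; a half-open segment $[p,tp)$ on the axis of $h$ if $\alpha_i=\mathrm{ax}(t,h)$; a half-open parallelogram with corner $p$ and edges from $p$ to $t_1p$ and from $p$ to $t_2p$ if $\alpha_i=\mathrm{cell}(t_1,t_2)$; and such a parallelogram with edges from $p$ to $tp$ and from $p$ to $sp$ if $\alpha_i=\mathrm{gl}(t,s)$ ($p$ being arbitrary, respectively arbitrary on the axis). -/

import Mathlib

open CategoryTheory

/-- The seventeen wallpaper groups. -/
inductive WallpaperGroup : Type
  | p1 | p2 | pm | pg | cm | pmm | pmg | pgg | cmm | p4 | p4m | p4g | p3 | p3m1 | p31m | p6 | p6m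

namespace WallpaperGroup

/-- The order `n` of the generating rotation `C = C_n`. -/
abbrev rot : WallpaperGroup → ℕ
  | p1 | pm | pg | cm => 1
  | p2 | pmm | pmg | pgg | cmm => 2
  | p3 | p3m1 | p31m => 3
  | p4 | p4m | p4g => 4
  | p6 | p6m => 6

/-- `2` if there is an orientation-reversing generator `M` (a mirror, or a glide reflection
for `pg`, `pgg`, `p4g`), and `1` otherwise. -/
abbrev mir : WallpaperGroup → ℕ
  | p1 | p2 | p3 | p4 | p6 => 1
  | _ => 2

instance (W : WallpaperGroup) : NeZero W.rot := ⟨by cases W <;> decide⟩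

instance (W : WallpaperGroup) : NeZero W.mir := ⟨by cases W <;> decide⟩

/-- An element of the wallpaper group in normal form `T₁ ^ x * T₂ ^ y * C ^ c * M ^ m`; the
letter `M` stands for the glide reflection `G` (or `G₁`) in `pg`, `pgg`, `p4g`.  In `pg` the
translation `T₂` is `G ^ 2`, so that `T₁ ^ x * G ^ s` is `T₁ ^ x * T₂ ^ (s / 2) * G ^ (s % 2)`. -/
@[ext] structure Elt (W : WallpaperGroup) : Type where
  x : ℤ
  y : ℤ
  c : Fin W.rot
  m : Fin W.mir

/-- The linear action of the rotation `C_n` in the basis of the translation vectors of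
`T₁`, `T₂`. -/
def rotGen {R : Type} [Ring R] (n : ℕ) (v : R × R) : R × R :=
  match n with
  | 2 => (-v.1, -v.2)
  | 3 => (-v.2, v.1 - v.2)
  | 4 => (-v.2, v.1)
  | 6 => (v.1 - v.2, v.1)
  | _ => v

/-- The linear part of `M` in the basis of the translation vectors of `T₁`, `T₂`. -/
def mirGen {R : Type} [Ring R] (W : WallpaperGroup) (v : R × R) : R × R :=
  match W with
  | pm | pg | pmm | pmg | pgg | p4m => (-v.1, v.2)
  | cm | cmm | p4g | p31m | p6m => (v.2, v.1)
  | p3m1 => (-v.2, -v.1)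
  | _ => v

/-- The linear part of `C ^ c * M ^ m`. -/
def lin {R : Type} [Ring R] (W : WallpaperGroup) (c : Fin W.rot) (m : Fin W.mir)
    (v : R × R) : R × R :=
  (rotGen W.rot)^[c.val] ((mirGen W)^[m.val] v)

/-- The translation in the product `(C ^ c₁ * M ^ m₁) * (C ^ c₂ * M ^ m₂)`. -/
def shift (W : WallpaperGroup) (c₁ : Fin W.rot) (m₁ : Fin W.mir) (c₂ : Fin W.rot)
    (m₂ : Fin W.mir) : ℤ × ℤ :=
  match W with
  | pg => (0, m₁.val * m₂.val)
  | pmg => ((-1) ^ c₁.val * c₂.val * m₁.val, 0)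
  | pgg => ((-1) ^ c₁.val * c₂.val * m₁.val,
      (-1) ^ c₁.val * c₂.val * m₁.val + (-1) ^ (c₁.val + c₂.val) * m₁.val * m₂.val)
  | p4g =>
      let s : ℤ := m₁.val
      let d : ℤ × ℤ := (rotGen 4)^[(if m₁ = 0 then c₂ else -c₂).val] (s * m₂.val, s * m₂.val)
      (rotGen 4)^[c₁.val]
        ((if c₂.val = 2 ∨ c₂.val = 3 then s else 0) + d.1,
          (if c₂.val = 1 ∨ c₂.val = 2 then s else 0) + d.2)
  | _ => (0, 0)

variable {W : WallpaperGroup}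

/-- `C ^ a`, conjugated by `M ^ m`: `C ^ a` if `m = 0` and `C ^ (-a)` if `m = 1`. -/
def flip (m : Fin W.mir) (a : Fin W.rot) : Fin W.rot := if m = 0 then a else -a

namespace Elt

instance : One (Elt W) := ⟨⟨0, 0, 0, 0⟩⟩

instance : Mul (Elt W) := ⟨fun g h =>
  ⟨g.x + (lin W g.c g.m (h.x, h.y)).1 + (shift W g.c g.m h.c h.m).1,
    g.y + (lin W g.c g.m (h.x, h.y)).2 + (shift W g.c g.m h.c h.m).2,
    g.c + flip g.m h.c, g.m + h.m⟩⟩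

instance : Inv (Elt W) := ⟨fun g =>
  ⟨-((lin W (-flip g.m g.c) (-g.m) (g.x, g.y)).1 + (shift W (-flip g.m g.c) (-g.m) g.c g.m).1),
    -((lin W (-flip g.m g.c) (-g.m) (g.x, g.y)).2 + (shift W (-flip g.m g.c) (-g.m) g.c g.m).2),
    -flip g.m g.c, -g.m⟩⟩

end Elt

/-- Twice the translation part of `M` as an affine map; the origin is a centre of `C`
(and, without rotations, lies on the axis of `M`). -/
def glide : WallpaperGroup → ℝ × ℝ
  | pg => (0, 1)
  | pmg => (1, 0)
  | pgg => (1, 1)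
  | p4g => (1, 1)
  | _ => (0, 0)

/-- The affine map `M` of the plane. -/
noncomputable def mirAff (W : WallpaperGroup) (v : ℝ × ℝ) : ℝ × ℝ :=
  mirGen W v + (1 / 2 : ℝ) • glide W

/-- The action of the wallpaper group on the plane, in affine coordinates in which `T₁` and `T₂`
are the unit translations. -/
noncomputable instance : SMul (Elt W) (ℝ × ℝ) := ⟨fun g v =>
  ((g.x : ℝ), (g.y : ℝ)) + (rotGen W.rot)^[g.c.val] ((mirAff W)^[g.m.val] v)⟩

theorem smul_def' (g : Elt W) (v : ℝ × ℝ) :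
    g • v = ((g.x : ℝ), (g.y : ℝ)) + (rotGen W.rot)^[g.c.val] ((mirAff W)^[g.m.val] v) := rfl

theorem mul_def' (g h : Elt W) : g * h =
  ⟨g.x + (lin W g.c g.m (h.x, h.y)).1 + (shift W g.c g.m h.c h.m).1,
    g.y + (lin W g.c g.m (h.x, h.y)).2 + (shift W g.c g.m h.c h.m).2,
    g.c + flip g.m h.c, g.m + h.m⟩ := rfl

section groupLaw

theorem rotGen_add {R : Type} [Ring R] (n : ℕ) (u v : R × R) :
    rotGen n (u + v) = rotGen n u + rotGen n v := by
  unfold rotGen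
  split <;> ext <;> simp <;> abel

theorem rotGen_iterate_add {R : Type} [Ring R] (n k : ℕ) (u v : R × R) :
    (rotGen n)^[k] (u + v) = (rotGen n)^[k] u + (rotGen n)^[k] v := by
  induction k generalizing u v with
  | zero => rfl
  | succ k ih => simp only [Function.iterate_succ, Function.comp_apply, rotGen_add, ih]

theorem rotGen_period (W : WallpaperGroup) (v : ℝ × ℝ) : (rotGen W.rot)^[W.rot] v = v := by
  obtain ⟨p, q⟩ := v
  cases W <;> simp [rotGen] <;> ring

theorem rotGen_val_add (a b : Fin W.rot) (v : ℝ × ℝ) :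
    (rotGen W.rot)^[(a + b).val] v = (rotGen W.rot)^[a.val] ((rotGen W.rot)^[b.val] v) := by
  have h : Function.IsPeriodicPt (rotGen W.rot) W.rot v := rotGen_period W v
  rw [Fin.val_add, h.iterate_mod_apply, Function.iterate_add_apply]

/-- The inclusion of the integral points in the plane. -/
def castP (v : ℤ × ℤ) : ℝ × ℝ := ((v.1 : ℝ), (v.2 : ℝ))

theorem castP_add (u v : ℤ × ℤ) : castP (u + v) = castP u + castP v := by
  simp [castP]

theorem castP_rotGen (n : ℕ) (v : ℤ × ℤ) : castP (rotGen n v) = rotGen n (castP v) := by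
  unfold rotGen
  split <;> simp [castP]

theorem castP_rotGen_iterate (n k : ℕ) (v : ℤ × ℤ) :
    castP ((rotGen n)^[k] v) = (rotGen n)^[k] (castP v) := by
  induction k generalizing v with
  | zero => rfl
  | succ k ih => simp only [Function.iterate_succ, Function.comp_apply, ih, castP_rotGen]

theorem shift_eq (c : Fin W.rot) (m : Fin W.mir) (c' : Fin W.rot) (m' : Fin W.mir) :
    shift W c m c' m' = (rotGen W.rot)^[c.val] (shift W 0 m c' m') := by
  cases W
  case pmg => fin_cases c <;> simp [shift, rotGen]
  case pgg => fin_cases c <;> simp [shift, rotGen, pow_succ, pow_add]; ring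
  case p4g => simp [shift]
  all_goals fin_cases c <;> simp [shift, rotGen]

theorem mirAff_iterate (m m' : Fin W.mir) (c' : Fin W.rot) (t : ℤ × ℤ) (v : ℝ × ℝ) :
    (mirAff W)^[m.val] (castP t + (rotGen W.rot)^[c'.val] ((mirAff W)^[m'.val] v)) =
      castP ((mirGen W)^[m.val] t + shift W 0 m c' m') +
        (rotGen W.rot)^[(flip m c').val] ((mirAff W)^[(m + m').val] v) := by
  obtain ⟨a, b⟩ := t
  obtain ⟨p, q⟩ := v
  cases W <;> fin_cases m <;> fin_cases c' <;> fin_cases m' <;>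
    simp [castP, shift, rotGen, mirGen, mirAff, glide, flip, Fin.val_neg', rot, mir]
  all_goals first | ring1 | (constructor <;> ring1)

theorem mul_smul' (g h : Elt W) (v : ℝ × ℝ) : (g * h) • v = g • (h • v) := by
  have h1 := mirAff_iterate g.m h.m h.c (h.x, h.y) v
  have h2 : h • v = castP (h.x, h.y) + (rotGen W.rot)^[h.c.val] ((mirAff W)^[h.m.val] v) := rfl
  have h3 : (g * h) • v = castP (g.x, g.y) + castP (lin W g.c g.m (h.x, h.y)) +
      castP (shift W g.c g.m h.c h.m) +
        (rotGen W.rot)^[(g.c + flip g.m h.c).val] ((mirAff W)^[(g.m + h.m).val] v) := by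
    rw [smul_def', mul_def']
    simp [castP]
  rw [smul_def' g, h2, h1, h3, rotGen_val_add, rotGen_iterate_add, castP_add, rotGen_iterate_add,
    ← castP_rotGen_iterate, ← castP_rotGen_iterate, ← shift_eq]
  simp only [lin, castP]
  abel

theorem flip_flip (m m' : Fin W.mir) (a : Fin W.rot) :
    flip m (flip m' a) = flip (m + m') a := by
  cases W <;> fin_cases m <;> fin_cases m' <;> simp [flip]

theorem flip_add (m : Fin W.mir) (a b : Fin W.rot) : flip m (a + b) = flip m a + flip m b := by
  unfold flip
  split <;> abel

theorem flip_neg_cancel (m : Fin W.mir) (a : Fin W.rot) : -flip m a + flip (-m) a = 0 := by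
  cases W <;> fin_cases m <;> simp [flip]

/-- The wallpaper group. -/
instance : Group (Elt W) := Group.ofLeftAxioms
  (by
    intro a b d
    have hc : (a * b * d).c = (a * (b * d)).c := by
      simp only [mul_def', flip_add, flip_flip]
      abel
    have hm : (a * b * d).m = (a * (b * d)).m := by
      simp only [mul_def']
      abel
    have h : (a * b * d) • (0 : ℝ × ℝ) = (a * (b * d)) • (0 : ℝ × ℝ) := by
      simp only [mul_smul']
    rw [smul_def', smul_def', hc, hm, add_left_inj, Prod.mk.injEq] at h
    exact Elt.ext (Int.cast_injective h.1) (Int.cast_injective h.2) hc hm)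
  (by
    intro a
    change (⟨0, 0, 0, 0⟩ : Elt W) * a = a
    rw [mul_def']
    have h : shift W 0 0 a.c a.m = (0, 0) := by
      cases W
      case p4g =>
        have h0 : ∀ k : ℕ, (rotGen 4)^[k] ((0, 0) : ℤ × ℤ) = (0, 0) := fun k =>
          Function.iterate_fixed (by simp [rotGen]) k
        simp [shift, h0]
      all_goals simp [shift]
    ext <;> simp [lin, flip, h])
  (by
    intro a
    change _ = (⟨0, 0, 0, 0⟩ : Elt W)
    change (⟨_, _, _, _⟩ : Elt W) * a = _
    rw [mul_def']
    refine Elt.ext ?_ ?_ ?_ ?_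
    · change -(_ + _) + _ + _ = (0 : ℤ)
      ring
    · change -(_ + _) + _ + _ = (0 : ℤ)
      ring
    · exact flip_neg_cancel a.m a.c
    · exact neg_add_cancel a.m)

theorem one_def' : (1 : Elt W) = ⟨0, 0, 0, 0⟩ := rfl

noncomputable instance : MulAction (Elt W) (ℝ × ℝ) where
  one_smul v := by
    simp [smul_def', one_def']
  mul_smul := mul_smul'

end groupLaw

/-! ### Cohomology -/

section cohomology

/-- The orientation character: `-1` on the orientation-reversing elements. -/
def orient (W : WallpaperGroup) : Elt W →* ℤˣ where
  toFun g := (-1) ^ g.m.val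
  map_one' := by simp [one_def']
  map_mul' g h := by
    obtain ⟨_, _, _, m⟩ := g
    obtain ⟨_, _, _, m'⟩ := h
    rw [mul_def']
    cases W <;> fin_cases m <;> fin_cases m' <;> simp

/-- The abelian group `A` with orientation-reversing elements acting by negation. -/
def twist (W : WallpaperGroup) (A : Type) [AddCommGroup A] : Representation ℤ (Elt W) A where
  toFun g := ((orient W g : ℤˣ) : ℤ) • LinearMap.id
  map_one' := by ext; simp
  map_mul' g h := by ext; simp [mul_smul]

/-- An additive map, as a morphism of twisted modules. -/
def twistMap (W : WallpaperGroup) {A B : Type} [AddCommGroup A] [AddCommGroup B] (f : A →+ B) :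
    Rep.of (twist W A) ⟶ Rep.of (twist W B) :=
  Rep.ofHom ⟨f.toIntLinearMap, fun g => by ext; simp [twist]⟩

/-- The exponential sequence `0 → ℤ_ρ → ℝ_ρ → U(1)_ρ → 0`, with `U(1)` written additively as
`ℝ / ℤ`, so that complex conjugation is negation. -/
def expSeq (W : WallpaperGroup) : ShortComplex (Rep ℤ (Elt W)) where
  X₁ := Rep.of (twist W ℤ)
  X₂ := Rep.of (twist W ℝ)
  X₃ := Rep.of (twist W UnitAddCircle)
  f := twistMap W (Int.castAddHom ℝ)
  g := twistMap W (QuotientAddGroup.mk' (AddSubgroup.zmultiples (1 : ℝ)))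
  zero := by
    refine Rep.hom_ext (Representation.IntertwiningMap.ext (LinearMap.ext fun n => ?_))
    exact (AddCircle.coe_eq_zero_iff (1 : ℝ)).2 ⟨n, zsmul_one n⟩

theorem exact_of_forall {k G : Type} [CommRing k] [Group G] (S : ShortComplex (Rep.{0} k G))
    (h : ∀ x : S.X₂, S.g.hom x = 0 → ∃ y : S.X₁, S.f.hom y = x) : S.Exact := by
  rw [← ShortComplex.exact_map_iff_of_faithful _ (forget₂ (Rep.{0} k G) (ModuleCat.{0} k)),
    ShortComplex.moduleCat_exact_iff]
  exact h

theorem expSeq_shortExact (W : WallpaperGroup) : (expSeq W).ShortExact where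
  exact := exact_of_forall _ fun x hx => by
    obtain ⟨n, hn⟩ := (AddCircle.coe_eq_zero_iff (1 : ℝ) (x := x)).1 hx
    exact ⟨n, (zsmul_one n).symm.trans hn⟩
  mono_f := (Rep.mono_iff_injective _).2 fun _ _ h => Int.cast_injective (α := ℝ) h
  epi_g := (Rep.epi_iff_surjective _).2 fun a =>
    QuotientAddGroup.mk'_surjective (AddSubgroup.zmultiples (1 : ℝ)) a

/-- The trivial module `ℤ/2`. -/
abbrev Z2 (W : WallpaperGroup) : Rep ℤ (Elt W) := Rep.trivial ℤ (Elt W) (ZMod 2)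

/-- The inclusion of `ℤ/2 = {1, -1}` in `U(1)_ρ`. -/
noncomputable def incl (W : WallpaperGroup) : Z2 W ⟶ Rep.of (twist W UnitAddCircle) :=
  Rep.ofHom ⟨(ZMod.toAddCircle (N := 2)).toIntLinearMap, fun g => by
    ext a
    change ZMod.toAddCircle (N := 2) a = ((orient W g : ℤˣ) : ℤ) • ZMod.toAddCircle (N := 2) a
    rcases Int.units_eq_one_or (orient W g) with h | h
    · simp [h]
    · have h2 : -a = a := by revert a; decide
      rw [h, Units.val_neg, Units.val_one, neg_smul, one_smul, ← map_neg, h2]⟩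

/-- The map `H²(G_s, ℤ/2) → H²(G_s, U(1)_ρ)` induced by the inclusion of coefficients. -/
noncomputable def iTilde (W : WallpaperGroup) :
    groupCohomology (Z2 W) 2 ⟶ groupCohomology (Rep.of (twist W UnitAddCircle)) 2 :=
  (groupCohomology.functor ℤ (Elt W) 2).map (incl W)

/-- The Bockstein homomorphism `H²(G_s, U(1)_ρ) → H³(G_s, ℤ_ρ)` of the exponential sequence;
its target is the Borel cohomology group `H²_Borel(G_s, U(1)_ρ) = H³(G_s, ℤ_ρ)`. -/
noncomputable def bockstein (W : WallpaperGroup) :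
    groupCohomology (Rep.of (twist W UnitAddCircle)) 2 ⟶
      groupCohomology (Rep.of (twist W ℤ)) 3 :=
  groupCohomology.δ (expSeq_shortExact W) 2 3 rfl

/-- The kernel of `H²(G_s, ℤ/2) → H²_Borel(G_s, U(1)_ρ) = H³(G_s, ℤ_ρ)`. -/
noncomputable def kerITilde (W : WallpaperGroup) : AddSubgroup (groupCohomology (Z2 W) 2) :=
  (iTilde W ≫ bockstein W).hom.toAddMonoidHom.ker

/-- The class of a 2-cocycle. -/
noncomputable def cls (f : groupCohomology.cocycles₂ (Z2 W)) : groupCohomology (Z2 W) 2 :=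
  (groupCohomology.H2π (Z2 W)).hom f

/-- The `{1, -1}`-valued cochain `ω = (-1) ^ f`. -/
def sgn (f : Elt W × Elt W → ZMod 2) : Elt W × Elt W → ℤˣ := fun p => (-1) ^ (f p)

end cohomology

/-! ### Topological invariants -/

section invariants

/-- The kinds of topological invariants; see `TopInv.eval` and `TopInv.regions`. -/
inductive TopInv (W : WallpaperGroup) : Type
  /-- a two-fold rotation `g` -/
  | rotation (g : Elt W)
  /-- a mirror `m` and a translation `t` along its axis -/
  | axis (t m : Elt W)
  /-- two independent translations -/
  | cell (t₁ t₂ : Elt W)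
  /-- a translation `t` and a glide reflection `s` with `s⁻¹ * t * s * t = 1` -/
  | glideCell (t s : Elt W)
  /-- a mirror `m` -/
  | mirror (m : Elt W)

/-- The value `α[ω]` of a topological invariant. -/
def TopInv.eval (ω : Elt W × Elt W → ℤˣ) : TopInv W → ℤˣ
  | rotation g => ω (g, g) / ω (1, 1)
  | axis t m => ω (t, m) / ω (m, t)
  | cell t₁ t₂ => ω (t₁, t₂) / ω (t₂, t₁)
  | glideCell t s => (ω (t * s⁻¹, t * s) * ω (t, s)) / (ω (s⁻¹, s) * ω (t, s⁻¹))
  | mirror m => ω (m, m) / ω (1, 1)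

/-- All kinds except the mirror-type invariants belong to Lieb-Schultz-Mattis constraints. -/
def TopInv.IsLSM : TopInv W → Prop
  | mirror _ => False
  | _ => True

/-- The half-open parallelogram with corner `p` and edges `u`, `v`. -/
def parallelogram (p u v : ℝ × ℝ) : Set (ℝ × ℝ) :=
  {q | ∃ a ∈ Set.Ico (0 : ℝ) 1, ∃ b ∈ Set.Ico (0 : ℝ) 1, q = p + a • u + b • v}

/-- The regions whose total projective representation enters the no-go theorem that belongs to
an invariant: the rotation centre, a translation unit on the mirror axis, a fundamental domain
of the two translations, or of the translation and the glide reflection. -/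
def TopInv.regions : TopInv W → Set (Set (ℝ × ℝ))
  | rotation g => {R | ∃ p : ℝ × ℝ, g • p = p ∧ R = {p}}
  | axis t m => {R | ∃ p : ℝ × ℝ, m • p = p ∧
      R = {q | ∃ a ∈ Set.Ico (0 : ℝ) 1, q = p + a • (t • p - p)}}
  | cell t₁ t₂ => {R | ∃ p : ℝ × ℝ, R = parallelogram p (t₁ • p - p) (t₂ • p - p)}
  | glideCell t s => {R | ∃ p : ℝ × ℝ, R = parallelogram p (t • p - p) (s • p - p)}
  | mirror _ => ∅

/-- The first translation. -/
def T₁ : Elt W := ⟨1, 0, 0, 0⟩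

/-- The second translation. -/
def T₂ : Elt W := ⟨0, 1, 0, 0⟩

/-- The generating rotation. -/
def C : Elt W := ⟨0, 0, 1, 0⟩

/-- The generating mirror or glide reflection. -/
def M : Elt W := ⟨0, 0, 0, 1⟩

/-- The number of listed invariants. -/
abbrev num : WallpaperGroup → ℕ
  | p1 | pg | p3 => 1
  | cm | pgg | p3m1 | p31m | p6 => 2
  | p4 | p4g => 3
  | p2 | pm | pmg | p6m => 4
  | cmm => 5
  | p4m => 6
  | pmm => 8

open TopInv in
/-- The listed invariants `α_i`. -/
def inv : (W : WallpaperGroup) → Fin W.num → TopInv W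
  | p1 => ![cell T₁ T₂]
  | p2 => ![rotation C, rotation (T₁ * C), rotation (T₂ * C), rotation (T₁ * T₂ * C)]
  | pm => ![axis T₂ M, axis T₂ (T₁ * M), mirror M, mirror (T₁ * M)]
  | pg => ![glideCell T₁ M]
  | cm => ![axis (T₁ * T₂) M, mirror M]
  | pmm => ![rotation C, rotation (T₁ * T₂ * C), rotation (T₁ * C), rotation (T₂ * C),
      mirror M, mirror (C * M), mirror (T₁ * M), mirror (T₂ * C * M)]
  | pmg => ![rotation C, rotation (T₁ * T₂ * C), axis T₂ M, mirror M]
  | pgg => ![rotation C, rotation (T₁ * C)]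
  | cmm => ![rotation C, rotation (T₁ * T₂ * C), rotation (T₁ * C), mirror M, mirror (C * M)]
  | p4 => ![rotation (C ^ 2), rotation (T₁ * T₂ * C ^ 2), rotation (T₁ * C ^ 2)]
  | p4m => ![rotation (C ^ 2), rotation (T₁ * T₂ * C ^ 2), rotation (T₁ * C ^ 2),
      mirror M, mirror (T₁ * M), mirror (C * M)]
  | p4g => ![rotation (C ^ 2), rotation (T₁ * C ^ 2), mirror (T₁⁻¹ * M)]
  | p3 => ![cell T₁ T₂]
  | p3m1 => ![cell T₁ T₂, mirror M]
  | p31m => ![axis (T₁ * T₂) M, mirror M]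
  | p6 => ![rotation (C ^ 3), rotation (T₁ * C ^ 3)]
  | p6m => ![rotation (C ^ 3), rotation (T₁ * C ^ 3), mirror M, mirror (C ^ 3 * M)]

end invariants

/-! ### Basis cocycles -/

section basis

/-- `1` if `a = b` and `0` otherwise. -/
def ind (a b : ℤ) : ℤ := if a = b then 1 else 0

/-- The carry `([c₁] + Q(m₁) [c₂] - [c₁ + Q(m₁) c₂]_n) / n`, where `Q(m) = (-1) ^ m`. -/
def carry (n c₁ m₁ c₂ : ℤ) : ℤ :=
  (c₁ + (1 - 2 * m₁) * c₂ - (c₁ + (1 - 2 * m₁) * c₂) % n) / n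

/-- The common part of the cochains of `cm`, `cmm`, `p4`, `p4m`. -/
def swapPart (e y₁ x₂ y₂ : ℤ) : ℤ :=
  (1 - e % 2) * (y₁ * x₂) + e % 2 * (y₂ * (x₂ + y₁))

/-- The second basis cochain of `p6` (with `m₁ = 0`) and `p6m`. -/
def hexPart (y₁ c₁ m₁ x₂ y₂ : ℤ) : ℤ :=
  ind c₁ 0 * ((1 - m₁) * (y₁ * x₂) + m₁ * (y₂ * (x₂ + y₁)))
  + ind c₁ 1 * ((1 - m₁) * (x₂ * (x₂ - 1) / 2 + y₁ * x₂ + y₂ * (x₂ + y₁))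
      + m₁ * (y₂ * (y₂ - 1) / 2 + y₁ * (x₂ + y₂)))
  + ind c₁ 2 * ((1 - m₁) * (y₂ * (y₂ + 1) / 2 + x₂ + y₂ * (x₂ + y₁))
      + m₁ * (x₂ * (x₂ + 1) / 2 + y₂ + y₁ * x₂))
  + ind c₁ 3 * ((1 - m₁) * (x₂ + y₂ + y₁ * x₂) + m₁ * (x₂ + y₂ + y₂ * (x₂ + y₁)))
  + ind c₁ 4 * ((1 - m₁) * (x₂ * (x₂ - 1) / 2 + y₂ + y₁ * x₂ + y₂ * (x₂ + y₁))
      + m₁ * (y₂ * (y₂ - 1) / 2 + x₂ + y₁ * (x₂ + y₂)))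
  + ind c₁ 5 * ((1 - m₁) * (y₂ * (y₂ + 1) / 2 + y₂ * (x₂ + y₁))
      + m₁ * (x₂ * (x₂ + 1) / 2 + y₁ * x₂))

/-- The second basis cochain of `p4g`. -/
def p4gPart (x₂ y₂ c₁ c₂ s₁ s₂ : ℤ) : ℤ :=
  ind c₁ 0 * (s₁ * (ind c₂ 3 + (c₁ - c₂) * s₂))
  + ind c₁ 1 * ((1 - s₁) * y₂ + s₁ * (x₂ + 1 - ind c₂ 0 + (c₁ - c₂) * s₂))
  + ind c₁ 2 * ((1 - s₁) * (x₂ + y₂) + s₁ * (x₂ + y₂ + ind c₂ 1 + (c₁ - c₂) * s₂))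
  + ind c₁ 3 * ((1 - s₁) * x₂ + s₁ * (y₂ + ind c₂ 2 + (c₁ - c₂) * s₂))

/-- Integers whose residues mod 2 are the values at `(g₁, g₂)` of the basis cochains `λ_j`, where
`g_i = T₁ ^ x_i * T₂ ^ y_i * C ^ c_i * M ^ m_i`. -/
def basisInt (y₁ c₁ m₁ x₂ y₂ c₂ m₂ : ℤ) : (W : WallpaperGroup) → Fin W.num → ℤ
  | p1 => ![y₁ * x₂]
  | p2 => ![y₁ * x₂ + c₁ * (x₂ + y₂ + c₂), (y₁ + c₁) * x₂, y₁ * x₂ + c₁ * y₂, y₁ * x₂]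
  | pm => ![y₁ * x₂ + m₁ * y₂, y₁ * x₂, m₁ * (x₂ + m₂), m₁ * x₂]
  | pg => ![m₁ * x₂]
  | cm => ![swapPart m₁ y₁ x₂ y₂, m₁ * m₂]
  | pmm => ![(y₁ + c₁) * x₂ + (c₁ + m₁) * (y₂ + c₂), y₁ * x₂, (y₁ + c₁) * x₂,
      y₁ * x₂ + (c₁ + m₁) * y₂, m₁ * (x₂ + c₂ + m₂), m₁ * (y₂ + c₂), m₁ * x₂, m₁ * y₂]
  | pmg => ![c₁ * (y₂ + c₂), c₁ * y₂, m₁ * y₂, m₁ * m₂]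
  | pgg => ![c₁ * (x₂ + y₂ + c₂) + (c₁ + c₂) * m₁ * m₂ + m₁ * x₂,
      c₁ * (x₂ + y₂) + (c₁ + c₂) * m₁ * m₂ + m₁ * x₂]
  | cmm => ![swapPart m₁ y₁ x₂ y₂ + c₁ * (x₂ + y₂ + c₂ + m₂), swapPart m₁ y₁ x₂ y₂,
      c₁ * (x₂ + y₂), m₁ * (c₂ + m₂), m₁ * c₂]
  | p4 =>
      let l₂ := swapPart c₁ y₁ x₂ y₂
      let l₃ := ind c₁ 1 * x₂ + ind c₁ 2 * (x₂ + y₂) + ind c₁ 3 * y₂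
      ![l₂ + l₃ + carry 4 c₁ 0 c₂, l₂, l₃]
  | p4m =>
      let l₂ := swapPart c₁ y₁ x₂ y₂
      let l₃ := ind c₁ 1 * x₂ + ind c₁ 2 * (x₂ + y₂) + ind c₁ 3 * y₂ + m₁ * y₂
      ![l₂ + l₃ + carry 4 c₁ m₁ c₂, l₂, l₃, m₁ * (x₂ + y₂ + c₂ + m₂), m₁ * (x₂ + y₂), m₁ * c₂]
  | p4g =>
      let l₂ := p4gPart x₂ y₂ c₁ c₂ m₁ m₂
      ![l₂ + carry 4 c₁ m₁ c₂, l₂, m₁ * m₂]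
  | p3 => ![ind c₁ 0 * (y₁ * x₂) + ind c₁ 1 * (y₂ * (y₂ - 1) / 2 + y₂ * (x₂ + y₁))
      + ind c₁ 2 * (x₂ * (x₂ - 1) / 2 + y₁ * x₂ + y₂ * (x₂ + y₁))]
  | p3m1 => ![ind c₁ 0 * ((1 - m₁) * (y₁ * x₂) + m₁ * (y₂ * (x₂ + y₁)))
      + ind c₁ 1 * ((1 - m₁) * (y₂ * (y₂ - 1) / 2 + y₂ * (x₂ + y₁))
        + m₁ * (x₂ * (x₂ + 1) / 2 + y₁ * x₂))
      + ind c₁ 2 * ((1 - m₁) * (x₂ * (x₂ - 1) / 2 + y₁ * x₂ + y₂ * (x₂ + y₁))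
        + m₁ * (y₂ * (y₂ + 1) / 2 + y₁ * (x₂ + y₂))),
      m₁ * m₂]
  | p31m => ![ind c₁ 0 * ((1 - m₁) * (y₁ * x₂) + m₁ * (y₂ * (x₂ + y₁)))
      + ind c₁ 1 * ((1 - m₁) * (y₂ * (y₂ + 1) / 2 + x₂ + y₂ * (x₂ + y₁))
        + m₁ * (x₂ * (x₂ + 1) / 2 + y₂ + y₁ * x₂))
      + ind c₁ 2 * ((1 - m₁) * (x₂ * (x₂ - 1) / 2 + y₂ + y₁ * x₂ + y₂ * (x₂ + y₁))
        + m₁ * (y₂ * (y₂ - 1) / 2 + x₂ + y₁ * (x₂ + y₂))),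
      m₁ * m₂]
  | p6 => ![hexPart y₁ c₁ 0 x₂ y₂ + carry 6 c₁ 0 c₂, hexPart y₁ c₁ 0 x₂ y₂]
  | p6m => ![hexPart y₁ c₁ m₁ x₂ y₂ + carry 6 c₁ m₁ c₂, hexPart y₁ c₁ m₁ x₂ y₂,
      m₁ * (c₂ + m₂), m₁ * c₂]

/-- The basis cochains `λ_j`. -/
def lam (W : WallpaperGroup) (j : Fin W.num) : Elt W × Elt W → ZMod 2 := fun p =>
  (basisInt p.1.y p.1.c.val p.1.m.val p.2.x p.2.y p.2.c.val p.2.m.val W j : ℤ)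

end basis

/-! ### Lattice homotopy -/

section latticeHomotopy

/-- The symmetric, locally finite distributions of degrees of freedom in the plane; `σ p` is the
total projective representation (trivial or nontrivial) at the point `p`, and addition is
stacking. -/
def Distribution (W : WallpaperGroup) : AddSubgroup (ℝ × ℝ → ZMod 2) where
  carrier := {σ | (∀ (g : Elt W) (p : ℝ × ℝ), σ (g • p) = σ p) ∧
    ∀ K : Set (ℝ × ℝ), IsCompact K → (K ∩ Function.support σ).Finite}
  zero_mem' := ⟨fun _ _ => rfl, fun K _ => by simp⟩
  add_mem' := by
    rintro σ τ ⟨h1, h2⟩ ⟨h3, h4⟩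
    refine ⟨fun g p => by simp [h1 g p, h3 g p], fun K hK => ?_⟩
    refine ((h2 K hK).union (h4 K hK)).subset ?_
    rw [← Set.inter_union_distrib_left]
    exact Set.inter_subset_inter_right _ (Function.support_add σ τ)
  neg_mem' := by
    rintro σ ⟨h1, h2⟩
    exact ⟨fun g p => by simp [h1 g p], fun K hK => by simpa using h2 K hK⟩

/-- `σ` can be deformed to `τ`: there is a set `ι` of degrees of freedom, each carrying the
nontrivial projective representation, which is permuted by the wallpaper group and moves along
continuous paths in a symmetric and locally finite way; the initial (final) positions, counted
mod 2, give `σ` (`τ`). -/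
def Deforms (W : WallpaperGroup) (σ τ : ℝ × ℝ → ZMod 2) : Prop :=
  ∃ (ι : Type) (_ : MulAction (Elt W) ι) (γ : ι → unitInterval → ℝ × ℝ),
    (∀ i, Continuous (γ i)) ∧
    (∀ (g : Elt W) (i : ι) (t : unitInterval), γ (g • i) t = g • γ i t) ∧
    (∀ K : Set (ℝ × ℝ), IsCompact K → {i | ∃ t, γ i t ∈ K}.Finite) ∧
    (∀ p, σ p = ({i | γ i 0 = p}.ncard : ZMod 2)) ∧
    (∀ p, τ p = ({i | γ i 1 = p}.ncard : ZMod 2))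

/-- The group `A_LH` of lattice homotopy classes: distributions up to deformation. -/
abbrev LatticeHomotopy (W : WallpaperGroup) : Type :=
  Distribution W ⧸ AddSubgroup.closure
    {δ : Distribution W | ∃ σ τ : Distribution W, Deforms W σ τ ∧ δ = σ - τ}

/-- The lattice homotopy class of a distribution. -/
def lhClass (σ : Distribution W) : LatticeHomotopy W := QuotientAddGroup.mk σ

end latticeHomotopy

end WallpaperGroup

namespace WallpaperGroup

variable {W : WallpaperGroup}

/-! ### Normal forms and generation -/

/-! A class in `H²(G_s, ℤ/2)` is a double cover of `G_s`, and triviality of an invariant says that a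
certain relation of `G_s` (an involution squares to one, two elements commute, a glide relation)
holds for all lifts. If all listed invariants are trivial, the generators have lifts that satisfy
the defining relations (`hasLifts`). Such lifts make the normal form a homomorphic section
(`Relations.sec_mul`), and its fibre component is a primitive of the cocycle
(`TwistedCocycle.exists_primitive`). So the invariants separate classes. The explicit cochains `lam`
are cocycles (`lam_mem_cocycles₂`) and are dual to the invariants (`val_lam`), so the invariants are
coordinates on the cohomology (`valEquiv`).

For the kernel, the long exact sequence shows that a class dies exactly when, in `U(1)_ρ`, it is a
coboundary away from the reduction of a real cocycle `r` (`cls_mem_kerITilde_iff`). At an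
orientation-reversing involution `g` the twisted cocycle identity forces `r(g, g) = -r(1, 1)`, so
mirror-type invariants vanish on the kernel. Conversely, a basis cocycle of LSM type becomes
cohomologous in `ℤ/16 ⊂ U(1)` to an integral multiple of the area cocycle, the determinant of
(doubled) translation parts, which visibly lifts to the reals. This is again proved by lifting
generators, now to a twisted extension by `ℤ/16` (`areaDefect_relations`). Hence the kernel is
`(ℤ/2)^k`, with one factor for each LSM-type invariant.

For lattice homotopy, the sum of a distribution over a region is invariant under deformation
(`regionSum_eq_of_deforms`). Labels that are not fixed by the rotation or the mirror of the region
cancel in pairs. What remains either stays at the centre, or is counted by a fundamental domain of a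
group acting on the axis or on the plane. Distributions are sums of orbits modulo homotopy, and
every orbit can be moved to base points of regions (`lhClass_orbitDist_mem_centreSpan`): the labels
are the cosets of a Sylow 2-subgroup of the stabilizer, so that each point is covered an odd number
of times, and they travel in the fixed set of that subgroup. The orbits of the base points are dual
to the regions (`regionSum_centre`), so `A_LH` is also `(ℤ/2)^k` with the same index set. Matching
coordinates gives `Φ`. -/

theorem shift_zero_zero (c : Fin W.rot) (m : Fin W.mir) : shift W 0 0 c m = (0, 0) := by
  cases W
  case p4g =>
    have h0 : ∀ k : ℕ, (rotGen 4)^[k] ((0, 0) : ℤ × ℤ) = (0, 0) := fun k =>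
      Function.iterate_fixed (by simp [rotGen]) k
    simp [shift, h0]
  all_goals simp [shift]

theorem rotGen_iterate_zero {R : Type} [Ring R] (n k : ℕ) :
    (rotGen n)^[k] ((0, 0) : R × R) = (0, 0) :=
  Function.iterate_fixed (by unfold rotGen; split <;> simp) k

theorem shift_zero_left (c : Fin W.rot) (c' : Fin W.rot) (m : Fin W.mir) :
    shift W c 0 c' m = (0, 0) := by
  rw [shift_eq, shift_zero_zero, rotGen_iterate_zero]

theorem shift_zero_right (c : Fin W.rot) (m : Fin W.mir) : shift W c m 0 0 = (0, 0) := by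
  rw [shift_eq]
  have : shift W 0 m 0 0 = (0, 0) := by
    cases W <;> fin_cases m <;> simp [shift]
  rw [this, rotGen_iterate_zero]

theorem mirGen_add {R : Type} [Ring R] (W : WallpaperGroup) (u v : R × R) :
    mirGen W (u + v) = mirGen W u + mirGen W v := by
  unfold mirGen
  split <;> ext <;> simp <;> abel

theorem flip_zero (a : Fin W.rot) : flip (0 : Fin W.mir) a = a := by simp [flip]

theorem flip_zero_right (m : Fin W.mir) : flip m (0 : Fin W.rot) = 0 := by simp [flip]

theorem lin_zero {R : Type} [Ring R] (v : R × R) : lin W 0 0 v = v := by simp [lin]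

/-- The translations, as a homomorphism. -/
def transHom (W : WallpaperGroup) : Multiplicative (ℤ × ℤ) →* Elt W where
  toFun v := ⟨v.toAdd.1, v.toAdd.2, 0, 0⟩
  map_one' := rfl
  map_mul' u v := by
    rw [mul_def']
    ext <;> simp [lin_zero, shift_zero_zero, flip_zero]

theorem T₁_zpow (x : ℤ) : (T₁ : Elt W) ^ x = ⟨x, 0, 0, 0⟩ := by
  have h := map_zpow (transHom W) (Multiplicative.ofAdd (1, 0)) x
  rw [show (transHom W) (Multiplicative.ofAdd (1, 0)) = T₁ from rfl] at h
  rw [← h, ← ofAdd_zsmul]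
  simp [transHom]

theorem T₂_zpow (y : ℤ) : (T₂ : Elt W) ^ y = ⟨0, y, 0, 0⟩ := by
  have h := map_zpow (transHom W) (Multiplicative.ofAdd (0, 1)) y
  rw [show (transHom W) (Multiplicative.ofAdd (0, 1)) = T₂ from rfl] at h
  rw [← h, ← ofAdd_zsmul]
  simp [transHom]

theorem lin_origin {R : Type} [Ring R] (c : Fin W.rot) (m : Fin W.mir) :
    lin W c m ((0, 0) : R × R) = (0, 0) := by
  have h : (mirGen W)^[m.val] ((0, 0) : R × R) = (0, 0) :=
    Function.iterate_fixed (by unfold mirGen; split <;> simp) _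
  rw [lin, h, rotGen_iterate_zero]

theorem C_pow (k : ℕ) : (C : Elt W) ^ k = ⟨0, 0, Fin.ofNat W.rot k, 0⟩ := by
  induction k with
  | zero => rfl
  | succ k ih =>
    have h : Fin.ofNat W.rot k + 1 = Fin.ofNat W.rot (k + 1) := by
      ext
      simp [Fin.val_add]
    rw [pow_succ, ih, C, mul_def', ← h]
    ext1 <;> simp only [shift_zero_left, lin_origin, flip_zero, add_zero]

theorem M_pow_val (m : Fin W.mir) : (M : Elt W) ^ m.val = ⟨0, 0, 0, m⟩ := by
  have hm : m.val < 2 := m.isLt.trans_le (by cases W <;> decide)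
  rcases (by omega : m.val = 0 ∨ m.val = 1) with h | h
  · rw [h, pow_zero, one_def']
    congr
    exact Fin.ext h.symm
  · rw [h, pow_one, M]
    have h1 : (1 : Fin W.mir) = m := by
      ext
      rw [h, Fin.val_one', Nat.mod_eq_of_lt (h ▸ m.isLt)]
    rw [h1]

theorem eq_normalForm (g : Elt W) :
    g = T₁ ^ g.x * T₂ ^ g.y * C ^ g.c.val * M ^ g.m.val := by
  rw [T₁_zpow, T₂_zpow, C_pow, M_pow_val, Fin.ofNat_val_eq_self]
  simp only [mul_def', lin_zero, shift_zero_left, lin_origin, flip_zero, flip_zero_right,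
    zero_add, add_zero]

/-- A subgroup that contains the generators is everything. -/
theorem mem_of_generators (H : Subgroup (Elt W)) (h₁ : T₁ ∈ H) (h₂ : T₂ ∈ H) (hc : C ∈ H)
    (hm : M ∈ H) (g : Elt W) : g ∈ H := by
  rw [eq_normalForm g]
  exact H.mul_mem (H.mul_mem (H.mul_mem (H.zpow_mem h₁ _) (H.zpow_mem h₂ _)) (H.pow_mem hc _))
    (H.pow_mem hm _)

/-! ### The defining relations -/

section relations

variable {K : Type} [Group K]

/-- `t₁ ^ x * t₂ ^ y`. -/
def trans (t₁ t₂ : K) (v : ℤ × ℤ) : K := t₁ ^ v.1 * t₂ ^ v.2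

/-- The defining relations of the wallpaper group. -/
structure Relations (W : WallpaperGroup) (t₁ t₂ c m : K) : Prop where
  comm : t₁ * t₂ = t₂ * t₁
  rot_t₁ : c * t₁ = trans t₁ t₂ (rotGen W.rot (1, 0)) * c
  rot_t₂ : c * t₂ = trans t₁ t₂ (rotGen W.rot (0, 1)) * c
  rot_pow : c ^ W.rot = 1
  mir_t₁ : m * t₁ = trans t₁ t₂ (mirGen W (1, 0)) * m
  mir_t₂ : m * t₂ = trans t₁ t₂ (mirGen W (0, 1)) * m
  mir_pow : m ^ W.mir = trans t₁ t₂ (shift W 0 1 0 1)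
  mir_rot : m * c = trans t₁ t₂ (shift W 0 1 1 0) *
    c ^ (flip (1 : Fin W.mir) (1 : Fin W.rot)).val * m

theorem trans_add {t₁ t₂ : K} (h : t₁ * t₂ = t₂ * t₁) (u v : ℤ × ℤ) :
    trans t₁ t₂ (u + v) = trans t₁ t₂ u * trans t₁ t₂ v := by
  have h' : Commute (t₂ ^ u.2) (t₁ ^ v.1) :=
    (Commute.zpow_zpow (show Commute t₁ t₂ from h) _ _).symm
  simp only [trans, Prod.fst_add, Prod.snd_add, zpow_add]
  rw [mul_assoc, mul_assoc, ← mul_assoc (t₁ ^ v.1), ← h'.eq, mul_assoc]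

theorem trans_zero (t₁ t₂ : K) : trans t₁ t₂ (0, 0) = 1 := by simp [trans]

/-- `trans` as a homomorphism. -/
def transMonoidHom {t₁ t₂ : K} (h : t₁ * t₂ = t₂ * t₁) : Multiplicative (ℤ × ℤ) →* K where
  toFun v := trans t₁ t₂ v.toAdd
  map_one' := trans_zero t₁ t₂
  map_mul' u v := trans_add h u.toAdd v.toAdd

/-- Conjugation by `c` is a homomorphism, so on the commuting pair `t₁`, `t₂` it is determined by
its values on the two generators. -/
theorem trans_conj {t₁ t₂ c : K} (h : t₁ * t₂ = t₂ * t₁) (L : ℤ × ℤ →+ ℤ × ℤ)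
    (h₁ : c * t₁ = trans t₁ t₂ (L (1, 0)) * c) (h₂ : c * t₂ = trans t₁ t₂ (L (0, 1)) * c)
    (v : ℤ × ℤ) : c * trans t₁ t₂ v = trans t₁ t₂ (L v) * c := by
  obtain ⟨a, b⟩ := v
  have hz (u : ℤ × ℤ) (k : ℤ) : trans t₁ t₂ u ^ k = trans t₁ t₂ (k • u) :=
    (map_zpow (transMonoidHom h) (Multiplicative.ofAdd u) k).symm
  have e : ((a, b) : ℤ × ℤ) = a • (1, 0) + b • (0, 1) := by simp
  have h₁' : c * t₁ * c⁻¹ = trans t₁ t₂ (L (1, 0)) := by rw [h₁, mul_inv_cancel_right]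
  have h₂' : c * t₂ * c⁻¹ = trans t₁ t₂ (L (0, 1)) := by rw [h₂, mul_inv_cancel_right]
  rw [← mul_inv_eq_iff_eq_mul, e, map_add, map_zsmul, map_zsmul, trans_add h, trans_add h, ← hz, ← hz,
    ← hz, ← hz, ← h₁', ← h₂', conj_zpow, conj_zpow]
  simp [trans, mul_assoc]

variable {t₁ t₂ c m : K}

/-- The linear part of the rotation, as an additive map. -/
def rotGenHom (n : ℕ) : ℤ × ℤ →+ ℤ × ℤ :=
  AddMonoidHom.mk' (rotGen n) (rotGen_add n)

/-- The linear part of the reflection, as an additive map. -/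
def mirGenHom (W : WallpaperGroup) : ℤ × ℤ →+ ℤ × ℤ :=
  AddMonoidHom.mk' (mirGen W) (mirGen_add W)

theorem pow_mul_trans {d : K} (L : ℤ × ℤ →+ ℤ × ℤ)
    (h : ∀ v, d * trans t₁ t₂ v = trans t₁ t₂ (L v) * d) (k : ℕ) (v : ℤ × ℤ) :
    d ^ k * trans t₁ t₂ v = trans t₁ t₂ (L^[k] v) * d ^ k := by
  induction k generalizing v with
  | zero => simp
  | succ k ih => rw [pow_succ, mul_assoc, h, ← mul_assoc, ih, Function.iterate_succ_apply, mul_assoc]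

namespace Relations

theorem rot_trans (r : Relations W t₁ t₂ c m) (k : ℕ) (v : ℤ × ℤ) :
    c ^ k * trans t₁ t₂ v = trans t₁ t₂ ((rotGen W.rot)^[k] v) * c ^ k :=
  pow_mul_trans (rotGenHom W.rot) (trans_conj r.comm (rotGenHom W.rot) r.rot_t₁ r.rot_t₂) k v

theorem mir_trans (r : Relations W t₁ t₂ c m) (k : ℕ) (v : ℤ × ℤ) :
    m ^ k * trans t₁ t₂ v = trans t₁ t₂ ((mirGen W)^[k] v) * m ^ k :=
  pow_mul_trans (mirGenHom W) (trans_conj r.comm (mirGenHom W) r.mir_t₁ r.mir_t₂) k v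

theorem lin_trans (r : Relations W t₁ t₂ c m) (a : Fin W.rot) (b : Fin W.mir) (v : ℤ × ℤ) :
    c ^ a.val * m ^ b.val * trans t₁ t₂ v = trans t₁ t₂ (lin W a b v) * (c ^ a.val * m ^ b.val) := by
  rw [mul_assoc, r.mir_trans, ← mul_assoc, r.rot_trans, mul_assoc, lin]

theorem pow_val_add (r : Relations W t₁ t₂ c m) (a b : Fin W.rot) :
    c ^ (a + b).val = c ^ a.val * c ^ b.val := by
  rw [Fin.val_add, ← pow_add]
  conv_rhs => rw [← Nat.div_add_mod (a.val + b.val) W.rot, pow_add, pow_mul, r.rot_pow, one_pow,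
    one_mul]

variable (t₁ t₂ c m) in
/-- The element with a given normal form. -/
def sec (g : Elt W) : K := trans t₁ t₂ (g.x, g.y) * (c ^ g.c.val * m ^ g.m.val)

theorem sec_one : sec t₁ t₂ c m (1 : Elt W) = 1 := by simp [sec, one_def', trans]

theorem m_eq_zero_or (b : Fin W.mir) : b = 0 ∨ (b = 1 ∧ W.mir = 2) := by
  cases W <;> fin_cases b <;> simp

/-- The right factors `h` that work for every `g` form a subgroup, so only the four generators need
checking. Each of them uses only the relations that move one letter through a normal form. -/
theorem sec_mul (r : Relations W t₁ t₂ c m) (g h : Elt W) :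
    sec t₁ t₂ c m (g * h) = sec t₁ t₂ c m g * sec t₁ t₂ c m h := by
  let H : Subgroup (Elt W) :=
    { carrier := {h | ∀ g, sec t₁ t₂ c m (g * h) = sec t₁ t₂ c m g * sec t₁ t₂ c m h}
      one_mem' := fun g => by rw [mul_one, sec_one, mul_one]
      mul_mem' := fun {a b} ha hb g => by rw [← mul_assoc, hb, ha, hb, mul_assoc]
      inv_mem' := fun {a} ha => by
        have h1 (g : Elt W) : sec t₁ t₂ c m (g * a⁻¹) = sec t₁ t₂ c m g * (sec t₁ t₂ c m a)⁻¹ := by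
          rw [eq_mul_inv_iff_mul_eq, ← ha, inv_mul_cancel_right]
        intro g
        rw [h1, ← one_mul a⁻¹, h1, sec_one, one_mul] }
  refine mem_of_generators H ?_ ?_ ?_ ?_ h g
  · rintro ⟨x, y, a, b⟩
    have := r.lin_trans a b (1, 0)
    simp only [T₁, mul_def', sec, shift_zero_right, flip_zero_right, add_zero, mul_assoc] at this ⊢
    rw [← Prod.mk_add_mk, trans_add r.comm, Prod.mk.eta, mul_assoc, ← this]
    simp [trans, mul_assoc]
  · rintro ⟨x, y, a, b⟩
    have := r.lin_trans a b (0, 1)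
    simp only [T₂, mul_def', sec, shift_zero_right, flip_zero_right, add_zero, mul_assoc] at this ⊢
    rw [← Prod.mk_add_mk, trans_add r.comm, Prod.mk.eta, mul_assoc, ← this]
    simp [trans, mul_assoc]
  · rintro ⟨x, y, a, b⟩
    -- In groups without rotations `1 : Fin 1` has value zero; then `rot_pow` says `c = 1`, and the
    -- equality still holds.
    have e1 : sec t₁ t₂ c m (C : Elt W) = c := by
      have h := r.rot_pow
      rw [sec, C, trans_zero, Fin.val_zero, pow_zero, mul_one, one_mul, Fin.val_one']
      conv_rhs => rw [← pow_one c, ← Nat.div_add_mod 1 W.rot, pow_add, pow_mul, h, one_pow, one_mul]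
    rw [e1]
    simp only [C, mul_def', sec, lin_origin, add_zero]
    rw [← Prod.mk_add_mk, trans_add r.comm, Prod.mk.eta, r.pow_val_add]
    rcases m_eq_zero_or b with rfl | ⟨rfl, h2⟩
    · rw [shift_zero_left, trans_zero, flip_zero]
      have : c ^ (1 : Fin W.rot).val = c := by simpa [sec, C, trans_zero] using e1
      simp only [this, mul_assoc, Fin.val_zero, pow_zero, mul_one]
    · have hv : (1 : Fin W.mir).val = 1 := by rw [Fin.val_one', h2]
      have := r.rot_trans a.val (shift W 0 1 1 0)
      rw [shift_eq]
      simp only [hv, pow_one, mul_assoc]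
      rw [r.mir_rot, ← mul_assoc (trans t₁ t₂ ((rotGen W.rot)^[a.val] _)), ← this]
      simp only [mul_assoc]
  · rintro ⟨x, y, a, b⟩
    rcases m_eq_zero_or b with rfl | ⟨rfl, h2⟩
    · simp [M, mul_def', sec, shift_zero_left, lin_origin, flip_zero, trans_zero, mul_assoc]
    · have hv : (1 : Fin W.mir).val = 1 := by rw [Fin.val_one', h2]
      have h11 : (1 + 1 : Fin W.mir).val = 0 := by rw [Fin.val_add, hv, h2]
      have hp : m * m = _ := (pow_two m ▸ congrArg (m ^ ·) h2).symm.trans r.mir_pow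
      have := r.rot_trans a.val (shift W 0 1 0 1)
      simp only [M, mul_def', sec, lin_origin, add_zero, flip_zero_right, trans_zero, hv, h11,
        pow_zero, pow_one, mul_one, one_mul, Fin.val_zero]
      rw [← Prod.mk_add_mk, trans_add r.comm, Prod.mk.eta, shift_eq, mul_assoc, ← this, ← hp]
      simp only [mul_assoc]

end Relations

end relations

/-! ### Twisted cocycles and the extensions they define -/

section cover

variable {B : Type} [AddCommGroup B]

/-- A 2-cocycle with values in `B`, on which orientation-reversing elements act by negation. -/
structure TwistedCocycle (W : WallpaperGroup) (B : Type) [AddCommGroup B] where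
  toFun : Elt W → Elt W → B
  cocycle : ∀ g h k, toFun (g * h) k + toFun g h = orient W g • toFun h k + toFun g (h * k)

namespace TwistedCocycle

variable (f : TwistedCocycle W B)

theorem one_left (h : Elt W) : f.toFun 1 h = f.toFun 1 1 := by
  simpa using (f.cocycle 1 1 h).symm

theorem one_right (g : Elt W) : f.toFun g 1 = orient W g • f.toFun 1 1 := by
  simpa using f.cocycle g 1 1

end TwistedCocycle

/-- The extension of the wallpaper group defined by a twisted cocycle. -/
@[ext] structure Cover (f : TwistedCocycle W B) where
  fib : B
  base : Elt W

namespace Cover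

variable {f : TwistedCocycle W B}

instance : Mul (Cover f) := ⟨fun a b =>
  ⟨a.fib + orient W a.base • b.fib + f.toFun a.base b.base, a.base * b.base⟩⟩

/-- Cocycles are not assumed to be normalised, so the identity has fibre component `-f(1, 1)`. -/
instance : One (Cover f) := ⟨⟨-f.toFun 1 1, 1⟩⟩

instance : Inv (Cover f) := ⟨fun a =>
  ⟨-f.toFun 1 1 - orient W a.base⁻¹ • a.fib - f.toFun a.base⁻¹ a.base, a.base⁻¹⟩⟩

theorem mul_fib (a b : Cover f) :
    (a * b).fib = a.fib + orient W a.base • b.fib + f.toFun a.base b.base := rfl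

theorem mul_base (a b : Cover f) : (a * b).base = a.base * b.base := rfl

theorem one_fib : (1 : Cover f).fib = -f.toFun 1 1 := rfl

theorem one_base : (1 : Cover f).base = 1 := rfl

instance : Group (Cover f) := Group.ofLeftAxioms
  (fun a b d => by
    ext1
    · have := f.cocycle a.base b.base d.base
      simp only [mul_fib, mul_base, map_mul, smul_add, mul_smul]
      rw [add_assoc, add_assoc, add_assoc, add_left_comm (f.toFun _ _),
        add_comm (f.toFun _ _) (f.toFun _ _), this]
      abel
    · exact mul_assoc _ _ _)
  (fun a => by
    ext1
    · simp [mul_fib, one_fib, one_base, f.one_left]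
    · exact one_mul _)
  (fun a => by
    ext1
    · change -f.toFun 1 1 - orient W a.base⁻¹ • a.fib - f.toFun a.base⁻¹ a.base +
        orient W a.base⁻¹ • a.fib + f.toFun a.base⁻¹ a.base = -f.toFun 1 1
      abel
    · exact inv_mul_cancel _)

/-- The projection to the wallpaper group. -/
def proj (f : TwistedCocycle W B) : Cover f →* Elt W where
  toFun := base
  map_one' := rfl
  map_mul' _ _ := rfl

end Cover

/-- A cocycle is a coboundary if the generators have lifts that satisfy the defining relations. -/
theorem TwistedCocycle.exists_primitive (f : TwistedCocycle W B) (t₁ t₂ c m : Cover f)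
    (h₁ : t₁.base = T₁) (h₂ : t₂.base = T₂) (hc : c.base = C) (hm : m.base = M)
    (r : Relations W t₁ t₂ c m) :
    ∃ φ : Elt W → B, ∀ g h, f.toFun g h = φ (g * h) - φ g - orient W g • φ h := by
  have hb (g : Elt W) : (Relations.sec t₁ t₂ c m g).base = g := by
    change Cover.proj f (Relations.sec t₁ t₂ c m g) = g
    rw [Relations.sec, trans, ← mul_assoc, map_mul, map_mul, map_mul, map_zpow, map_zpow, map_pow,
      map_pow]
    change t₁.base ^ _ * t₂.base ^ _ * c.base ^ _ * m.base ^ _ = g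
    rw [h₁, h₂, hc, hm, ← eq_normalForm]
  -- Multiplicativity of the section, read off in the fibre, is exactly the coboundary equation.
  refine ⟨fun g => (Relations.sec t₁ t₂ c m g).fib, fun g h => ?_⟩
  beta_reduce
  rw [r.sec_mul, Cover.mul_fib, hb, hb]
  abel

end cover

/-- Makes relations between explicit group elements, such as the words for `T₁` and `T₂` below,
checkable by evaluation. -/
instance : DecidableEq (Elt W) := fun g h =>
  decidable_of_iff (g.x = h.x ∧ g.y = h.y ∧ g.c = h.c ∧ g.m = h.m) Elt.ext_iff.symm

/-! ### Lifting the generators to a central extension -/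

section words

variable {E : Type} [Group E]

/-- Two involutions `c` and `t * c` generate a dihedral group, in which `c` inverts `t`. -/
theorem mul_eq_inv_mul_of_sq {t c : E} (hc : c * c = 1) (h : t * c * (t * c) = 1) :
    c * t = t⁻¹ * c := by
  have h1 : t * (c * t * c) = 1 := by simpa only [mul_assoc] using h
  have h2 : c⁻¹ = c := inv_eq_of_mul_eq_one_left hc
  rw [← eq_inv_of_mul_eq_one_right h1, mul_assoc, hc, mul_one]

/-- When an involution `c` inverts both translations, the square of `t₁ * t₂ * c` is their
commutator. -/
theorem comm_of_sq {t₁ t₂ c : E} (hc : c * c = 1) (h₁ : c * t₁ = t₁⁻¹ * c)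
    (h₂ : c * t₂ = t₂⁻¹ * c) (h : t₁ * t₂ * c * (t₁ * t₂ * c) = 1) : t₁ * t₂ = t₂ * t₁ := by
  have h3 : t₁ * t₂ * c * (t₁ * t₂ * c) = t₁ * t₂ * (t₁⁻¹ * t₂⁻¹) := by
    calc t₁ * t₂ * c * (t₁ * t₂ * c) = t₁ * t₂ * ((c * t₁) * t₂ * c) := by simp only [mul_assoc]
      _ = t₁ * t₂ * (t₁⁻¹ * (c * t₂) * c) := by rw [h₁]; simp only [mul_assoc]
      _ = t₁ * t₂ * (t₁⁻¹ * t₂⁻¹ * (c * c)) := by rw [h₂]; simp only [mul_assoc]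
      _ = _ := by rw [hc, mul_one]
  rw [h3, ← mul_inv_rev, mul_inv_eq_one] at h
  exact h

theorem comm_of_involutions {a b : E} (ha : a * a = 1) (hb : b * b = 1)
    (h : a * b * (a * b) = 1) : b * a = a * b := by
  rw [mul_eq_inv_mul_of_sq hb h, inv_eq_of_mul_eq_one_left ha]

theorem conj_eq_iff {c t s : E} : MulAut.conj c t = s ↔ c * t = s * c := mul_inv_eq_iff_eq_mul

theorem conj_mul_apply (a b x : E) :
    MulAut.conj (a * b) x = MulAut.conj a (MulAut.conj b x) := by
  rw [map_mul, MulAut.mul_apply]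

end words

/-- The statement that an invariant of a central extension is trivial, in terms of lifts. -/
def TopInv.Lifts {E : Type} [Group E] (π : E →* Elt W) : TopInv W → Prop
  | rotation g => ∀ e, π e = g → e * e = 1
  | axis t m => ∀ a b, π a = t → π b = m → a * b = b * a
  | cell t₁ t₂ => ∀ a b, π a = t₁ → π b = t₂ → a * b = b * a
  | glideCell t s => ∀ a b, π a = t → π b = s → a * b⁻¹ * (a * b) = 1
  | mirror m => ∀ e, π e = m → e * e = 1

/-- A surjection with central kernel `{1, z}`. -/
structure IsDoubleCover {E : Type} [Group E] (π : E →* Elt W) (z : E) : Prop where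
  surj : Function.Surjective π
  comm : ∀ a, a * z = z * a
  sq : z * z = 1
  map : π z = 1
  ker : ∀ a b, π a = π b → a = b ∨ a = z * b

/-- The generators have lifts that satisfy the defining relations. -/
def HasLifts {E : Type} [Group E] (π : E →* Elt W) : Prop :=
  ∃ t₁ t₂ c m : E, π t₁ = T₁ ∧ π t₂ = T₂ ∧ π c = C ∧ π m = M ∧ Relations W t₁ t₂ c m

section lifts

variable {E : Type} [Group E] {z : E}

/-! ### Lifts for the groups without threefold rotations. -/

theorem hasLifts_p1 {π : E →* Elt p1} (hπ : IsDoubleCover π z) (h : ∀ i, (inv p1 i).Lifts π) :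
    HasLifts π := by
  obtain ⟨t₁, h₁⟩ := hπ.surj T₁
  obtain ⟨t₂, h₂⟩ := hπ.surj T₂
  have h0 : t₁ * t₂ = t₂ * t₁ := h 0 t₁ t₂ h₁ h₂
  refine ⟨t₁, t₂, 1, 1, h₁, h₂, map_one π, map_one π, ?_⟩
  constructor <;> simp [trans, rotGen, mirGen, shift, h0]

theorem hasLifts_p2 {π : E →* Elt p2} (hπ : IsDoubleCover π z) (h : ∀ i, (inv p2 i).Lifts π) :
    HasLifts π := by
  obtain ⟨t₁, h₁⟩ := hπ.surj T₁
  obtain ⟨t₂, h₂⟩ := hπ.surj T₂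
  obtain ⟨c, hc⟩ := hπ.surj C
  have h0 : c * c = 1 := h 0 c hc
  have r₁ := mul_eq_inv_mul_of_sq h0 (h 1 (t₁ * c) (by simp [h₁, hc]))
  have r₂ := mul_eq_inv_mul_of_sq h0 (h 2 (t₂ * c) (by simp [h₂, hc]))
  have r := comm_of_sq h0 r₁ r₂ (h 3 (t₁ * t₂ * c) (by simp [h₁, h₂, hc]))
  refine ⟨t₁, t₂, c, 1, h₁, h₂, hc, map_one π, ?_⟩
  constructor <;> simp [trans, rotGen, mirGen, shift, flip, pow_two, r, r₁, r₂, h0]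

/-- The two axis invariants make `t₂` commute with `m` and with `t₁ * m`, hence with `t₁`. -/
theorem hasLifts_pm {π : E →* Elt pm} (hπ : IsDoubleCover π z) (h : ∀ i, (inv pm i).Lifts π) :
    HasLifts π := by
  obtain ⟨t₁, h₁⟩ := hπ.surj T₁
  obtain ⟨t₂, h₂⟩ := hπ.surj T₂
  obtain ⟨m, hm⟩ := hπ.surj M
  have h0 : t₂ * m = m * t₂ := h 0 t₂ m h₂ hm
  have h1 : t₂ * (t₁ * m) = t₁ * m * t₂ := h 1 t₂ (t₁ * m) h₂ (by simp [h₁, hm])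
  have h2 : m * m = 1 := h 2 m hm
  have r₁ := mul_eq_inv_mul_of_sq h2 (h 3 (t₁ * m) (by simp [h₁, hm]))
  have r : t₁ * t₂ = t₂ * t₁ := by
    rw [mul_assoc, ← h0, ← mul_assoc, ← mul_assoc] at h1
    exact (mul_right_cancel h1).symm
  refine ⟨t₁, t₂, 1, m, h₁, h₂, map_one π, hm, ?_⟩
  constructor <;> simp [trans, rotGen, mirGen, shift, pow_two, r, r₁, h0, h2]

/-- With `t₂ = m * m` the only relation left is that `m` inverts `t₁`, which is the glide invariant;
then `m * m` commutes with `t₁`. -/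
theorem hasLifts_pg {π : E →* Elt pg} (hπ : IsDoubleCover π z) (h : ∀ i, (inv pg i).Lifts π) :
    HasLifts π := by
  obtain ⟨t₁, h₁⟩ := hπ.surj T₁
  obtain ⟨m, hm⟩ := hπ.surj M
  have h0 : t₁ * m⁻¹ * (t₁ * m) = 1 := h 0 t₁ m h₁ hm
  have r₁ : m * t₁ = t₁⁻¹ * m := by
    have : t₁ * m⁻¹ = m⁻¹ * t₁⁻¹ := by rw [← mul_inv_rev]; exact eq_inv_of_mul_eq_one_left h0
    calc m * t₁ = m * (t₁ * m⁻¹) * m := by group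
      _ = _ := by rw [this]; group
  have r : t₁ * (m * m) = m * m * t₁ := by
    rw [mul_assoc m m t₁, r₁, ← mul_assoc m, show m * t₁⁻¹ = t₁ * m from ?_, mul_assoc]
    rw [mul_inv_eq_iff_eq_mul, mul_assoc, r₁, mul_inv_cancel_left]
  refine ⟨t₁, m * m, 1, m, h₁, by rw [map_mul, hm]; decide, map_one π, hm, ?_⟩
  constructor <;> simp [trans, rotGen, mirGen, shift, pow_two, r, r₁, mul_assoc]

/-- With `t₂ = m * t₁ * m`, conjugation by `m` turns `t₁ * t₂` into `t₂ * t₁`, so the axis invariant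
is the commutation of the translations. -/
theorem hasLifts_cm {π : E →* Elt cm} (hπ : IsDoubleCover π z) (h : ∀ i, (inv cm i).Lifts π) :
    HasLifts π := by
  obtain ⟨t₁, h₁⟩ := hπ.surj T₁
  obtain ⟨m, hm⟩ := hπ.surj M
  have h1 : m * m = 1 := h 1 m hm
  have h₂ : π (m * t₁ * m) = T₂ := by simp only [map_mul, hm, h₁]; decide
  have h0 : t₁ * (m * t₁ * m) * m = m * (t₁ * (m * t₁ * m)) :=
    h 0 (t₁ * (m * t₁ * m)) m (by rw [map_mul, h₁, h₂]) hm
  refine ⟨t₁, m * t₁ * m, 1, m, h₁, h₂, map_one π, hm, ?_⟩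
  have r₂ : m * (m * t₁ * m) = t₁ * m := by simp only [← mul_assoc, h1, one_mul]
  have r : t₁ * (m * t₁ * m) = m * t₁ * m * t₁ := by
    simp only [← mul_assoc] at h0 ⊢
    rw [← mul_left_inj m, h0]
  constructor <;> simp [trans, rotGen, mirGen, shift, pow_two, r, r₂, h1]
  simp [mul_assoc, h1]

theorem hasLifts_pmm {π : E →* Elt pmm} (hπ : IsDoubleCover π z)
    (h : ∀ i, (inv pmm i).Lifts π) : HasLifts π := by
  obtain ⟨t₁, h₁⟩ := hπ.surj T₁
  obtain ⟨t₂, h₂⟩ := hπ.surj T₂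
  obtain ⟨c, hc⟩ := hπ.surj C
  obtain ⟨m, hm⟩ := hπ.surj M
  have h0 : c * c = 1 := h 0 c hc
  have h4 : m * m = 1 := h 4 m hm
  have h5 : c * m * (c * m) = 1 := h 5 (c * m) (by simp [hc, hm])
  have r₁ := mul_eq_inv_mul_of_sq h0 (h 2 (t₁ * c) (by simp [h₁, hc]))
  have r₂ := mul_eq_inv_mul_of_sq h0 (h 3 (t₂ * c) (by simp [h₂, hc]))
  have r := comm_of_sq h0 r₁ r₂ (h 1 (t₁ * t₂ * c) (by simp [h₁, h₂, hc]))
  have s₁ := mul_eq_inv_mul_of_sq h4 (h 6 (t₁ * m) (by simp [h₁, hm]))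
  -- Both `c` and `c * m` invert `t₂`, so `m` centralises it.
  have s₂ : m * t₂ = t₂ * m := by
    have := mul_eq_inv_mul_of_sq h5 (h 7 (t₂ * (c * m)) (by simp [h₂, hm, hc, mul_assoc]))
    rw [← mul_assoc, ← r₂, mul_assoc, mul_assoc] at this
    exact mul_left_cancel this
  have s := comm_of_involutions h0 h4 h5
  refine ⟨t₁, t₂, c, m, h₁, h₂, hc, hm, ?_⟩
  constructor <;> simp [trans, rotGen, mirGen, shift, flip, pow_two, r, r₁, r₂, s₁, s₂, s, h0, h4]

/-- The product `m * c` is a glide reflection with square `T₁`, so `m * c * m * c` is taken as the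
lift of `T₁`. The rotation about the other centre is `t₂ * (m * c * m)`; conjugating it by `m` shows
that `t₂ * c` is an involution. -/
theorem hasLifts_pmg {π : E →* Elt pmg} (hπ : IsDoubleCover π z)
    (h : ∀ i, (inv pmg i).Lifts π) : HasLifts π := by
  obtain ⟨t₂, h₂⟩ := hπ.surj T₂
  obtain ⟨c, hc⟩ := hπ.surj C
  obtain ⟨m, hm⟩ := hπ.surj M
  have h0 : c * c = 1 := h 0 c hc
  have h2 : t₂ * m = m * t₂ := h 2 t₂ m h₂ hm
  have h3 : m * m = 1 := h 3 m hm
  have hc' : c⁻¹ = c := inv_eq_of_mul_eq_one_left h0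
  have hm' : m⁻¹ = m := inv_eq_of_mul_eq_one_left h3
  have h1 : t₂ * (m * c * m) * (t₂ * (m * c * m)) = 1 :=
    h 1 (t₂ * (m * c * m)) (by simp only [map_mul, hm, hc, h₂]; decide)
  have r₂ : c * t₂ = t₂⁻¹ * c := by
    refine mul_eq_inv_mul_of_sq h0 ?_
    have h4 := congrArg (MulAut.conj m) h1
    have h5 : MulAut.conj m t₂ = t₂ := conj_eq_iff.2 h2.symm
    have h6 : MulAut.conj m (m * c * m) = c := by
      rw [MulAut.conj_apply, hm', ← mul_assoc, ← mul_assoc, h3, one_mul, mul_assoc, h3, mul_one]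
    rwa [map_mul, map_mul, h5, h6, map_one] at h4
  have hi : (m * c * m * c)⁻¹ = c * m * c * m := by simp only [mul_inv_rev, hc', hm', mul_assoc]
  have r : m * c * m * c * t₂ = t₂ * (m * c * m * c) := by
    rw [← conj_eq_iff]
    have h5 : MulAut.conj m t₂ = t₂ := conj_eq_iff.2 h2.symm
    have h6 : MulAut.conj c t₂ = t₂⁻¹ := conj_eq_iff.2 r₂
    simp only [map_mul, MulAut.mul_apply, h5, h6, map_inv, inv_inv]
  refine ⟨m * c * m * c, t₂, c, m, by simp only [map_mul, hm, hc]; decide, h₂, hc, hm, ?_⟩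
  constructor <;>
    simp only [trans, rotGen, mirGen, shift, flip, pow_two, r, h2, h0, h3, r₂, zpow_neg_one, hi,
      neg_zero, zpow_zero, mul_one, one_mul, zpow_one, rot, mir]
  case rot_t₁ => simp [mul_assoc]
  case mir_t₁ => rw [mul_assoc (c * m * c), h3]; simp only [← mul_assoc, h3, one_mul, mul_one]
  case mir_pow => simp
  case mir_rot => simp [mul_assoc, h0, h3]

theorem hasLifts_cmm {π : E →* Elt cmm} (hπ : IsDoubleCover π z)
    (h : ∀ i, (inv cmm i).Lifts π) : HasLifts π := by
  obtain ⟨t₁, h₁⟩ := hπ.surj T₁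
  obtain ⟨c, hc⟩ := hπ.surj C
  obtain ⟨m, hm⟩ := hπ.surj M
  have h₂ : π (m * t₁ * m) = T₂ := by simp only [map_mul, hm, h₁]; decide
  have h0 : c * c = 1 := h 0 c hc
  have h3 : m * m = 1 := h 3 m hm
  have s := comm_of_involutions h0 h3 (h 4 (c * m) (by simp [hc, hm]))
  have r₁ := mul_eq_inv_mul_of_sq h0 (h 2 (t₁ * c) (by simp [h₁, hc]))
  have hm' : m⁻¹ = m := inv_eq_of_mul_eq_one_left h3
  have r₂ : c * (m * t₁ * m) = (m * t₁ * m)⁻¹ * c := by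
    have e : (m * t₁ * m)⁻¹ = m * t₁⁻¹ * m := by simp only [mul_inv_rev, hm', mul_assoc]
    rw [e, ← mul_assoc, ← mul_assoc, ← s, mul_assoc m c, r₁, mul_assoc _ m c, s]
    simp only [mul_assoc]
  have r := comm_of_sq h0 r₁ r₂ (h 1 (t₁ * (m * t₁ * m) * c) (by simp [h₁, h₂, hc]))
  have s₂ : m * (m * t₁ * m) = t₁ * m := by simp only [← mul_assoc, h3, one_mul]
  refine ⟨t₁, m * t₁ * m, c, m, h₁, h₂, hc, hm, ?_⟩
  constructor <;>
    simp only [trans, rotGen, mirGen, shift, flip, pow_two, r, h0, h3, r₁, r₂, s₂, zpow_neg_one,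
      neg_zero, zpow_zero, mul_one, one_mul, zpow_one, rot, mir]
  · simp [mul_assoc, h3]
  · simp [s]

theorem hasLifts_p4 {π : E →* Elt p4} (hπ : IsDoubleCover π z) (h : ∀ i, (inv p4 i).Lifts π) :
    HasLifts π := by
  obtain ⟨t₁, h₁⟩ := hπ.surj T₁
  obtain ⟨c, hc⟩ := hπ.surj C
  have h₂ : π (c * t₁ * c⁻¹) = T₂ := by simp only [map_mul, map_inv, hc, h₁]; decide
  have h0 : c ^ 2 * c ^ 2 = 1 := h 0 (c ^ 2) (by simp [hc])
  have r₁ := mul_eq_inv_mul_of_sq h0 (h 2 (t₁ * c ^ 2) (by simp [h₁, hc]))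
  have r₂ : c ^ 2 * (c * t₁ * c⁻¹) = (c * t₁ * c⁻¹)⁻¹ * c ^ 2 := by
    calc _ = c * (c ^ 2 * t₁) * c⁻¹ := by group
      _ = _ := by rw [r₁]; group
  have r := comm_of_sq h0 r₁ r₂ (h 1 (t₁ * (c * t₁ * c⁻¹) * c ^ 2) (by simp [h₁, h₂, hc]))
  have s₂ : c * (c * t₁ * c⁻¹) = t₁⁻¹ * c := by
    rw [← mul_left_inj c]
    calc _ = c ^ 2 * t₁ := by rw [pow_two]; group
      _ = _ := by rw [r₁, pow_two, mul_assoc]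
  refine ⟨t₁, c * t₁ * c⁻¹, c, 1, h₁, h₂, hc, map_one π, ?_⟩
  constructor <;> simp [trans, rotGen, mirGen, shift, flip, rot, mir, r, s₂]
  rw [← h0, ← pow_add]

theorem hasLifts_p4m {π : E →* Elt p4m} (hπ : IsDoubleCover π z)
    (h : ∀ i, (inv p4m i).Lifts π) : HasLifts π := by
  obtain ⟨t₁, h₁⟩ := hπ.surj T₁
  obtain ⟨c, hc⟩ := hπ.surj C
  obtain ⟨m, hm⟩ := hπ.surj M
  have h₂ : π (c * t₁ * c⁻¹) = T₂ := by simp only [map_mul, map_inv, hc, h₁]; decide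
  have h0 : c ^ 2 * c ^ 2 = 1 := h 0 (c ^ 2) (by simp [hc])
  have h3 : m * m = 1 := h 3 m hm
  have h5 : c * m * (c * m) = 1 := h 5 (c * m) (by simp [hc, hm])
  have r₁ := mul_eq_inv_mul_of_sq h0 (h 2 (t₁ * c ^ 2) (by simp [h₁, hc]))
  have r₂ : c ^ 2 * (c * t₁ * c⁻¹) = (c * t₁ * c⁻¹)⁻¹ * c ^ 2 := by
    calc _ = c * (c ^ 2 * t₁) * c⁻¹ := by group
      _ = _ := by rw [r₁]; group
  have r := comm_of_sq h0 r₁ r₂ (h 1 (t₁ * (c * t₁ * c⁻¹) * c ^ 2) (by simp [h₁, h₂, hc]))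
  have s₂ : c * (c * t₁ * c⁻¹) = t₁⁻¹ * c := by
    rw [← mul_left_inj c]
    calc _ = c ^ 2 * t₁ := by rw [pow_two]; group
      _ = _ := by rw [r₁, pow_two, mul_assoc]
  have s := mul_eq_inv_mul_of_sq h3 h5
  have q₁ := mul_eq_inv_mul_of_sq h3 (h 4 (t₁ * m) (by simp [h₁, hm]))
  -- Since `c * m * c = m`, the action of `m` on `t₂` is determined by its action on `t₁`.
  have q₂ : m * (c * t₁ * c⁻¹) = c * t₁ * c⁻¹ * m := by
    have e : MulAut.conj c (MulAut.conj m (MulAut.conj c t₁)) = MulAut.conj m t₁ := by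
      rw [← MulAut.mul_apply, ← MulAut.mul_apply, ← map_mul, ← map_mul, mul_assoc, s,
        mul_inv_cancel_left]
    rw [conj_eq_iff.2 q₁, ← conj_eq_iff.2 s₂, EmbeddingLike.apply_eq_iff_eq] at e
    exact conj_eq_iff.1 e
  have h4 : c ^ 4 = 1 := by rw [← h0, ← pow_add]
  have hi : c⁻¹ = c ^ 3 := inv_eq_of_mul_eq_one_left (by rw [← pow_succ, h4])
  refine ⟨t₁, c * t₁ * c⁻¹, c, m, h₁, h₂, hc, hm, ?_⟩
  constructor <;>
    simp [trans, rotGen, mirGen, shift, flip, rot, mir, r, s₂, q₁, q₂, h4, pow_two, h3]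
  rw [s, hi]

/-- The group is generated by the rotation `c` and the genuine mirror `s` over `T₁⁻¹ * M`. Both
translations are words in `c⁻¹` and `s`, and `M` lifts to `t₁ * s`, so that the relations become
word identities. -/
theorem hasLifts_p4g {π : E →* Elt p4g} (hπ : IsDoubleCover π z)
    (h : ∀ i, (inv p4g i).Lifts π) : HasLifts π := by
  obtain ⟨c, hc⟩ := hπ.surj C
  obtain ⟨s, hs⟩ := hπ.surj (T₁⁻¹ * M)
  have h₁ : π (c⁻¹ * s * c⁻¹ * s) = T₁ := by simp only [map_mul, map_inv, hc, hs]; decide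
  have h0 : c ^ 2 * c ^ 2 = 1 := h 0 (c ^ 2) (by simp [hc])
  have h2 : s * s = 1 := h 2 s hs
  have h4 : c ^ 4 = 1 := by rw [← h0, ← pow_add]
  have hi : c⁻¹ = c ^ 3 := inv_eq_of_mul_eq_one_left (by rw [← pow_succ, h4])
  have hs' : s⁻¹ = s := inv_eq_of_mul_eq_one_left h2
  have r₁ := mul_eq_inv_mul_of_sq h0 (h 1 (c⁻¹ * s * c⁻¹ * s * c ^ 2) (by
    rw [map_mul, h₁, map_pow, hc]))
  obtain ⟨t₁, ht⟩ : ∃ t, t = c⁻¹ * s * c⁻¹ * s := ⟨_, rfl⟩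
  obtain ⟨t₂, ht'⟩ : ∃ t, t = s * c⁻¹ * s * c⁻¹ := ⟨_, rfl⟩
  have q₁ : MulAut.conj s t₁ = t₂ := by
    rw [MulAut.conj_apply, hs', ht, ht']
    simp [mul_assoc, h2]
  have q₂ : MulAut.conj s t₂ = t₁ := by
    rw [MulAut.conj_apply, hs', ht, ht', ← mul_assoc, ← mul_assoc, ← mul_assoc, h2, one_mul]
  have k₁ : MulAut.conj c t₁ = t₂ := by
    rw [MulAut.conj_apply, ht, ht']
    group
  have k₂ : MulAut.conj c t₂ = t₁⁻¹ := by
    rw [← ht] at r₁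
    rw [← k₁, ← MulAut.mul_apply, ← map_mul, ← pow_two, conj_eq_iff, r₁]
  -- Conjugation by `c ^ 2` inverts both translations, giving `t₁⁻¹ * t₂⁻¹`; the word for `t₁ * t₂`
  -- shows that it also inverts the product. Comparison gives commutativity.
  have r : t₁ * t₂ = t₂ * t₁ := by
    have e : t₁ * t₂ = c⁻¹ * s * (c ^ 2)⁻¹ * s * c⁻¹ := by
      rw [ht, ht', pow_two, mul_inv_rev]
      simp only [mul_assoc, ← mul_assoc s s, h2, one_mul]
    have e1 : MulAut.conj (c ^ 2) (t₁ * t₂) = (t₁ * t₂)⁻¹ := by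
      have h3 : (c ^ 2)⁻¹ = c ^ 2 := inv_eq_of_mul_eq_one_left h0
      rw [MulAut.conj_apply, e, h3, mul_inv_rev, mul_inv_rev, mul_inv_rev, mul_inv_rev, inv_inv,
        hs', h3, hi]
      simp only [mul_assoc, ← pow_add]
      rw [← mul_assoc, ← pow_add]
      norm_num
      rw [show c ^ 5 = c by rw [pow_succ c 4, h4, one_mul]]
    rw [pow_two, conj_mul_apply, map_mul, map_mul, k₁, k₂, map_inv, k₁,
      ← mul_inv_rev, inv_inj] at e1
    exact e1.symm
  have km : s * c = t₁⁻¹ * c⁻¹ * s := by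
    rw [ht]
    simp only [mul_inv_rev, inv_inv, hs', mul_assoc, mul_inv_cancel_left, h2, mul_one]
  have k₃ : c⁻¹ * t₁ = t₂⁻¹ * c⁻¹ := by
    rw [inv_mul_eq_iff_eq_mul, ← mul_assoc, eq_mul_inv_iff_mul_eq, ← inv_inj, mul_inv_rev,
      mul_inv_rev, inv_inv, inv_mul_eq_iff_eq_mul, ← mul_assoc, eq_mul_inv_iff_mul_eq]
    exact (conj_eq_iff.1 k₂).symm
  refine ⟨t₁, t₂, c, t₁ * s, ht ▸ h₁, ?_, hc, ?_, ?_⟩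
  · rw [ht']
    simp only [map_mul, map_inv, hc, hs]
    decide
  · rw [map_mul, ht, h₁, hs, mul_inv_cancel_left]
  constructor
  case comm => exact r
  case rot_pow => exact h4
  all_goals simp [trans, rotGen, mirGen, shift, flip, rot, mir]
  case rot_t₁ => exact conj_eq_iff.1 k₁
  case rot_t₂ => exact conj_eq_iff.1 k₂
  case mir_t₁ => rw [mul_assoc, conj_eq_iff.1 q₁, ← mul_assoc, r, mul_assoc]
  case mir_t₂ => rw [mul_assoc, conj_eq_iff.1 q₂]
  case mir_pow => rw [pow_two, mul_assoc, ← mul_assoc s, conj_eq_iff.1 q₁, mul_assoc, h2, mul_one]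
  case mir_rot =>
    rw [mul_assoc, km, ← hi, mul_assoc, mul_assoc, ← mul_assoc c⁻¹ t₁, k₃]
    simp [mul_assoc]

theorem hasLifts_pgg {π : E →* Elt pgg} (hπ : IsDoubleCover π z)
    (h : ∀ i, (inv pgg i).Lifts π) : HasLifts π := by
  obtain ⟨c, hc⟩ := hπ.surj C
  obtain ⟨m, hm⟩ := hπ.surj M
  have h₁ : π (m * c * m⁻¹ * c * (m * m)⁻¹) = T₁ := by
    simp only [map_mul, map_inv, hc, hm]; decide
  have h0 : c * c = 1 := h 0 c hc
  have hc' : c⁻¹ = c := inv_eq_of_mul_eq_one_left h0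
  have h1 := h 1 (m * c * m⁻¹ * c * (m * m)⁻¹ * c) (by rw [map_mul, h₁, hc])
  have r₁ := mul_eq_inv_mul_of_sq h0 h1
  -- The relation holds up to the central element `z`. If `z` occurred, the lift of `T₁ * C` would
  -- be `z * (m * c * m)` with square `z`, while the second invariant makes this square trivial; so
  -- `z = 1`.
  have k : MulAut.conj c (m * m) = (m * m)⁻¹ := by
    rcases hπ.ker (MulAut.conj c (m * m)) (m * m)⁻¹ (by
      simp only [MulAut.conj_apply, map_mul, map_inv, hc, hm]; decide) with hk | hk
    · exact hk
    · have e : m * c * m⁻¹ * c * (m * m)⁻¹ * c = z * (m * c * m) := by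
        calc _ = m * c * m⁻¹ * (MulAut.conj c (m * m))⁻¹ := by
              rw [← map_inv, MulAut.conj_apply, hc']
              simp only [mul_assoc]
          _ = _ := by
              rw [hk, mul_inv_rev, inv_inv, inv_eq_of_mul_eq_one_left hπ.sq, ← mul_assoc,
                hπ.comm]
              group
      have e2 : m * c * m * (m * c * m) = z := by
        calc _ = m * (MulAut.conj c (m * m)) * m := by
              rw [MulAut.conj_apply, hc']
              simp only [mul_assoc]
          _ = _ := by
              rw [hk, ← mul_assoc m z, hπ.comm]
              group
      have hz : z = 1 := by
        rwa [e, mul_assoc z, ← mul_assoc _ z, hπ.comm, mul_assoc z, ← mul_assoc z z, hπ.sq, e2,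
          one_mul] at h1
      rw [hk, hz, one_mul]
  have kc : c * (m * m) = (m * m)⁻¹ * c := conj_eq_iff.1 k
  have r : m * c * m⁻¹ * c * (m * m)⁻¹ * (m * m) = m * m * (m * c * m⁻¹ * c * (m * m)⁻¹) := by
    rw [← conj_eq_iff]
    have k' : MulAut.conj m (m * m) = m * m := by rw [conj_eq_iff, mul_assoc]
    have k'' : MulAut.conj m⁻¹ (m * m) = m * m := by rw [conj_eq_iff]; group
    have k3 : MulAut.conj (m * m)⁻¹ (m * m) = m * m := by rw [conj_eq_iff]; group
    rw [conj_mul_apply, k3, conj_mul_apply, k, conj_mul_apply, map_inv, k'', conj_mul_apply,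
      map_inv, k, inv_inv, k']
  refine ⟨m * c * m⁻¹ * c * (m * m)⁻¹, m * m, c, m, h₁, by rw [map_mul, hm]; decide, hc, hm, ?_⟩
  constructor <;>
    simp only [trans, rotGen, mirGen, shift, flip, rot, mir, zpow_neg_one, neg_zero, zpow_zero,
      mul_one, one_mul, zpow_one, pow_two, h0, r₁, kc, r]
  case mir_t₁ =>
    have e : c * (m * m)⁻¹ = m * m * c := by
      rw [mul_inv_eq_iff_eq_mul, mul_assoc, kc, mul_inv_cancel_left]
    calc _ = m * (m * c * m⁻¹ * (c * (m * m)⁻¹)) := by rw [mul_assoc _ c]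
      _ = m * m * c * m * c := by rw [e]; group
      _ = _ := by simp only [mul_inv_rev, inv_inv, hc', mul_assoc, inv_mul_cancel, mul_one]
  case mir_t₂ => simp [mul_assoc]
  case mir_pow => simp
  case mir_rot => simp [mul_assoc, h0]

/-! ### Lifts for the groups with threefold or sixfold rotations. -/

/-- A central element of order at most two. -/
structure IsSign (e : E) : Prop where
  comm : ∀ a, a * e = e * a
  sq : e * e = 1

namespace IsSign

variable {e : E}

theorem mul_mul (he : IsSign e) (a b : E) : e * a * (e * b) = a * b := by
  rw [mul_assoc, ← mul_assoc a, he.comm, mul_assoc, ← mul_assoc, he.sq, one_mul]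

theorem inv_eq (he : IsSign e) : e⁻¹ = e := inv_eq_of_mul_eq_one_left he.sq

theorem mul_inv (he : IsSign e) (a : E) : (e * a)⁻¹ = e * a⁻¹ := by
  rw [mul_inv_rev, he.inv_eq, he.comm]

theorem conj (he : IsSign e) (c a : E) : MulAut.conj c (e * a) = e * MulAut.conj c a := by
  rw [map_mul, conj_eq_iff.2 (he.comm c)]

/-- An odd power keeps the sign, so cubes can both detect and absorb it. -/
theorem mul_pow_three (he : IsSign e) (a : E) : (e * a) ^ 3 = e * a ^ 3 := by
  rw [(show Commute e a from (he.comm a).symm).mul_pow, pow_succ, pow_two, he.sq, one_mul]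

end IsSign

namespace IsDoubleCover

variable {π : E →* Elt W}

/-- Treats the two alternatives of the kernel condition by one unknown sign, which the relations
then determine. -/
theorem exists_sign (hπ : IsDoubleCover π z) {a b : E} (h : π a = π b) :
    ∃ e, IsSign e ∧ π e = 1 ∧ a = e * b := by
  rcases hπ.ker a b h with hk | hk
  · exact ⟨1, ⟨fun a => by simp, one_mul 1⟩, map_one π, by rw [hk, one_mul]⟩
  · exact ⟨z, ⟨hπ.comm, hπ.sq⟩, hπ.map, hk⟩

/-- Lifts of the translations and of a threefold rotation. -/
theorem exists_lifts_three (hπ : IsDoubleCover π z) (h₁ : (C * T₁ * C⁻¹ : Elt W) = T₂)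
    (h₂ : (C * T₂ * C⁻¹ : Elt W) = T₁⁻¹ * T₂⁻¹) (h₃ : (C : Elt W) ^ 3 = 1) :
    ∃ t₁ t₂ c : E, π t₁ = T₁ ∧ π t₂ = T₂ ∧ π c = C ∧ MulAut.conj c t₁ = t₂ ∧
      MulAut.conj c t₂ = t₁⁻¹ * t₂⁻¹ ∧ c ^ 3 = 1 := by
  obtain ⟨c, hc, hc3⟩ : ∃ c, π c = C ∧ c ^ 3 = 1 := by
    obtain ⟨c, hc⟩ := hπ.surj C
    obtain ⟨e, he, hπe, h⟩ := hπ.exists_sign (a := c ^ 3) (b := 1) (by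
      rw [map_pow, hc, h₃, map_one])
    -- Here `e` is the cube of `c`; multiplying `c` by it makes the cube trivial.
    exact ⟨e * c, by rw [map_mul, hπe, hc, one_mul], by
      rw [he.mul_pow_three, h, mul_one, he.sq]⟩
  obtain ⟨t, ht⟩ := hπ.surj T₁
  have ht₂ : π (MulAut.conj c t) = T₂ := by
    rw [MulAut.conj_apply, map_mul, map_mul, map_inv, hc, ht, h₁]
  obtain ⟨e, he, hπe, h⟩ := hπ.exists_sign (a := MulAut.conj c (MulAut.conj c t))
    (b := t⁻¹ * (MulAut.conj c t)⁻¹) (by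
      rw [MulAut.conj_apply, map_mul, map_mul, map_inv, hc, ht₂, h₂, map_mul, map_inv, map_inv,
        ht₂, ht])
  -- In `c t₂ c⁻¹ = t₁⁻¹ t₂⁻¹` a sign in `t₁` enters `t₂` as well, so it occurs once on the left and
  -- twice on the right. Replacing `t` by `e * t` therefore cancels the defect `e`.
  refine ⟨e * t, _, c, by rw [map_mul, hπe, ht, one_mul], ?_, hc, rfl, ?_, hc3⟩
  · rw [he.conj, map_mul, hπe, ht₂, one_mul]
  · rw [he.conj, he.conj, h, he.mul_inv, he.mul_inv, he.mul_mul, ← mul_assoc, he.sq, one_mul]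

/-- Lifts of the translations and of a sixfold rotation. -/
theorem exists_lifts_six (hπ : IsDoubleCover π z) (h₁ : (C * T₁ * C⁻¹ : Elt W) = T₁ * T₂)
    (h₂ : (C * T₂ * C⁻¹ : Elt W) = T₁⁻¹) (h₀ : ∀ e, π e = C ^ 3 → e * e = 1)
    (h : ∀ e, π e = T₁ * C ^ 3 → e * e = 1) :
    ∃ t₁ t₂ c : E, π t₁ = T₁ ∧ π t₂ = T₂ ∧ π c = C ∧ MulAut.conj c t₁ = t₁ * t₂ ∧
      MulAut.conj c t₂ = t₁⁻¹ ∧ c ^ 3 * c ^ 3 = 1 ∧ t₁ * t₂ = t₂ * t₁ := by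
  obtain ⟨c, hc⟩ := hπ.surj C
  have hc3 := h₀ (c ^ 3) (by rw [map_pow, hc])
  obtain ⟨t, ht⟩ := hπ.surj T₁
  have ht₂ : π (t⁻¹ * MulAut.conj c t) = T₂ := by
    rw [map_mul, MulAut.conj_apply, map_mul, map_mul, map_inv, map_inv, hc, ht, h₁,
      inv_mul_cancel_left]
  obtain ⟨e, he, hπe, hk⟩ := hπ.exists_sign (a := MulAut.conj c (t⁻¹ * MulAut.conj c t))
    (b := t⁻¹) (by
      rw [MulAut.conj_apply, map_mul, map_mul, map_inv, hc, ht₂, h₂, map_inv, ht])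
  obtain ⟨t₁, h₁', k₂, ht₂'⟩ : ∃ t₁, π t₁ = T₁ ∧
      MulAut.conj c (t₁⁻¹ * MulAut.conj c t₁) = t₁⁻¹ ∧ π (t₁⁻¹ * MulAut.conj c t₁) = T₂ := by
    -- The lift of `T₂` does not see the sign of `t`, whereas the right side `t⁻¹` of the remaining
    -- relation does; so the sign can be absorbed.
    have e1 : (e * t)⁻¹ * MulAut.conj c (e * t) = t⁻¹ * MulAut.conj c t := by
      rw [he.conj, he.mul_inv, he.mul_mul]
    exact ⟨e * t, by rw [map_mul, hπe, ht, one_mul], by rw [e1, hk, he.mul_inv], by rw [e1, ht₂]⟩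
  obtain ⟨t₂, k₁⟩ : ∃ t₂, t₂ = t₁⁻¹ * MulAut.conj c t₁ := ⟨_, rfl⟩
  rw [← k₁] at k₂ ht₂'
  replace k₁ : MulAut.conj c t₁ = t₁ * t₂ := by rw [k₁, mul_inv_cancel_left]
  refine ⟨t₁, t₂, c, h₁', ht₂', hc, k₁, k₂, hc3, ?_⟩
  -- The relations carry `t₁` under `c ^ 3` to the commutator of `t₁` and `t₂` times `t₁⁻¹`, while
  -- the second invariant says that `c ^ 3` inverts `t₁`.
  have k := conj_eq_iff.2 (mul_eq_inv_mul_of_sq hc3 (h (t₁ * c ^ 3) (by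
    rw [map_mul, h₁', map_pow, hc])))
  rw [pow_succ, pow_two, conj_mul_apply, conj_mul_apply, k₁, map_mul, k₁, k₂, map_mul, map_mul, k₁,
    k₂, map_inv, k₁, mul_inv_rev, ← mul_assoc, mul_eq_right, mul_inv_eq_one,
    mul_inv_eq_iff_eq_mul] at k
  exact k

/-- The possible sign in the dihedral relation survives cubing, so it is enough to know the relation
for `c ^ 3`. -/
theorem conj_eq_inv (hπ : IsDoubleCover π z) {m c : E} (hk : π (MulAut.conj m c) = π c⁻¹)
    (h : MulAut.conj m (c ^ 3) = (c ^ 3)⁻¹) : MulAut.conj m c = c⁻¹ := by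
  obtain ⟨e, he, -, hk⟩ := hπ.exists_sign hk
  rw [map_pow, hk, he.mul_pow_three, inv_pow, mul_eq_right] at h
  rw [hk, h, one_mul]

end IsDoubleCover

/-- This is `c * m * c = m` acting on `x`. It carries the sign in the action of `m` from one
translation to the next. -/
theorem conj_conj_conj {m c : E} (h : MulAut.conj m c = c⁻¹) (x : E) :
    MulAut.conj c (MulAut.conj m (MulAut.conj c x)) = MulAut.conj m x := by
  rw [← conj_mul_apply, ← conj_mul_apply, mul_assoc, conj_eq_iff.1 h, mul_inv_cancel_left]

theorem hasLifts_p3 {π : E →* Elt p3} (hπ : IsDoubleCover π z) (h : ∀ i, (inv p3 i).Lifts π) :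
    HasLifts π := by
  obtain ⟨t₁, t₂, c, h₁, h₂, hc, k₁, k₂, k₃⟩ :=
    hπ.exists_lifts_three (by decide) (by decide) (by decide)
  have r : t₁ * t₂ = t₂ * t₁ := h 0 t₁ t₂ h₁ h₂
  refine ⟨t₁, t₂, c, 1, h₁, h₂, hc, map_one π, ?_⟩
  constructor
  case comm => exact r
  case rot_pow => exact k₃
  all_goals simp [trans, rotGen, mirGen, shift, flip, rot, mir]
  · exact conj_eq_iff.1 k₁
  · exact conj_eq_iff.1 k₂

theorem hasLifts_p3m1 {π : E →* Elt p3m1} (hπ : IsDoubleCover π z)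
    (h : ∀ i, (inv p3m1 i).Lifts π) : HasLifts π := by
  obtain ⟨t₁, t₂, c, h₁, h₂, hc, k₁, k₂, k₃⟩ :=
    hπ.exists_lifts_three (by decide) (by decide) (by decide)
  obtain ⟨m, hm⟩ := hπ.surj M
  have r : t₁ * t₂ = t₂ * t₁ := h 0 t₁ t₂ h₁ h₂
  have h1 : m * m = 1 := h 1 m hm
  have hi : c⁻¹ = c ^ 2 := inv_eq_of_mul_eq_one_left (by rw [← pow_succ, k₃])
  have kc : MulAut.conj m c = c⁻¹ := hπ.conj_eq_inv
    (by simp only [MulAut.conj_apply, map_mul, map_inv, hc, hm]; decide)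
    (by rw [k₃, map_one, inv_one])
  have kk := conj_conj_conj kc
  obtain ⟨e, he, -, hk⟩ := hπ.exists_sign (a := MulAut.conj m t₁) (b := t₂⁻¹)
    (by simp only [MulAut.conj_apply, map_mul, map_inv, h₁, h₂, hm]; decide)
  have hk₂ : MulAut.conj m t₂ = e * t₁⁻¹ := by
    apply (MulAut.conj c).injective
    rw [he.conj, map_inv, k₁, ← hk, ← kk t₁, k₁]
  -- On `t₂`, one side of `kk` contains the sign twice and the other once.
  have he1 : e = 1 := by
    have := kk t₂
    rwa [k₂, map_mul, map_inv, map_inv, hk, hk₂, he.mul_inv, he.mul_inv, he.mul_mul, inv_inv,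
      inv_inv, map_mul, k₁, k₂, inv_mul_cancel_right, right_eq_mul] at this
  rw [he1, one_mul] at hk hk₂
  refine ⟨t₁, t₂, c, m, h₁, h₂, hc, hm, ?_⟩
  constructor
  case comm => exact r
  case rot_pow => exact k₃
  all_goals simp [trans, rotGen, mirGen, shift, flip, rot, mir]
  · exact conj_eq_iff.1 k₁
  · exact conj_eq_iff.1 k₂
  · exact conj_eq_iff.1 hk
  · exact conj_eq_iff.1 hk₂
  · rw [pow_two, h1]
  · exact hi ▸ conj_eq_iff.1 kc

theorem hasLifts_p31m {π : E →* Elt p31m} (hπ : IsDoubleCover π z)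
    (h : ∀ i, (inv p31m i).Lifts π) : HasLifts π := by
  obtain ⟨t₁, t₂, c, h₁, h₂, hc, k₁, k₂, k₃⟩ :=
    hπ.exists_lifts_three (by decide) (by decide) (by decide)
  obtain ⟨m, hm⟩ := hπ.surj M
  have h0 : t₁ * t₂ * m = m * (t₁ * t₂) := h 0 (t₁ * t₂) m (by rw [map_mul, h₁, h₂]) hm
  have h1 : m * m = 1 := h 1 m hm
  have hi : c⁻¹ = c ^ 2 := inv_eq_of_mul_eq_one_left (by rw [← pow_succ, k₃])
  have kc : MulAut.conj m c = c⁻¹ := hπ.conj_eq_inv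
    (by simp only [MulAut.conj_apply, map_mul, map_inv, hc, hm]; decide)
    (by rw [k₃, map_one, inv_one])
  have kk := conj_conj_conj kc
  obtain ⟨e, he, -, hk⟩ := hπ.exists_sign (a := MulAut.conj m t₁) (b := t₂)
    (by simp only [MulAut.conj_apply, map_mul, map_inv, h₁, h₂, hm]; decide)
  have hk₂ : MulAut.conj m t₂ = e * t₁ := by
    apply (MulAut.conj c).injective
    rw [he.conj, k₁, ← hk, ← kk t₁, k₁]
  -- Conjugation by `m` swaps the translations up to the same sign twice, so invariance of `t₁ * t₂`
  -- is commutativity.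
  have r : t₁ * t₂ = t₂ * t₁ := by
    have := conj_eq_iff.2 h0.symm
    rwa [map_mul, hk, hk₂, he.mul_mul, eq_comm] at this
  have he1 : e = 1 := by
    have := kk t₂
    rwa [k₂, map_mul, map_inv, map_inv, hk, hk₂, he.mul_inv, he.mul_inv, he.mul_mul, map_mul,
      map_inv, map_inv, k₁, k₂, mul_inv_rev, inv_inv, inv_inv, ← r, mul_inv_cancel_right,
      right_eq_mul] at this
  rw [he1, one_mul] at hk hk₂
  refine ⟨t₁, t₂, c, m, h₁, h₂, hc, hm, ?_⟩
  constructor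
  case comm => exact r
  case rot_pow => exact k₃
  all_goals simp [trans, rotGen, mirGen, shift, flip, rot, mir]
  · exact conj_eq_iff.1 k₁
  · exact conj_eq_iff.1 k₂
  · exact conj_eq_iff.1 hk
  · exact conj_eq_iff.1 hk₂
  · rw [pow_two, h1]
  · exact hi ▸ conj_eq_iff.1 kc

theorem hasLifts_p6 {π : E →* Elt p6} (hπ : IsDoubleCover π z) (h : ∀ i, (inv p6 i).Lifts π) :
    HasLifts π := by
  obtain ⟨t₁, t₂, c, h₁, h₂, hc, k₁, k₂, k₃, r⟩ :=
    hπ.exists_lifts_six (by decide) (by decide) (h 0) (h 1)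
  refine ⟨t₁, t₂, c, 1, h₁, h₂, hc, map_one π, ?_⟩
  constructor
  case comm => exact r
  case rot_pow => rw [← k₃, ← pow_add]
  all_goals simp [trans, rotGen, mirGen, shift, flip, rot, mir]
  · exact conj_eq_iff.1 k₁
  · exact conj_eq_iff.1 k₂

theorem hasLifts_p6m {π : E →* Elt p6m} (hπ : IsDoubleCover π z)
    (h : ∀ i, (inv p6m i).Lifts π) : HasLifts π := by
  obtain ⟨t₁, t₂, c, h₁, h₂, hc, k₁, k₂, k₃, r⟩ :=
    hπ.exists_lifts_six (by decide) (by decide) (h 0) (h 1)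
  obtain ⟨m, hm⟩ := hπ.surj M
  have h2 : m * m = 1 := h 2 m hm
  have s := comm_of_involutions k₃ h2 (h 3 (c ^ 3 * m) (by rw [map_mul, map_pow, hc, hm]))
  have k6 : c ^ 6 = 1 := by rw [← k₃, ← pow_add]
  have hi : c⁻¹ = c ^ 5 := inv_eq_of_mul_eq_one_left (by rw [← pow_succ, k6])
  have kc : MulAut.conj m c = c⁻¹ := hπ.conj_eq_inv
    (by simp only [MulAut.conj_apply, map_mul, map_inv, hc, hm]; decide)
    (by rw [conj_eq_iff.2 s, inv_eq_of_mul_eq_one_left k₃])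
  have kk := conj_conj_conj kc
  obtain ⟨e, he, -, hk⟩ := hπ.exists_sign (a := MulAut.conj m t₁) (b := t₂)
    (by simp only [MulAut.conj_apply, map_mul, map_inv, h₁, h₂, hm]; decide)
  have hk₂ : MulAut.conj m t₂ = t₁ := by
    apply (MulAut.conj c).injective
    have := kk t₁
    rwa [k₁, map_mul, map_mul, hk, he.conj, k₂, mul_assoc, mul_right_inj, inv_mul_eq_iff_eq_mul,
      ← k₁] at this
  -- Since `m` has order two, the sign picked up by `t₁` on the way to `t₂` must be trivial: the way
  -- back has none.
  have he1 : e = 1 := by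
    have := conj_mul_apply m m t₁
    rwa [h2, map_one, MulAut.one_apply, hk, he.conj, hk₂, right_eq_mul] at this
  rw [he1, one_mul] at hk
  refine ⟨t₁, t₂, c, m, h₁, h₂, hc, hm, ?_⟩
  constructor
  case comm => exact r
  case rot_pow => exact k6
  all_goals simp [trans, rotGen, mirGen, shift, flip, rot, mir]
  · exact conj_eq_iff.1 k₁
  · exact conj_eq_iff.1 k₂
  · exact conj_eq_iff.1 hk
  · exact conj_eq_iff.1 hk₂
  · rw [pow_two, h2]
  · exact hi ▸ conj_eq_iff.1 kc

/-- If all invariants of a double cover are trivial, the generators can be lifted. -/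
theorem hasLifts {π : E →* Elt W} (hπ : IsDoubleCover π z) (h : ∀ i, (inv W i).Lifts π) :
    HasLifts π := by
  cases W
  exacts [hasLifts_p1 hπ h, hasLifts_p2 hπ h, hasLifts_pm hπ h, hasLifts_pg hπ h,
    hasLifts_cm hπ h, hasLifts_pmm hπ h, hasLifts_pmg hπ h, hasLifts_pgg hπ h, hasLifts_cmm hπ h,
    hasLifts_p4 hπ h, hasLifts_p4m hπ h, hasLifts_p4g hπ h, hasLifts_p3 hπ h, hasLifts_p3m1 hπ h,
    hasLifts_p31m hπ h, hasLifts_p6 hπ h, hasLifts_p6m hπ h]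

end lifts

/-! ### The invariants of a class -/

section invariants

/-- The invariant `α[ω]` of `ω = (-1) ^ f`, written additively. -/
def TopInv.val (f : Elt W × Elt W → ZMod 2) : TopInv W → ZMod 2
  | rotation g => f (g, g) - f (1, 1)
  | axis t m => f (t, m) - f (m, t)
  | cell t₁ t₂ => f (t₁, t₂) - f (t₂, t₁)
  | glideCell t s => f (t * s⁻¹, t * s) + f (t, s) - (f (s⁻¹, s) + f (t, s⁻¹))
  | mirror m => f (m, m) - f (1, 1)

theorem TopInv.eval_sgn (f : Elt W × Elt W → ZMod 2) (α : TopInv W) :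
    α.eval (sgn f) = (-1) ^ α.val f := by
  cases α <;> simp only [eval, val, sgn, uzpow_add, uzpow_sub]

theorem neg_one_uzpow_injective : Function.Injective fun a : ZMod 2 => (-1 : ℤˣ) ^ a := by
  decide

theorem TopInv.val_add (f f' : Elt W × Elt W → ZMod 2) (α : TopInv W) :
    α.val (f + f') = α.val f + α.val f' := by
  cases α <;> simp only [val, Pi.add_apply] <;> ring

theorem TopInv.val_zero (α : TopInv W) : α.val 0 = 0 := by
  cases α <;> simp [val]

/-- The relation between group elements that an invariant depends on. -/
def TopInv.Valid : TopInv W → Prop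
  | rotation g => g * g = 1
  | axis t m => t * m = m * t
  | cell t₁ t₂ => t₁ * t₂ = t₂ * t₁
  | glideCell t s => t * s⁻¹ * (t * s) = 1
  | mirror m => m * m = 1

instance (α : TopInv W) : Decidable α.Valid := by
  cases α <;> unfold TopInv.Valid <;> infer_instance

theorem inv_valid (i : Fin W.num) : (inv W i).Valid := by
  revert i
  cases W <;> decide

theorem smul_zmod_two (u : ℤˣ) (a : ZMod 2) : u • a = a := by
  rcases Int.units_eq_one_or u with rfl | rfl
  · simp
  · rw [Units.neg_smul, one_smul]
    revert a
    decide

/-- The relation between the group elements identifies the products at which `φ` is evaluated; all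
values then cancel or occur twice. -/
theorem TopInv.val_coboundary (φ : Elt W → ZMod 2) {α : TopInv W} (h : α.Valid) :
    α.val (fun p => φ p.2 - φ (p.1 * p.2) + φ p.1) = 0 := by
  have h2 : ∀ a b : ZMod 2, a - b + a - (b - b + b) = 0 := by decide
  have h3 : ∀ a b : ZMod 2, a * 2 - b * 2 = 0 := by decide
  cases α with
  | rotation g | mirror g =>
    simp only [Valid] at h
    simp only [val, h, mul_one]
    exact h2 _ _
  | axis t m | cell t₁ t₂ =>
    simp only [Valid] at h
    simp only [val, h]
    ring
  | glideCell t s =>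
    simp only [Valid] at h
    simp only [val, h, inv_mul_cancel]
    ring_nf
    exact h3 _ _

/-- A cocycle with trivial action, as a twisted cocycle. -/
def TwistedCocycle.ofMem (f : groupCohomology.cocycles₂ (Z2 W)) : TwistedCocycle W (ZMod 2) where
  toFun g h := f (g, h)
  cocycle g h k := by
    rw [smul_zmod_two]
    exact (groupCohomology.mem_cocycles₂_iff (A := Z2 W) f).1 f.2 g h k

/-- The central element has fibre component `1 - f(1, 1)`, one more than the identity of the cover.
-/
theorem Cover.isDoubleCover (f : TwistedCocycle W (ZMod 2)) :
    IsDoubleCover (Cover.proj f) ⟨1 - f.toFun 1 1, 1⟩ where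
  surj g := ⟨⟨0, g⟩, rfl⟩
  comm a := by
    ext1
    · rw [Cover.mul_fib, Cover.mul_fib, smul_zmod_two, smul_zmod_two]
      change a.fib + (1 - f.toFun 1 1) + f.toFun a.base 1 =
        1 - f.toFun 1 1 + a.fib + f.toFun 1 a.base
      rw [f.one_left a.base, f.one_right a.base, smul_zmod_two, add_comm a.fib]
    · simp [Cover.mul_base]
  sq := by
    ext1
    · simp only [Cover.mul_fib, Cover.one_fib, smul_zmod_two]
      generalize f.toFun 1 1 = a
      revert a
      decide
    · exact mul_one 1
  map := rfl
  ker a b h := by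
    have h' : a.base = b.base := h
    have h2 : ∀ x y d : ZMod 2, x = y ∨ x = 1 - d + y + d := by decide
    refine (h2 a.fib b.fib (f.toFun 1 1)).imp (fun h => Cover.ext h h') fun h => Cover.ext ?_ ?_
    · rw [Cover.mul_fib, smul_zmod_two]
      change a.fib = 1 - f.toFun 1 1 + b.fib + f.toFun 1 b.base
      rw [f.one_left b.base]
      exact h
    · exact h'.trans (one_mul _).symm

/-- In the cover the square of a lift of an involution, or the comparison of `a * b` with `b * a`,
is governed by precisely the combination of cocycle values in the invariant; the fibre components of
the lifts drop out mod 2. -/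
theorem TopInv.lifts_of_val_eq_zero (f : groupCohomology.cocycles₂ (Z2 W)) {α : TopInv W}
    (h : α.Valid) (h0 : α.val f = 0) : α.Lifts (Cover.proj (TwistedCocycle.ofMem f)) := by
  have hsq (g : Elt W) (hg : g * g = 1) (hf : f (g, g) - f (1, 1) = 0)
      (e : Cover (TwistedCocycle.ofMem f)) (he : e.base = g) : e * e = 1 := by
    ext1
    · rw [Cover.mul_fib, Cover.one_fib, he, smul_zmod_two]
      have key : ∀ a b d : ZMod 2, b - d = 0 → a + a + b = -d := by decide
      exact key _ _ _ hf
    · rw [Cover.mul_base, he, hg, Cover.one_base]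
  have hcomm (s t : Elt W) (hst : s * t = t * s) (hf : f (s, t) - f (t, s) = 0)
      (a b : Cover (TwistedCocycle.ofMem f)) (ha : a.base = s) (hb : b.base = t) :
      a * b = b * a := by
    ext1
    · rw [Cover.mul_fib, Cover.mul_fib, ha, hb, smul_zmod_two, smul_zmod_two]
      change _ + f (s, t) = _ + f (t, s)
      rw [sub_eq_zero.1 hf, add_comm a.fib]
    · rw [Cover.mul_base, Cover.mul_base, ha, hb, hst]
  cases α with
  | rotation g => exact fun e he => hsq g h h0 e he
  | axis t m => exact fun a b ha hb => hcomm t m h h0 a b ha hb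
  | cell t₁ t₂ => exact fun a b ha hb => hcomm t₁ t₂ h h0 a b ha hb
  | mirror g => exact fun e he => hsq g h h0 e he
  | glideCell t s =>
    intro a b ha hb
    have ha' : a.base = t := ha
    have hb' : b.base = s := hb
    ext1
    · have e : (b⁻¹).fib = -f (1, 1) - orient W b.base⁻¹ • b.fib - f (b.base⁻¹, b.base) := rfl
      have e' : (b⁻¹).base = b.base⁻¹ := rfl
      simp only [Cover.mul_fib, Cover.mul_base, Cover.one_fib, e, e', ha', hb', smul_zmod_two]
      have key : ∀ x y u v w q r : ZMod 2, r + q - (v + w) = 0 →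
          x + (-u - y - v) + w + (x + y + q) + r = -u := by decide
      exact key _ _ _ _ _ _ _ h0
    · change a.base * b.base⁻¹ * (a.base * b.base) = 1
      rw [ha', hb']
      exact h

open groupCohomology

theorem mem_coboundaries₂_iff (f : Elt W × Elt W → ZMod 2) :
    f ∈ coboundaries₂ (Z2 W) ↔
      ∃ φ : Elt W → ZMod 2, f = fun p => φ p.2 - φ (p.1 * p.2) + φ p.1 :=
  ⟨fun ⟨φ, h⟩ => ⟨φ, h.symm⟩, fun ⟨φ, h⟩ => ⟨φ, h.symm⟩⟩

/-- The invariants separate classes. -/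
theorem mem_coboundaries₂_of_val_eq_zero (f : cocycles₂ (Z2 W)) (h : ∀ i, (inv W i).val f = 0) :
    (f : Elt W × Elt W → ZMod 2) ∈ coboundaries₂ (Z2 W) := by
  obtain ⟨t₁, t₂, c, m, h₁, h₂, hc, hm, r⟩ := hasLifts (Cover.isDoubleCover (.ofMem f))
    fun i => TopInv.lifts_of_val_eq_zero f (inv_valid i) (h i)
  obtain ⟨φ, hφ⟩ := TwistedCocycle.exists_primitive _ t₁ t₂ c m h₁ h₂ hc hm r
  rw [mem_coboundaries₂_iff]
  refine ⟨fun g => -φ g, funext fun p => ?_⟩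
  have := hφ p.1 p.2
  rw [smul_zmod_two] at this
  change f (p.1, p.2) = _
  rw [show f (p.1, p.2) = _ from this]
  ring

theorem val_eq_zero_of_mem_coboundaries₂ {b : Elt W × Elt W → ZMod 2}
    (hb : b ∈ coboundaries₂ (Z2 W)) (i : Fin W.num) : (inv W i).val b = 0 := by
  obtain ⟨φ, rfl⟩ := (mem_coboundaries₂_iff b).1 hb
  exact TopInv.val_coboundary φ (inv_valid i)

end invariants

/-- The basis cochains are dual to the invariants. -/
theorem val_lam (i j : Fin W.num) : (inv W i).val (lam W j) = if i = j then 1 else 0 := by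
  revert i j
  cases W <;> decide +kernel

/-! ### The basis cochains are cocycles -/

section basisCocycles

/-- The defect of the cocycle identity is a coboundary, hence closed. Together with normalisation at
`1` this makes the `g` with vanishing defect a subgroup. -/
theorem cocycle_of_generators (f : Elt W → Elt W → ZMod 2) (h1 : ∀ h, f 1 h = 0)
    (hg : ∀ g, g = T₁ ∨ g = T₂ ∨ g = C ∨ g = M → ∀ h k, f (g * h) k + f g h = f h k + f g (h * k))
    (g h k : Elt W) : f (g * h) k + f g h = f h k + f g (h * k) := by
  let H : Subgroup (Elt W) :=
    { carrier := {g | ∀ h k, f (g * h) k + f g h = f h k + f g (h * k)}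
      one_mem' := fun h k => by rw [one_mul, h1, h1]
      mul_mem' := fun {a b} ha hb h k => by
        have e1 := ha (b * h) k
        have e2 := ha b h
        have e3 := ha b (h * k)
        have e4 := hb h k
        simp only [mul_assoc] at e1 e2 e3 e4 ⊢
        linear_combination e1 + e2 - e3 + e4
      inv_mem' := fun {a} ha h k => by
        have e1 := ha (a⁻¹ * h) k
        have e2 := ha a⁻¹ h
        have e3 := ha a⁻¹ (h * k)
        simp only [← mul_assoc, mul_inv_cancel, one_mul, h1] at e1 e2 e3 ⊢
        linear_combination e3 - e1 - e2 }
  exact mem_of_generators H (hg _ (by simp)) (hg _ (by simp)) (hg _ (by simp)) (hg _ (by simp))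
    g h k

/-! ### Splitting the basis cochains into translation and point-group parts. -/

/-- The part of the integral cochain that depends on the second translation only. -/
def linPart (W : WallpaperGroup) (j : Fin W.num) (c : Fin W.rot) (m : Fin W.mir) (v : ℤ × ℤ) : ℤ :=
  basisInt 0 c.val m.val v.1 v.2 0 0 W j

/-- The part of the integral cochain that is inflated from the point group. -/
def constPart (W : WallpaperGroup) (j : Fin W.num) (c : Fin W.rot) (m : Fin W.mir) (c' : Fin W.rot)
    (m' : Fin W.mir) : ℤ :=
  basisInt 0 c.val m.val 0 0 c'.val m'.val W j

/-- The coefficient of `y₁ * x₂` on translations. -/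
def areaCoeff (W : WallpaperGroup) (j : Fin W.num) : ℤ := basisInt 1 0 0 1 0 0 0 W j

/-- No basis cochain contains a product of a translation coordinate with the point-group component
of the second element. -/
theorem basisInt_split (y₁ c₁ m₁ x₂ y₂ c₂ m₂ : ℤ) (j : Fin W.num) :
    basisInt y₁ c₁ m₁ x₂ y₂ c₂ m₂ W j = basisInt y₁ c₁ m₁ x₂ y₂ 0 0 W j +
      basisInt 0 c₁ m₁ 0 0 c₂ m₂ W j - basisInt 0 c₁ m₁ 0 0 0 0 W j := by
  have h0 : ind 0 0 = 1 := rfl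
  have h1 : ind 0 1 = 0 := rfl
  have h2 : ind 0 2 = 0 := rfl
  have h3 : ind 0 3 = 0 := rfl
  cases W <;> fin_cases j <;>
    simp [basisInt, swapPart, hexPart, p4gPart, h0, h1, h2, h3] <;> ring

/-- A triangular number mod 2 depends only on its index mod 4. This is why the finite checks below
run over `Fin 4`. -/
theorem tri_congr {x x' : ℤ} (h : x ≡ x' [ZMOD 4]) :
    ((x * (x - 1) / 2 : ℤ) : ZMod 2) = ((x' * (x' - 1) / 2 : ℤ) : ZMod 2) := by
  obtain ⟨k, hk⟩ := h.symm.dvd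
  obtain rfl : x = x' + 4 * k := by linarith
  have e : (x' + 4 * k) * (x' + 4 * k - 1) =
      x' * (x' - 1) + 2 * (2 * (k * (2 * x' - 1) + 4 * k ^ 2)) := by ring
  rw [e, Int.add_mul_ediv_left _ _ two_ne_zero, Int.cast_add, Int.cast_mul 2]
  simp [show (2 : ZMod 2) = 0 from rfl]

theorem tri_congr' {x x' : ℤ} (h : x ≡ x' [ZMOD 4]) :
    ((x * (x + 1) / 2 : ℤ) : ZMod 2) = ((x' * (x' + 1) / 2 : ℤ) : ZMod 2) := by
  have := tri_congr (h.add_right 1)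
  rwa [add_sub_cancel_right, add_sub_cancel_right, mul_comm, mul_comm _ x'] at this

theorem basisInt_congr {y₁ y₁' x x' y y' : ℤ} (hy₁ : y₁ ≡ y₁' [ZMOD 4]) (hx : x ≡ x' [ZMOD 4])
    (hy : y ≡ y' [ZMOD 4]) (c m : ℤ) (j : Fin W.num) :
    (basisInt y₁ c m x y 0 0 W j : ZMod 2) = basisInt y₁' c m x' y' 0 0 W j := by
  have h2 {a b : ℤ} (h : a ≡ b [ZMOD 4]) : (a : ZMod 2) = b :=
    (ZMod.intCast_eq_intCast_iff a b 2).2 (h.of_dvd (by norm_num))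
  have e1 := h2 hy₁
  have e2 := h2 hx
  have e3 := h2 hy
  have e4 := tri_congr hx
  have e5 := tri_congr hy
  have e6 := tri_congr' hx
  have e7 := tri_congr' hy
  cases W <;> fin_cases j <;> simp [basisInt, swapPart, hexPart, p4gPart, e1, e2, e3, e4, e5, e6, e7]

theorem cast_eq_of_emod {a b : ℤ} (h : (a - b) % 2 = 0) : (a : ZMod 2) = b :=
  (ZMod.intCast_eq_intCast_iff_dvd_sub a b 2).2 (by
    rw [← neg_sub, dvd_neg]
    exact_mod_cast Int.dvd_of_emod_eq_zero h)

/-- The linear part of an element, as an additive map. -/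
def linHom (W : WallpaperGroup) (c : Fin W.rot) (m : Fin W.mir) : ℤ × ℤ →+ ℤ × ℤ :=
  AddMonoidHom.mk' (lin W c m) fun u v => by
    have h (k : ℕ) : (mirGen W)^[k] (u + v) = (mirGen W)^[k] u + (mirGen W)^[k] v := by
      induction k generalizing u v with
      | zero => rfl
      | succ k ih => simp only [Function.iterate_succ, Function.comp_apply, mirGen_add, ih]
    rw [lin, h, rotGen_iterate_add]
    rfl

theorem lin_add (c : Fin W.rot) (m : Fin W.mir) (u v : ℤ × ℤ) :
    lin W c m (u + v) = lin W c m u + lin W c m v := map_add (linHom W c m) u v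

theorem lin_congr (c : Fin W.rot) (m : Fin W.mir) {u v : ℤ × ℤ} (h₁ : u.1 ≡ v.1 [ZMOD 4])
    (h₂ : u.2 ≡ v.2 [ZMOD 4]) : (lin W c m u).1 ≡ (lin W c m v).1 [ZMOD 4] ∧
      (lin W c m u).2 ≡ (lin W c m v).2 [ZMOD 4] := by
  obtain ⟨a, ha⟩ := h₁.symm.dvd
  obtain ⟨b, hb⟩ := h₂.symm.dvd
  have e : u = v + (4 : ℤ) • (a, b) := by
    ext
    · simp; linarith
    · simp; linarith
  have e2 : lin W c m u = lin W c m v + (4 : ℤ) • lin W c m (a, b) := by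
    rw [e, lin_add]
    exact congrArg _ (map_zsmul (linHom W c m) 4 (a, b))
  rw [e2]
  constructor
  · simp [Int.ModEq]
  · simp [Int.ModEq]

theorem linPart_congr (j : Fin W.num) (c : Fin W.rot) (m : Fin W.mir) {u v : ℤ × ℤ}
    (h₁ : u.1 ≡ v.1 [ZMOD 4]) (h₂ : u.2 ≡ v.2 [ZMOD 4]) :
    (linPart W j c m u : ZMod 2) = linPart W j c m v :=
  basisInt_congr rfl h₁ h₂ _ _ j

theorem exists_fin_modEq (a : ℤ) : ∃ k : Fin 4, a ≡ (k.val : ℤ) [ZMOD 4] :=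
  ⟨⟨(a % 4).toNat, by omega⟩, by
    rw [Int.ModEq]
    simp only
    omega⟩

/-- The basis vectors. -/
def unitVec (k : Bool) : ℤ × ℤ := bif k then (1, 0) else (0, 1)

/-- A vector with coordinates in `{0, 1, 2, 3}`. -/
def finVec (x y : Fin 4) : ℤ × ℤ := (x.val, y.val)

theorem basisInt_eq_fin (j : Fin W.num) (c : Fin W.rot) (m : Fin W.mir) (y₁ x y : Fin 4) :
    (basisInt y₁.val c.val m.val x.val y.val 0 0 W j -
      (areaCoeff W j * (y₁.val * (lin W c m (finVec x y)).1) +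
        linPart W j c m (finVec x y))) % 2 = 0 := by
  revert c m y₁ x y j
  cases W <;> decide +kernel

theorem constPart_zero (j : Fin W.num) (c : Fin W.rot) (m : Fin W.mir) :
    constPart W j c m 0 0 % 2 = 0 := by
  revert j c m
  cases W <;> decide +kernel

/-- The structural form of a basis cochain: a bilinear area term, a function of the second
translation for each point-group class, and a cochain inflated from the point group. The cocycle
identity then splits into the conditions of `Compatible`. -/
theorem lam_eq (j : Fin W.num) (g h : Elt W) :
    lam W j (g, h) = areaCoeff W j * (g.y * (lin W g.c g.m (h.x, h.y)).1) +
      linPart W j g.c g.m (h.x, h.y) + constPart W j g.c g.m h.c h.m := by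
  obtain ⟨y₁, hy₁⟩ := exists_fin_modEq g.y
  obtain ⟨x, hx⟩ := exists_fin_modEq h.x
  obtain ⟨y, hy⟩ := exists_fin_modEq h.y
  have h2 {a b : ℤ} (h : a ≡ b [ZMOD 4]) : (a : ZMod 2) = b :=
    (ZMod.intCast_eq_intCast_iff a b 2).2 (h.of_dvd (by norm_num))
  have e1 := cast_eq_of_emod (basisInt_eq_fin j g.c g.m y₁ x y)
  have e2 := cast_eq_of_emod (b := 0) (by rw [sub_zero]; exact constPart_zero j g.c g.m)
  rw [lam, basisInt_split]
  simp only [constPart, Fin.val_zero, Nat.cast_zero, Int.cast_zero] at e2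
  push_cast at e1 ⊢
  rw [e2, basisInt_congr hy₁ hx hy, e1,
    linPart_congr j g.c g.m (u := (h.x, h.y)) (v := finVec x y) hx hy,
    h2 (lin_congr g.c g.m (u := (h.x, h.y)) (v := finVec x y) hx hy).1, h2 hy₁]
  simp [constPart]

/-- The compatibility conditions of the parts of a basis cochain, for an element `(c, m)` of the
point group. -/
structure Compatible (j : Fin W.num) (c : Fin W.rot) (m : Fin W.mir) : Prop where
  quad : ∀ u v : ℤ × ℤ, (linPart W j c m (u + v) : ZMod 2) = linPart W j c m u + linPart W j c m v +
    areaCoeff W j * ((lin W c m u).2 * (lin W c m v).1 - u.2 * v.1)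
  mul : ∀ c' m' (v : ℤ × ℤ), (linPart W j (c + flip m c') (m + m') v : ZMod 2) =
    linPart W j c' m' v + linPart W j c m (lin W c' m' v)
  const : ∀ c' m' c'' m'', (linPart W j c m (shift W c' m' c'' m'') + constPart W j c' m' c'' m'' +
    constPart W j c m (c' + flip m' c'') (m' + m'') : ZMod 2) =
      constPart W j (c + flip m c') (m + m') c'' m'' + constPart W j c m c' m'
  lin : ∀ c' m' (v : ℤ × ℤ), lin W (c + flip m c') (m + m') v = lin W c m (lin W c' m' v)

/-- The generators of the point group. -/
def IsPointGen (c : Fin W.rot) (m : Fin W.mir) : Prop := (c = 1 ∧ m = 0) ∨ (c = 0 ∧ m = 1)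

instance (c : Fin W.rot) (m : Fin W.mir) : Decidable (IsPointGen c m) := by
  unfold IsPointGen
  infer_instance

theorem linPart_mul_fin (j : Fin W.num) (c : Fin W.rot) (m : Fin W.mir) (h : IsPointGen c m)
    (c' : Fin W.rot) (m' : Fin W.mir) (x y : Fin 4) :
    (linPart W j (c + flip m c') (m + m') (finVec x y) -
      (linPart W j c' m' (finVec x y) +
        linPart W j c m (WallpaperGroup.lin W c' m' (finVec x y)))) % 2 = 0 := by
  revert c m j c' m' x y
  cases W <;> decide +kernel

theorem linPart_quad_fin (j : Fin W.num) (c : Fin W.rot) (m : Fin W.mir) (h : IsPointGen c m)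
    (k : Bool) (x y : Fin 4) :
    (linPart W j c m ((finVec x y) + unitVec k) -
      (linPart W j c m (finVec x y) + linPart W j c m (unitVec k) +
        areaCoeff W j * ((WallpaperGroup.lin W c m (finVec x y)).2 *
          (WallpaperGroup.lin W c m (unitVec k)).1 -
            y.val * (unitVec k).1))) % 2 = 0 := by
  revert c m j k x y
  cases W <;> decide +kernel

/-- For a bilinear `b`, the `v` that satisfy the identity for all `u` form a subgroup, so the basis
vectors suffice. -/
theorem quad_of_basis (F : ℤ × ℤ → ZMod 2) (b : ℤ × ℤ → ℤ × ℤ → ZMod 2)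
    (hl : ∀ u u' v, b (u + u') v = b u v + b u' v) (hr : ∀ u v v', b u (v + v') = b u v + b u v')
    (h₁ : ∀ u, F (u + (1, 0)) = F u + F (1, 0) + b u (1, 0))
    (h₂ : ∀ u, F (u + (0, 1)) = F u + F (0, 1) + b u (0, 1)) (u v : ℤ × ℤ) :
    F (u + v) = F u + F v + b u v := by
  have hl0 (v) : b 0 v = 0 := by simpa using hl 0 0 v
  have hr0 (u) : b u 0 = 0 := by simpa using hr u 0 0
  have h0 : F 0 = 0 := by simpa [hl0] using h₁ 0
  let H : AddSubgroup (ℤ × ℤ) :=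
    { carrier := {v | ∀ u, F (u + v) = F u + F v + b u v}
      zero_mem' := fun u => by rw [add_zero, h0, hr0, add_zero, add_zero]
      add_mem' := fun {v w} hv hw u => by
        rw [← add_assoc, hw, hv, hw, hl, hr]
        ring
      neg_mem' := fun {v} hv u => by
        have e1 := hv (u + -v)
        have e2 := hv (-v)
        have e3 := hl u (-v) v
        have e4 := hr u v (-v)
        rw [neg_add_cancel_right] at e1
        rw [neg_add_cancel, h0] at e2
        rw [add_neg_cancel, hr0] at e4
        linear_combination -e1 + e2 - e3 + e4 }
  have e : v = v.1 • (1, 0) + v.2 • (0, 1) := by ext <;> simp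
  exact (show v ∈ H by
    rw [e]
    exact H.add_mem (H.zsmul_mem h₁ _) (H.zsmul_mem h₂ _)) u

theorem constPart_fin (j : Fin W.num) (c : Fin W.rot) (m : Fin W.mir) (h : IsPointGen c m)
    (c' : Fin W.rot) (m' : Fin W.mir) (c'' : Fin W.rot) (m'' : Fin W.mir) :
    (linPart W j c m (shift W c' m' c'' m'') + constPart W j c' m' c'' m'' +
      constPart W j c m (c' + flip m' c'') (m' + m'') -
        (constPart W j (c + flip m c') (m + m') c'' m'' + constPart W j c m c' m')) % 2 = 0 := by
  revert c m j c' m' c'' m''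
  cases W <;> decide +kernel

theorem lin_mul_fin (c : Fin W.rot) (m : Fin W.mir) (h : IsPointGen c m) (c' : Fin W.rot)
    (m' : Fin W.mir) (k : Bool) :
    lin W (c + flip m c') (m + m') (unitVec k) =
      lin W c m (lin W c' m' (unitVec k)) := by
  revert c m c' m' k
  cases W <;> decide +kernel

/-- Excludes the mixed terms that a bilinear area term would produce with the translations in
products of point-group representatives: the two never occur together mod 2. -/
theorem areaCoeff_or_shift (j : Fin W.num) :
    (areaCoeff W j : ZMod 2) = 0 ∨ ∀ c m c' m', shift W c m c' m' = (0, 0) := by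
  cases W
  case pg | pmg | pgg | p4g =>
    left
    revert j
    decide
  all_goals exact Or.inr fun _ _ _ _ => rfl

theorem compatible (j : Fin W.num) {c : Fin W.rot} {m : Fin W.mir} (h : IsPointGen c m) :
    Compatible j c m where
  quad := by
    have hb (k : Bool) (u : ℤ × ℤ) :
        (linPart W j c m (u + unitVec k) : ZMod 2) =
          linPart W j c m u + linPart W j c m (unitVec k) +
          areaCoeff W j * ((lin W c m u).2 * (lin W c m (unitVec k)).1 -
            u.2 * (unitVec k).1) := by
      obtain ⟨x, hx⟩ := exists_fin_modEq u.1
      obtain ⟨y, hy⟩ := exists_fin_modEq u.2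
      have h2 {a b : ℤ} (h : a ≡ b [ZMOD 4]) : (a : ZMod 2) = b :=
        (ZMod.intCast_eq_intCast_iff a b 2).2 (h.of_dvd (by norm_num))
      have e := cast_eq_of_emod (linPart_quad_fin j c m h k x y)
      push_cast at e
      rw [linPart_congr j c m (u := u + _) (v := finVec x y + _) (hx.add_right _) (hy.add_right _),
        linPart_congr j c m (v := finVec x y) hx hy, h2 hy,
        h2 (lin_congr c m (v := finVec x y) hx hy).2]
      exact e
    exact quad_of_basis (fun v => (linPart W j c m v : ZMod 2))
      (fun u v => areaCoeff W j * ((lin W c m u).2 * (lin W c m v).1 - u.2 * v.1))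
      (fun u u' v => by
        simp only [lin_add, Prod.snd_add]
        push_cast
        ring)
      (fun u v v' => by
        simp only [lin_add, Prod.fst_add]
        push_cast
        ring) (hb true) (hb false)
  mul c' m' v := by
    obtain ⟨x, hx⟩ := exists_fin_modEq v.1
    obtain ⟨y, hy⟩ := exists_fin_modEq v.2
    have e := cast_eq_of_emod (linPart_mul_fin j c m h c' m' x y)
    have e2 := lin_congr c' m' (v := finVec x y) hx hy
    push_cast at e
    rw [linPart_congr j _ _ (v := finVec x y) hx hy, linPart_congr j c' m' (v := finVec x y) hx hy,
      linPart_congr j c m e2.1 e2.2]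
    exact e
  const c' m' c'' m'' := by
    have e := cast_eq_of_emod (constPart_fin j c m h c' m' c'' m'')
    push_cast at e
    exact e
  lin c' m' v := by
    have e : v = v.1 • unitVec true + v.2 • unitVec false := by ext <;> simp [unitVec]
    change linHom W _ _ v = linHom W c m (linHom W c' m' v)
    rw [e]
    simp only [map_add, map_zsmul]
    exact congrArg₂ (v.1 • · + v.2 • ·) (lin_mul_fin c m h c' m' true)
      (lin_mul_fin c m h c' m' false)

theorem linPart_zero_zero (j : Fin W.num) (v : ℤ × ℤ) : linPart W j 0 0 v = 0 := by
  have h1 : ind 0 1 = 0 := rfl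
  have h2 : ind 0 2 = 0 := rfl
  have h3 : ind 0 3 = 0 := rfl
  have h4 : ind 0 4 = 0 := rfl
  have h5 : ind 0 5 = 0 := rfl
  cases W <;> fin_cases j <;>
    simp [linPart, basisInt, swapPart, hexPart, p4gPart, carry, h1, h2, h3, h4, h5]

theorem constPart_zero_left (j : Fin W.num) (c : Fin W.rot) (m : Fin W.mir) :
    (constPart W j 0 0 c m : ZMod 2) = 0 := by
  revert j c m
  cases W <;> decide +kernel

/-- The cocycle condition of a basis cochain for a generator of the point group. -/
theorem lam_cocycle_of_compatible (j : Fin W.num) {c : Fin W.rot} {m : Fin W.mir}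
    (r : Compatible j c m) (h k : Elt W) :
    lam W j (⟨0, 0, c, m⟩ * h, k) + lam W j (⟨0, 0, c, m⟩, h) =
      lam W j (h, k) + lam W j (⟨0, 0, c, m⟩, h * k) := by
  simp only [lam_eq, mul_def', zero_add]
  have e := r.const h.c h.m k.c k.m
  have e2 := r.mul h.c h.m (k.x, k.y)
  have e3 := r.lin h.c h.m (k.x, k.y)
  have q1 := r.quad ((h.x, h.y) + lin W h.c h.m (k.x, k.y)) (shift W h.c h.m k.c k.m)
  have q2 := r.quad (h.x, h.y) (lin W h.c h.m (k.x, k.y))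
  have e4 : ((h.x + (lin W h.c h.m (k.x, k.y)).1 + (shift W h.c h.m k.c k.m).1,
      h.y + (lin W h.c h.m (k.x, k.y)).2 + (shift W h.c h.m k.c k.m).2) : ℤ × ℤ) =
        (h.x, h.y) + lin W h.c h.m (k.x, k.y) + shift W h.c h.m k.c k.m := rfl
  rw [e4, q1, q2, e2, e3]
  -- Without area coefficient only the parts `linPart` and `constPart` remain; without shift the
  -- area terms cancel against the quadratic defect. In both cases `const` is what is left.
  rcases areaCoeff_or_shift j with h0 | h0
  · rw [h0]
    push_cast
    linear_combination -e
  · simp only [h0, add_zero, ← Prod.zero_eq_mk, Prod.fst_zero, Prod.snd_zero] at e ⊢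
    have e5 : lin W c m (0 : ℤ × ℤ) = 0 := map_zero (linHom W c m)
    rw [e5]
    push_cast
    simp only [Prod.fst_zero, Int.cast_zero]
    linear_combination -e

theorem lam_cocycle_of_trans (j : Fin W.num) (a b : ℤ) (h k : Elt W) :
    lam W j (⟨a, b, 0, 0⟩ * h, k) + lam W j (⟨a, b, 0, 0⟩, h) =
      lam W j (h, k) + lam W j (⟨a, b, 0, 0⟩, h * k) := by
  simp only [lam_eq, mul_def', zero_add, lin_zero, shift_zero_zero, flip_zero, add_zero,
    linPart_zero_zero, constPart_zero_left]
  rcases areaCoeff_or_shift j with h0 | h0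
  · rw [h0]
    ring
  · rw [h0]
    push_cast
    ring

theorem lam_mem_cocycles₂ (j : Fin W.num) : lam W j ∈ groupCohomology.cocycles₂ (Z2 W) := by
  rw [groupCohomology.mem_cocycles₂_iff]
  refine cocycle_of_generators (fun g h => lam W j (g, h)) (fun h => ?_) ?_
  · simp [lam_eq, one_def', linPart_zero_zero, constPart_zero_left]
  · rintro g (rfl | rfl | rfl | rfl)
    · exact lam_cocycle_of_trans j 1 0
    · exact lam_cocycle_of_trans j 0 1
    · exact lam_cocycle_of_compatible j (compatible j (Or.inl ⟨rfl, rfl⟩))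
    · exact lam_cocycle_of_compatible j (compatible j (Or.inr ⟨rfl, rfl⟩))

end basisCocycles

/-! ### The kernel -/

section kernel

open groupCohomology

theorem map_H2π {A B : Rep ℤ (Elt W)} (φ : A ⟶ B) (f : cocycles₂ A) :
    (groupCohomology.functor ℤ (Elt W) 2).map φ (H2π A f) =
      H2π B (mapCocycles₂ (MonoidHom.id _) φ f) :=
  H2π_comp_map_apply (MonoidHom.id _) φ f

/-- Exactness of the long exact cohomology sequence at `H²(G_s, U(1)_ρ)`. -/
theorem bockstein_eq_zero_iff (x : groupCohomology (Rep.of (twist W UnitAddCircle)) 2) :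
    bockstein W x = 0 ↔
      ∃ y, (groupCohomology.functor ℤ (Elt W) 2).map (expSeq W).g y = x := by
  have h := mapShortComplex₃_exact (expSeq_shortExact W) (i := 2) (j := 3) rfl
  rw [ShortComplex.moduleCat_exact_iff] at h
  refine ⟨fun hx => h x hx, ?_⟩
  rintro ⟨y, rfl⟩
  have := (mapShortComplex₃ (expSeq_shortExact W) (i := 2) (j := 3) rfl).zero
  exact ConcreteCategory.congr_hom this y

/-- A class is in the kernel if and only if, after inclusion in `U(1)`, it is the reduction of a
real cocycle up to a coboundary. -/
theorem cls_mem_kerITilde_iff (f : cocycles₂ (Z2 W)) :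
    cls f ∈ kerITilde W ↔ ∃ (r : TwistedCocycle W ℝ) (φ : Elt W → UnitAddCircle), ∀ g h,
      ZMod.toAddCircle (N := 2) (f (g, h)) =
        (r.toFun g h : UnitAddCircle) + (orient W g • φ h - φ (g * h) + φ g) := by
  have h0 : cls f ∈ kerITilde W ↔ bockstein W (iTilde W (cls f)) = 0 := Iff.rfl
  rw [h0, bockstein_eq_zero_iff]
  have h1 : iTilde W (cls f) = H2π _ (mapCocycles₂ (MonoidHom.id _) (incl W) f) := map_H2π _ f
  constructor
  · rintro ⟨y, hy⟩
    induction y using H2_induction_on with | h r => ?_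
    have hy' : H2π (Rep.of (twist W UnitAddCircle)) (mapCocycles₂ (MonoidHom.id _) (incl W) f) =
        H2π (Rep.of (twist W UnitAddCircle)) (mapCocycles₂ (MonoidHom.id _) (expSeq W).g r) :=
      h1.symm.trans (hy.symm.trans (map_H2π _ r))
    obtain ⟨φ, hφ⟩ := (H2π_eq_iff _ _).1 hy'
    refine ⟨⟨fun g h => r (g, h), fun g h k => (mem_cocycles₂_iff _).1 r.2 g h k⟩, φ,
      fun g h => ?_⟩
    have := congrFun hφ (g, h)
    exact (eq_add_of_sub_eq' this.symm)
  · rintro ⟨r, φ, h⟩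
    let r' : cocycles₂ (Rep.of (twist W ℝ)) := ⟨fun p => r.toFun p.1 p.2,
      (mem_cocycles₂_iff _).2 fun g h k => r.cocycle g h k⟩
    refine ⟨H2π (Rep.of (twist W ℝ)) r', ?_⟩
    refine (map_H2π (expSeq W).g r').trans (Eq.trans ?_ h1.symm)
    refine Eq.symm ((H2π_eq_iff (A := Rep.of (twist W UnitAddCircle)) _ _).2
      ⟨φ, funext fun p => ?_⟩)
    exact (sub_eq_of_eq_add' (h p.1 p.2)).symm

instance (α : TopInv W) : Decidable α.IsLSM := by
  cases α <;> unfold TopInv.IsLSM <;> infer_instance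

/-- A mirror-type invariant belongs to an orientation-reversing element. -/
def TopInv.MirrorReverses : TopInv W → Prop
  | mirror g => orient W g = -1
  | _ => True

instance (α : TopInv W) : Decidable α.MirrorReverses := by
  cases α <;> unfold TopInv.MirrorReverses <;> infer_instance

theorem inv_mirrorReverses (i : Fin W.num) : (inv W i).MirrorReverses := by
  revert i
  cases W <;> decide

/-- The mirror-type invariants of a class in the kernel are trivial. -/
theorem val_eq_zero_of_mem_kerITilde {f : cocycles₂ (Z2 W)} (hf : cls f ∈ kerITilde W)
    (i : Fin W.num) (hi : ¬(inv W i).IsLSM) : (inv W i).val f = 0 := by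
  obtain ⟨r, φ, h⟩ := (cls_mem_kerITilde_iff f).1 hf
  have hv := inv_valid i
  have hr := inv_mirrorReverses i
  generalize inv W i = α at hi hv hr
  cases α with
  | mirror g =>
    have ho : orient W g = -1 := hr
    have hg : g * g = 1 := hv
    -- Because `g` acts by `-1`, this identity reads `2 r(g, g) = -2 r(1, 1)`, and one may divide by
    -- two in the reals.
    have e1 := r.cocycle g g g
    rw [hg, r.one_left g, r.one_right g, ho, Units.neg_smul, Units.neg_smul, one_smul, one_smul] at e1
    have e2 : r.toFun g g = -r.toFun 1 1 := by linarith
    have h1 := h g g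
    have h2 := h 1 1
    rw [hg, ho, e2, Units.neg_smul, one_smul] at h1
    rw [map_one, one_smul, mul_one] at h2
    apply ZMod.toAddCircle_injective 2
    -- As a sum, the invariant has cancelling real parts, and the coboundary contributions `-φ(1)`
    -- and `φ(1)` cancel too.
    have h3 : ∀ a b : ZMod 2, a - b = a + b := by decide
    change ZMod.toAddCircle (N := 2) ((f (g, g) : ZMod 2) - (f (1, 1) : ZMod 2)) = _
    rw [h3, map_add, h1, h2, map_zero, QuotientAddGroup.mk_neg]
    abel
  | _ => exact absurd trivial hi

/-! ### The area cocycle. -/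

/-- The determinant. -/
def det (u v : ℤ × ℤ) : ℤ := u.1 * v.2 - u.2 * v.1

/-- Twice the translation part of `M`. -/
def glideInt : WallpaperGroup → ℤ × ℤ
  | pg => (0, 1)
  | pmg => (1, 0)
  | pgg => (1, 1)
  | p4g => (1, 1)
  | _ => (0, 0)

/-- Twice the translation part of `C ^ c * M ^ m`. -/
def pointPart (W : WallpaperGroup) (c : Fin W.rot) (m : Fin W.mir) : ℤ × ℤ :=
  if m = 0 then (0, 0) else (rotGen W.rot)^[c.val] (glideInt W)

/-- Twice the translation part of an element. -/
def transPart (g : Elt W) : ℤ × ℤ := (2 : ℤ) • (g.x, g.y) + pointPart W g.c g.m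

theorem lin_mul (c : Fin W.rot) (m : Fin W.mir) (c' : Fin W.rot) (m' : Fin W.mir) (v : ℤ × ℤ) :
    lin W (c + flip m c') (m + m') v = lin W c m (lin W c' m' v) := by
  have h : ∀ c m c' m' k, lin W (c + flip m c') (m + m') (unitVec k) =
      lin W c m (lin W c' m' (unitVec k)) := by
    cases W <;> decide +kernel
  have e : v = v.1 • unitVec true + v.2 • unitVec false := by ext <;> simp [unitVec]
  change linHom W _ _ v = linHom W c m (linHom W c' m' v)
  rw [e]
  simp only [map_add, map_zsmul]
  exact congrArg₂ (v.1 • · + v.2 • ·) (h c m c' m' true) (h c m c' m' false)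

theorem pointPart_mul (c : Fin W.rot) (m : Fin W.mir) (c' : Fin W.rot) (m' : Fin W.mir) :
    (2 : ℤ) • shift W c m c' m' + pointPart W (c + flip m c') (m + m') =
      pointPart W c m + lin W c m (pointPart W c' m') := by
  revert c m c' m'
  cases W <;> decide +kernel

/-- The translation part is a crossed homomorphism for the linear action; doubling makes the
half-integral glides integral. -/
theorem transPart_mul (g h : Elt W) :
    transPart (g * h) = transPart g + lin W g.c g.m (transPart h) := by
  have e1 := pointPart_mul g.c g.m h.c h.m
  have e2 : lin W g.c g.m ((2 : ℤ) • (h.x, h.y)) = (2 : ℤ) • lin W g.c g.m (h.x, h.y) :=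
    map_zsmul (linHom W g.c g.m) 2 (h.x, h.y)
  have e3 : transPart (g * h) = (2 : ℤ) • (g.x, g.y) + (2 : ℤ) • lin W g.c g.m (h.x, h.y) +
      ((2 : ℤ) • shift W g.c g.m h.c h.m + pointPart W (g.c + flip g.m h.c) (g.m + h.m)) := by
    rw [mul_def', transPart, ← add_assoc, ← smul_add, ← smul_add]
    rfl
  rw [e3, e1, transPart, transPart, lin_add, e2]
  abel

/-- Linear parts have determinant `±1` with the sign of the orientation, so the determinant pairs
two translation modules into `ℤ_ρ`; this gives the twisted cocycle identity of `area`. -/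
theorem det_lin (g : Elt W) (u v : ℤ × ℤ) :
    det (lin W g.c g.m u) (lin W g.c g.m v) = orient W g • det u v := by
  obtain ⟨x, y, c, m⟩ := g
  cases W <;> fin_cases c <;> fin_cases m <;>
    simp [det, lin, rotGen, mirGen, orient, Units.smul_def] <;> ring

theorem det_add_left (u u' v : ℤ × ℤ) : det (u + u') v = det u v + det u' v := by
  simp only [det, Prod.fst_add, Prod.snd_add]
  ring

theorem det_add_right (u v v' : ℤ × ℤ) : det u (v + v') = det u v + det u v' := by
  simp only [det, Prod.fst_add, Prod.snd_add]
  ring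

/-- Four times the area cocycle. -/
def area (W : WallpaperGroup) : TwistedCocycle W ℤ where
  toFun g h := det (transPart g) (lin W g.c g.m (transPart h))
  cocycle g h k := by
    have e : lin W (g * h).c (g * h).m (transPart k) =
        lin W g.c g.m (lin W h.c h.m (transPart k)) := lin_mul _ _ _ _ _
    rw [e, transPart_mul, transPart_mul, lin_add, det_add_left, det_add_right, ← det_lin]
    ring

/-- The embedding of `ℤ/2` in `ℤ/16`. -/
def embed (a : ZMod 2) : ZMod 16 := 8 * a.val

theorem embed_add (a b : ZMod 2) : embed (a + b) = embed a + embed b := by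
  revert a b
  decide

/-- The element `8` of `ℤ/16` is its own negative, so the embedded `ℤ/2` is fixed by complex
conjugation. -/
theorem smul_embed (u : ℤˣ) (a : ZMod 2) : u • embed a = embed a := by
  revert u a
  decide

theorem toAddCircle_embed (a : ZMod 2) :
    ZMod.toAddCircle (embed a) = ZMod.toAddCircle (N := 2) a := by
  have h : ZMod.toAddCircle (N := 16) ((8 : ℤ) : ZMod 16) =
      ZMod.toAddCircle (N := 2) ((1 : ℤ) : ZMod 2) := by
    rw [ZMod.toAddCircle_intCast, ZMod.toAddCircle_intCast]
    norm_num
  have h2 : a = 0 ∨ a = 1 := by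
    revert a
    decide
  rcases h2 with rfl | rfl
  · simp [embed]
  · exact_mod_cast h

/-- The difference of a basis cocycle and a multiple of the area cocycle, with values in
`ℤ/16 ⊂ U(1)`. -/
def areaDefect (W : WallpaperGroup) (j : Fin W.num) (k : ℤ) : TwistedCocycle W (ZMod 16) where
  toFun g h := embed (lam W j (g, h)) - (k * (area W).toFun g h : ℤ)
  cocycle g h l := by
    have h1 := (mem_cocycles₂_iff (A := Z2 W) (lam W j)).1 (lam_mem_cocycles₂ j) g h l
    have h1' : embed (lam W j (g * h, l)) + embed (lam W j (g, h)) =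
        embed (lam W j (h, l)) + embed (lam W j (g, h * l)) := by
      rw [← embed_add, ← embed_add]
      exact congrArg embed h1
    have h2 := congrArg (fun a : ℤ => (k * a : ZMod 16)) ((area W).cocycle g h l)
    have h3 : ((orient W g • (area W).toFun h l : ℤ) : ZMod 16) =
        orient W g • ((area W).toFun h l : ZMod 16) := by
      simp [Units.smul_def]
    have h4 : orient W g • (k * (area W).toFun h l : ZMod 16) =
        k * orient W g • ((area W).toFun h l : ZMod 16) := by
      simp [Units.smul_def, mul_left_comm]
    simp only [Int.cast_add, h3] at h2
    simp only [smul_sub, smul_embed, Int.cast_mul, h4]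
    linear_combination h1' - h2

/-- The multiple of the area cocycle to which a basis cocycle is cohomologous, and the components
in `ℤ/16` of lifts of `T₁`, `T₂`, `C`, `M` which satisfy the defining relations. -/
def areaData : (W : WallpaperGroup) → Fin W.num → ℤ × ZMod 16 × ZMod 16 × ZMod 16 × ZMod 16
  | p1 => ![(-1, 0, 0, 0, 0)]
  | p2 => ![(-1, 4, 4, 4, 0), (-1, 4, 0, 0, 0), (-1, 0, 4, 0, 0), (-1, 0, 0, 0, 0)]
  | pm => ![(-1, 0, 4, 0, 0), (-1, 0, 0, 0, 0), 0, 0]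
  | pg => ![(-2, 0, 0, 0, 0)]
  | cm => ![(-1, 0, 0, 0, 0), 0]
  | pmm => ![(-1, 4, 4, 4, 0), (-1, 0, 0, 0, 0), (-1, 4, 0, 0, 0), (-1, 0, 4, 0, 0), 0, 0, 0, 0]
  | pmg => ![(-2, 8, 4, 4, 0), (-2, 0, 4, 0, 0), (-2, 0, 0, 0, 0), 0]
  | pgg => ![(-2, 12, 4, 4, 0), (-2, 4, 4, 0, 0)]
  | cmm => ![(-1, 4, 12, 4, 0), (-1, 0, 0, 0, 0), (0, 4, 12, 0, 0), 0, 0]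
  | p4 => ![(-1, 4, 12, 2, 0), (-1, 0, 0, 0, 0), (0, 4, 12, 0, 0)]
  | p4m => ![(-1, 4, 12, 2, 0), (-1, 0, 0, 0, 0), (0, 4, 12, 0, 0), 0, 0, 0]
  | p4g => ![(-2, 4, 4, 2, 0), (-2, 4, 4, 0, 0), 0]
  | p3 => ![(-1, 12, 12, 0, 0)]
  | p3m1 => ![(-1, 12, 12, 0, 0), 0]
  | p31m => ![(-1, 4, 12, 0, 0), 0]
  | p6 => ![(-1, 4, 12, 4, 0), (-1, 4, 12, 0, 0)]
  | p6m => ![(-1, 4, 12, 4, 0), (-1, 4, 12, 0, 0), 0, 0]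

instance {B : Type} [AddCommGroup B] [DecidableEq B] (f : TwistedCocycle W B) :
    DecidableEq (Cover f) := fun a b =>
  decidable_of_iff (a.fib = b.fib ∧ a.base = b.base)
    ⟨fun h => Cover.ext h.1 h.2, fun h => h ▸ ⟨rfl, rfl⟩⟩

instance {K : Type} [Group K] [DecidableEq K] (t₁ t₂ c m : K) :
    Decidable (Relations W t₁ t₂ c m) :=
  decidable_of_iff ((t₁ * t₂ = t₂ * t₁ ∧ c * t₁ = trans t₁ t₂ (rotGen W.rot (1, 0)) * c ∧
      c * t₂ = trans t₁ t₂ (rotGen W.rot (0, 1)) * c ∧ c ^ W.rot = 1) ∧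
      m * t₁ = trans t₁ t₂ (mirGen W (1, 0)) * m ∧ m * t₂ = trans t₁ t₂ (mirGen W (0, 1)) * m ∧
      m ^ W.mir = trans t₁ t₂ (shift W 0 1 0 1) ∧ m * c = trans t₁ t₂ (shift W 0 1 1 0) *
        c ^ (flip (1 : Fin W.mir) (1 : Fin W.rot)).val * m)
    ⟨fun ⟨⟨h1, h2, h3, h4⟩, h5, h6, h7, h8⟩ => ⟨h1, h2, h3, h4, h5, h6, h7, h8⟩,
      fun h => ⟨⟨h.1, h.2, h.3, h.4⟩, h.5, h.6, h.7, h.8⟩⟩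

/-- The lifts are explicit elements of an extension with computable multiplication, so the
triviality of the defect is a finite verification. -/
theorem areaDefect_relations (j : Fin W.num) (hj : (inv W j).IsLSM) :
    Relations W (⟨(areaData W j).2.1, T₁⟩ : Cover (areaDefect W j (areaData W j).1))
      ⟨(areaData W j).2.2.1, T₂⟩ ⟨(areaData W j).2.2.2.1, C⟩ ⟨(areaData W j).2.2.2.2, M⟩ := by
  revert j
  cases W <;> decide +kernel

/-- The basis cocycles dual to LSM-type invariants are in the kernel. -/
theorem cls_lam_mem_kerITilde (j : Fin W.num) (hj : (inv W j).IsLSM) :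
    cls ⟨lam W j, lam_mem_cocycles₂ j⟩ ∈ kerITilde W := by
  obtain ⟨φ, hφ⟩ := TwistedCocycle.exists_primitive _ _ _ _ _ rfl rfl rfl rfl
    (areaDefect_relations j hj)
  set k := (areaData W j).1
  rw [cls_mem_kerITilde_iff]
  -- On translations and for `k = -1` this is `(y₁ x₂ - x₁ y₂) / 4`, whose antisymmetrisation is
  -- that of `y₁ x₂ / 2`; the factor 4 in `area` turns the denominator 4 into 16.
  refine ⟨⟨fun g h => (k * (area W).toFun g h : ℤ) / 16, fun g h l => ?_⟩,
    fun g => -ZMod.toAddCircle (φ g), fun g h => ?_⟩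
  · have h2 := congrArg (fun a : ℤ => (k * a / 16 : ℝ)) ((area W).cocycle g h l)
    simp only [Units.smul_def, zsmul_eq_mul, Int.cast_add, Int.cast_mul, Int.cast_id] at h2 ⊢
    linear_combination h2
  · have h1 : embed (lam W j (g, h)) =
        φ (g * h) - φ g - orient W g • φ h + (k * (area W).toFun g h : ℤ) :=
      sub_eq_iff_eq_add.1 (hφ g h)
    have h2 := congrArg (ZMod.toAddCircle (N := 16)) h1
    rw [toAddCircle_embed, map_add, map_sub, map_sub, ZMod.toAddCircle_intCast, Units.smul_def,
      map_zsmul] at h2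
    change ZMod.toAddCircle (lam W j (g, h)) = _
    rw [h2, Units.smul_def, smul_neg]
    push_cast
    abel

end kernel

/-! ### The classification of classes -/

section classification

open groupCohomology

theorem cls_add (f f' : cocycles₂ (Z2 W)) : cls (f + f') = cls f + cls f' :=
  map_add (H2π (Z2 W)).hom f f'

theorem cls_surjective : Function.Surjective (cls (W := W)) := fun x => by
  induction x using H2_induction_on with | h f => exact ⟨f, rfl⟩

theorem cls_eq_iff (f f' : cocycles₂ (Z2 W)) :
    cls f = cls f' ↔ ∀ i, (inv W i).val f = (inv W i).val f' := by
  have h0 : cls f = cls f' ↔ ((f - f' : cocycles₂ (Z2 W)) : Elt W × Elt W → ZMod 2) ∈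
    coboundaries₂ (Z2 W) := H2π_eq_iff f f'
  have h1 (i) : (inv W i).val (f - f' : cocycles₂ (Z2 W)) = (inv W i).val f - (inv W i).val f' := by
    rw [eq_sub_iff_add_eq, ← TopInv.val_add]
    congr 1
    exact congrArg (fun a : cocycles₂ (Z2 W) => (a : Elt W × Elt W → ZMod 2)) (sub_add_cancel f f')
  rw [h0]
  refine ⟨fun h i => ?_, fun h => mem_coboundaries₂_of_val_eq_zero _ fun i => ?_⟩
  · rw [← sub_eq_zero, ← h1]
    exact val_eq_zero_of_mem_coboundaries₂ h i
  · rw [h1, h, sub_self]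

/-- The basis cocycles. -/
def basisCocycle (j : Fin W.num) : cocycles₂ (Z2 W) := ⟨lam W j, lam_mem_cocycles₂ j⟩

/-- The invariants of a cocycle. -/
def valHom (W : WallpaperGroup) : cocycles₂ (Z2 W) →+ (Fin W.num → ZMod 2) where
  toFun f i := (inv W i).val f
  map_zero' := funext fun _ => TopInv.val_zero _
  map_add' f f' := funext fun _ => TopInv.val_add f f' _

theorem valHom_basisCocycle (j : Fin W.num) : valHom W (basisCocycle j) = Pi.single j 1 := by
  ext i
  rw [Pi.single_apply]
  exact val_lam i j

/-- The cocycle with given invariants. -/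
def ofVal (a : Fin W.num → ZMod 2) : cocycles₂ (Z2 W) := ∑ j, (a j).val • basisCocycle j

theorem valHom_ofVal (a : Fin W.num → ZMod 2) : valHom W (ofVal a) = a := by
  ext i
  simp only [ofVal, map_sum, map_nsmul, valHom_basisCocycle, Finset.sum_apply, Pi.smul_apply,
    Pi.single_apply]
  simp

/-- The invariants identify the second cohomology with `(ℤ/2)ⁿ`. -/
noncomputable def valEquiv (W : WallpaperGroup) :
    groupCohomology (Z2 W) 2 ≃+ (Fin W.num → ZMod 2) :=
  AddEquiv.symm
    { toFun := fun a => cls (ofVal a)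
      invFun := fun x => valHom W (Function.surjInv cls_surjective x)
      left_inv := fun a => by
        have h := Function.surjInv_eq cls_surjective (cls (ofVal a))
        rw [cls_eq_iff] at h
        exact (funext h : valHom W _ = _).trans (valHom_ofVal a)
      right_inv := fun x => by
        conv_rhs => rw [← Function.surjInv_eq cls_surjective x]
        rw [cls_eq_iff]
        exact congrFun (valHom_ofVal (valHom W (Function.surjInv cls_surjective x)))
      map_add' := fun a b => by
        rw [← cls_add, cls_eq_iff]
        refine congrFun (?_ : valHom W _ = valHom W _)
        rw [map_add, valHom_ofVal, valHom_ofVal, valHom_ofVal] }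

theorem valEquiv_cls (f : cocycles₂ (Z2 W)) (i : Fin W.num) :
    valEquiv W (cls f) i = (inv W i).val f := by
  have h := Function.surjInv_eq cls_surjective (cls f)
  rw [cls_eq_iff] at h
  exact h i

theorem cls_eq_sum (f : cocycles₂ (Z2 W)) :
    cls f = ∑ j, ((inv W j).val f).val • cls (basisCocycle j) := by
  have h : cls f = cls (ofVal (valHom W f)) := by
    rw [cls_eq_iff]
    exact congrFun (valHom_ofVal (valHom W f)).symm
  rw [h, ofVal]
  change (H2π (Z2 W)).hom _ = _
  rw [map_sum]
  refine Finset.sum_congr rfl fun j _ => ?_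
  rw [map_nsmul]
  rfl

theorem cls_mem_closure (f : cocycles₂ (Z2 W))
    (h : ∀ i, ¬(inv W i).IsLSM → (inv W i).val f = 0) :
    cls f ∈ AddSubgroup.closure {x | ∃ j, (inv W j).IsLSM ∧ x = cls (basisCocycle j)} := by
  rw [cls_eq_sum]
  refine sum_mem fun j _ => ?_
  by_cases hj : (inv W j).IsLSM
  · refine nsmul_mem (AddSubgroup.subset_closure ?_) _
    exact ⟨j, hj, rfl⟩
  · rw [h j hj]
    simp

theorem closure_le_kerITilde :
    AddSubgroup.closure {x | ∃ j, (inv W j).IsLSM ∧ x = cls (basisCocycle j)} ≤ kerITilde W := by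
  rw [AddSubgroup.closure_le]
  rintro _ ⟨j, hj, rfl⟩
  exact cls_lam_mem_kerITilde j hj

/-- A circle of inclusions: vanishing mirror coordinates put a class in the span of the LSM basis
classes, this span lies in the kernel, and on the kernel the mirror coordinates vanish. -/
theorem cls_mem_kerITilde_iff_val (f : cocycles₂ (Z2 W)) :
    cls f ∈ kerITilde W ↔ ∀ i, ¬(inv W i).IsLSM → (inv W i).val f = 0 :=
  ⟨fun h i hi => val_eq_zero_of_mem_kerITilde h i hi,
    fun h => closure_le_kerITilde (cls_mem_closure f h)⟩

theorem kerITilde_eq_closure :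
    kerITilde W = AddSubgroup.closure {x | ∃ j, (inv W j).IsLSM ∧ x = cls (basisCocycle j)} := by
  refine le_antisymm (fun x hx => ?_) closure_le_kerITilde
  obtain ⟨f, rfl⟩ := cls_surjective x
  exact cls_mem_closure f ((cls_mem_kerITilde_iff_val f).1 hx)

/-- The kernel is identified with `(ℤ/2)ᵏ` by the LSM-type invariants. -/
noncomputable def kerEquiv (W : WallpaperGroup) :
    kerITilde W ≃+ ({i : Fin W.num // (inv W i).IsLSM} → ZMod 2) where
  toFun x i := valEquiv W x i
  invFun a := ⟨(valEquiv W).symm fun i => if h : (inv W i).IsLSM then a ⟨i, h⟩ else 0, by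
    obtain ⟨f, hf⟩ := cls_surjective
      ((valEquiv W).symm fun i => if h : (inv W i).IsLSM then a ⟨i, h⟩ else 0)
    rw [← hf, cls_mem_kerITilde_iff_val]
    intro i hi
    rw [← valEquiv_cls, hf, AddEquiv.apply_symm_apply, dif_neg hi]⟩
  left_inv x := by
    obtain ⟨x, hx⟩ := x
    obtain ⟨f, rfl⟩ := cls_surjective x
    rw [Subtype.mk.injEq, AddEquiv.symm_apply_eq]
    ext i
    split_ifs with h
    · rfl
    · rw [valEquiv_cls, (cls_mem_kerITilde_iff_val f).1 hx i h]
  right_inv a := by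
    ext i
    simp only [AddEquiv.apply_symm_apply]
    rw [dif_pos i.2]
  map_add' x y := by
    ext i
    simp

end classification

/-! ### The action on the plane -/

section action

theorem rotGen_smul (n : ℕ) (r : ℝ) (v : ℝ × ℝ) : rotGen n (r • v) = r • rotGen n v := by
  unfold rotGen
  split <;> ext <;> simp <;> ring

theorem continuous_rotGen (n : ℕ) : Continuous (rotGen n : ℝ × ℝ → ℝ × ℝ) := by
  unfold rotGen
  split <;> fun_prop

theorem continuous_mirAff (W : WallpaperGroup) : Continuous (mirAff W) := by
  have h : Continuous (mirGen W : ℝ × ℝ → ℝ × ℝ) := by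
    unfold mirGen
    cases W <;> fun_prop
  unfold mirAff
  fun_prop

/-- The part of the action of an element that depends on its class in the point group. -/
noncomputable def pointAct (W : WallpaperGroup) (c : Fin W.rot) (m : Fin W.mir) (v : ℝ × ℝ) :
    ℝ × ℝ :=
  (rotGen W.rot)^[c.val] ((mirAff W)^[m.val] v)

theorem smul_eq (g : Elt W) (v : ℝ × ℝ) : g • v = castP (g.x, g.y) + pointAct W g.c g.m v := rfl

theorem continuous_pointAct (c : Fin W.rot) (m : Fin W.mir) : Continuous (pointAct W c m) :=
  ((continuous_rotGen W.rot).iterate c.val).comp ((continuous_mirAff W).iterate m.val)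

theorem continuous_smul' (g : Elt W) : Continuous fun v : ℝ × ℝ => g • v :=
  continuous_const.add (continuous_pointAct g.c g.m)

theorem mirAff_combo (u v : ℝ × ℝ) {a b : ℝ} (h : a + b = 1) :
    mirAff W (a • u + b • v) = a • mirAff W u + b • mirAff W v := by
  obtain rfl : b = 1 - a := by linarith
  cases W <;> ext <;> simp [mirAff, mirGen, glide] <;> ring

/-- The action is affine, so an element that fixes two points fixes the line through them. -/
theorem smul_combo (g : Elt W) (u v : ℝ × ℝ) {a b : ℝ} (h : a + b = 1) :
    g • (a • u + b • v) = a • (g • u) + b • (g • v) := by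
  have h1 (k : ℕ) (u v : ℝ × ℝ) : (mirAff W)^[k] (a • u + b • v) =
      a • (mirAff W)^[k] u + b • (mirAff W)^[k] v := by
    induction k generalizing u v with
    | zero => rfl
    | succ k ih => simp only [Function.iterate_succ, Function.comp_apply, mirAff_combo _ _ h, ih]
  have h2 (k : ℕ) (u v : ℝ × ℝ) : (rotGen W.rot)^[k] (a • u + b • v) =
      a • (rotGen W.rot)^[k] u + b • (rotGen W.rot)^[k] v := by
    induction k generalizing u v with
    | zero => rfl
    | succ k ih =>
      simp only [Function.iterate_succ, Function.comp_apply, rotGen_add, rotGen_smul, ih]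
  have h3 : castP (g.x, g.y) = a • castP (g.x, g.y) + b • castP (g.x, g.y) := by
    rw [← add_smul, h, one_smul]
  rw [smul_eq, smul_eq, smul_eq, pointAct, h1, h2, smul_add, smul_add]
  conv_lhs => rw [h3]
  simp only [pointAct]
  abel

theorem finite_castP_preimage {K : Set (ℝ × ℝ)} (hK : IsCompact K) : (castP ⁻¹' K).Finite := by
  have h : Topology.IsClosedEmbedding castP :=
    Int.isClosedEmbedding_coe_real.prodMap Int.isClosedEmbedding_coe_real
  exact (h.isCompact_preimage hK).finite_of_discrete

/-- The action is properly discontinuous. -/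
theorem finite_smul_inter {K K' : Set (ℝ × ℝ)} (hK : IsCompact K) (hK' : IsCompact K') :
    {g : Elt W | ∃ v ∈ K, g • v ∈ K'}.Finite := by
  have h (c : Fin W.rot) (m : Fin W.mir) :
      (castP ⁻¹' ((fun p : (ℝ × ℝ) × (ℝ × ℝ) => p.1 - pointAct W c m p.2) '' (K' ×ˢ K))).Finite :=
    finite_castP_preimage ((hK'.prod hK).image
      (continuous_fst.sub ((continuous_pointAct c m).comp continuous_snd)))
  -- For each of the finitely many point-group classes, the translation part is an integral point in
  -- the compact set of differences `g • v - pointAct v`.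
  refine (Set.finite_iUnion fun c => Set.finite_iUnion fun m =>
    (h c m).image fun v => (⟨v.1, v.2, c, m⟩ : Elt W)).subset ?_
  rintro g ⟨v, hv, hg⟩
  simp only [Set.mem_iUnion]
  refine ⟨g.c, g.m, (g.x, g.y), ⟨(g • v, v), ⟨hg, hv⟩, ?_⟩, rfl⟩
  rw [smul_eq]
  exact add_sub_cancel_right _ _

theorem trans_smul (a b : ℤ) (v : ℝ × ℝ) : (⟨a, b, 0, 0⟩ : Elt W) • v = castP (a, b) + v := by
  simp [smul_eq, pointAct]

theorem eq_one_of_fixed {g : Elt W} (hc : g.c = 0) (hm : g.m = 0) {v : ℝ × ℝ} (h : g • v = v) :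
    g = 1 := by
  obtain ⟨x, y, c, m⟩ := g
  simp only at hc hm
  subst hc hm
  rw [trans_smul, add_eq_right] at h
  have h : ((x : ℝ), (y : ℝ)) = 0 := h
  rw [Prod.mk_eq_zero] at h
  rw [one_def', Int.cast_eq_zero.1 h.1, Int.cast_eq_zero.1 h.2]

/-- Finiteness of stabilizers is what gives their Sylow 2-subgroups odd index. -/
instance (v : ℝ × ℝ) : Finite (MulAction.stabilizer (Elt W) v) :=
  ((finite_smul_inter (W := W) (isCompact_singleton (x := v)) (isCompact_singleton (x := v))).subset
    fun _ hg => ⟨v, rfl, hg⟩).to_subtype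

end action

/-! ### Counting -/

section counting

theorem finsum_ncard_fiber {ι X : Type} (f : ι → X) (R : Set X) (hR : {i | f i ∈ R}.Finite) :
    ∑ᶠ q ∈ R, ({i | f i = q}.ncard : ZMod 2) = ({i | f i ∈ R}.ncard : ZMod 2) := by
  classical
  have hfib {q : X} (hq : q ∈ R) : {i | f i = q}.ncard = (hR.toFinset.filter (f · = q)).card := by
    rw [← Set.ncard_coe_finset]
    congr 1
    ext i
    simp only [Set.mem_ofPred_eq, Finset.coe_filter, Set.Finite.mem_toFinset]
    exact ⟨fun h => ⟨h ▸ hq, h⟩, fun h => h.2⟩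
  rw [finsum_mem_eq_sum_of_inter_support_eq (t := hR.toFinset.image f),
    Set.ncard_eq_toFinset_card _ hR,
    Finset.card_eq_sum_card_image f, Nat.cast_sum]
  · refine Finset.sum_congr rfl fun q hq => ?_
    rw [hfib]
    obtain ⟨i, hi, rfl⟩ := Finset.mem_image.1 hq
    exact hR.mem_toFinset.1 hi
  · ext q
    simp only [Set.mem_inter_iff, Finset.coe_image, Set.Finite.coe_toFinset, Function.mem_support]
    refine and_congr_left fun hq => ⟨fun h => ?_, ?_⟩
    · by_contra hne
      have : {i | f i = q} = ∅ := by
        ext i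
        simp only [Set.mem_ofPred_eq, Set.mem_empty_iff_false, iff_false]
        exact fun hi => hne ⟨i, by rw [← hi] at h; exact h, hi⟩
      simp [this] at hq
    · rintro ⟨i, hi, rfl⟩
      exact hi

/-- The parity of a finite set is that of the fixed points of an involution. -/
theorem ncard_eq_ncard_fixed {ι : Type} {s : Set ι} (hs : s.Finite) (f : ι → ι)
    (hf : ∀ i ∈ s, f i ∈ s) (h : ∀ i ∈ s, f (f i) = i) :
    (s.ncard : ZMod 2) = ({i | i ∈ s ∧ f i = i}.ncard : ZMod 2) := by
  classical
  have h1 : {i | i ∈ s ∧ f i = i} = (hs.toFinset.filter (fun i => f i = i) : Set ι) := by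
    ext i
    simp
  -- Points that are not fixed cancel in pairs mod 2.
  have h2 : ∑ i ∈ hs.toFinset.filter (fun i => ¬f i = i), (1 : ZMod 2) = 0 := by
    refine Finset.sum_involution (fun i _ => f i) (fun i _ => by decide) (fun i hi _ => ?_)
      (fun i hi => ?_) fun i hi => ?_
    · exact (Finset.mem_filter.1 hi).2
    · simp only [Finset.mem_filter, Set.Finite.mem_toFinset] at hi ⊢
      exact ⟨hf i hi.1, fun h' => hi.2 (by rw [h i hi.1] at h'; exact h'.symm)⟩
    · simp only [Finset.mem_filter, Set.Finite.mem_toFinset] at hi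
      exact h i hi.1
  rw [h1, Set.ncard_coe_finset, Set.ncard_eq_toFinset_card s hs,
    ← Finset.card_filter_add_card_filter_not (s := hs.toFinset) (fun i => f i = i), Nat.cast_add]
  simp only [Finset.sum_const, nsmul_eq_mul, mul_one] at h2
  rw [h2, add_zero]

/-- Two equivariant positions of the same set have the same number of points in fundamental
domains. -/
theorem ncard_fundamental {G ι X : Type} [Group G] [MulAction G ι] [MulAction G X]
    (H : Subgroup G) (J : Set ι) (hJ : ∀ h ∈ H, ∀ i ∈ J, h • i ∈ J) (f f' : ι → X)
    (hf : ∀ (g : G) i, f (g • i) = g • f i) (hf' : ∀ (g : G) i, f' (g • i) = g • f' i)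
    (D D' : Set X) (hD : ∀ i ∈ J, ∃! h, h ∈ H ∧ h • f i ∈ D)
    (hD' : ∀ i ∈ J, ∃! h, h ∈ H ∧ h • f' i ∈ D') :
    {i | i ∈ J ∧ f i ∈ D}.ncard = {i | i ∈ J ∧ f' i ∈ D'}.ncard := by
  -- A label in the first domain is sent to the unique translate of it by `H` that lies in the
  -- second; uniqueness on both sides makes this a bijection.
  choose! k hk hk' using hD'
  refine Set.ncard_congr (fun i _ => k i • i) (fun i hi => ?_) (fun i j hi hj hij => ?_)
    fun i hi => ?_
  · exact ⟨hJ _ (hk i hi.1).1 i hi.1, by rw [hf']; exact (hk i hi.1).2⟩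
  · have e : ((k j)⁻¹ * k i) • i = j := by rw [mul_smul, hij, inv_smul_smul]
    obtain ⟨l, -, hl⟩ := hD i hi.1
    have h1 := hl 1 ⟨H.one_mem, by rw [one_smul]; exact hi.2⟩
    have h2 := hl ((k j)⁻¹ * k i) ⟨H.mul_mem (H.inv_mem (hk j hj.1).1) (hk i hi.1).1, by
      rw [← hf, e]; exact hj.2⟩
    rw [h2, ← h1, one_smul] at e
    exact e
  · obtain ⟨l, ⟨hl, hl'⟩, -⟩ := hD i hi.1
    have hli : l • i ∈ J := hJ l hl i hi.1
    refine ⟨l • i, ⟨hli, by rw [hf]; exact hl'⟩, ?_⟩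
    have h1 := hk' i hi.1 1 ⟨H.one_mem, by rw [one_smul]; exact hi.2⟩
    have h2 := hk' i hi.1 (k (l • i) * l) ⟨H.mul_mem (hk _ hli).1 hl, by
      rw [mul_smul, ← hf' l]; exact (hk _ hli).2⟩
    rw [← mul_smul, h2, ← h1, one_smul]

end counting

/-! ### Regions as fundamental domains -/

section regions

theorem rotGen_iterate_of_involution {c : Fin W.rot} (h0 : c ≠ 0) (h : c + c = 0) (v : ℝ × ℝ) :
    (rotGen W.rot)^[c.val] v = -v := by
  obtain ⟨a, b⟩ := v
  revert c
  cases W <;> intro c <;> fin_cases c <;> simp [rotGen, rot, Fin.ext_iff] <;> ring_nf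

/-- An orientation-preserving involution is a rotation by `π`. -/
theorem smul_of_involution {g : Elt W} (hm : g.m = 0) (h2 : g * g = 1) (h1 : g ≠ 1) (v : ℝ × ℝ) :
    g • v = castP (g.x, g.y) - v := by
  obtain ⟨x, y, c, m⟩ := g
  simp only at hm
  subst hm
  by_cases hc : c = 0
  · subst hc
    rw [mul_def', one_def', Elt.mk.injEq] at h2
    simp only [lin_zero, shift_zero_zero, add_zero] at h2
    obtain ⟨hx, hy, -⟩ := h2
    exact absurd (by rw [one_def', show x = 0 by omega, show y = 0 by omega]) h1
  · have hcc : c + flip 0 c = 0 := congrArg Elt.c h2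
    rw [flip_zero] at hcc
    have h := rotGen_iterate_of_involution hc hcc v
    rw [smul_eq, pointAct, Fin.val_zero, Function.iterate_zero, id, h, sub_eq_add_neg]

theorem add_neg_floor_mem (x : ℝ) : x + ((-⌊x⌋ : ℤ) : ℝ) ∈ Set.Ico (0 : ℝ) 1 := by
  rw [Int.cast_neg, ← sub_eq_add_neg, Int.self_sub_floor]
  exact ⟨Int.fract_nonneg x, Int.fract_lt_one x⟩

theorem eq_neg_floor {x : ℝ} {n : ℤ} (h : x + n ∈ Set.Ico (0 : ℝ) 1) : n = -⌊x⌋ := by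
  rw [eq_neg_iff_add_eq_zero, ← neg_eq_iff_add_eq_zero, eq_comm, Int.floor_eq_iff]
  push_cast
  constructor <;> linarith [h.1, h.2]

/-- What the counting arguments use of an invariant. -/
def TopInv.Regular : TopInv W → Prop
  | rotation g => g * g = 1 ∧ g.m = 0 ∧ g ≠ 1
  | axis t m => m * m = 1 ∧ ∃ H : Subgroup (Elt W), (∀ h ∈ H, h * m = m * h) ∧
      ∀ R ∈ (axis t m).regions, ∀ v : ℝ × ℝ, m • v = v → ∃! h, h ∈ H ∧ h • v ∈ R
  | cell t₁ t₂ => ∃ H : Subgroup (Elt W),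
      ∀ R ∈ (cell t₁ t₂).regions, ∀ v : ℝ × ℝ, ∃! h, h ∈ H ∧ h • v ∈ R
  | glideCell t s => ∃ H : Subgroup (Elt W),
      ∀ R ∈ (glideCell t s).regions, ∀ v : ℝ × ℝ, ∃! h, h ∈ H ∧ h • v ∈ R
  | mirror _ => True

theorem zpow_smul_of_add {t : Elt W} {w : ℝ × ℝ} (ht : ∀ v : ℝ × ℝ, t • v = v + w) (n : ℤ)
    (v : ℝ × ℝ) : t ^ n • v = v + (n : ℝ) • w := by
  induction n generalizing v with
  | zero => simp
  | succ n ih =>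
    rw [zpow_add_one, mul_smul, ht, ih]
    push_cast
    rw [add_smul, one_smul]
    abel
  | pred n ih =>
    have h : t⁻¹ • v = v - w := by rw [inv_smul_eq_iff, ht, sub_add_cancel]
    rw [zpow_sub_one, mul_smul, h, ih]
    push_cast
    rw [sub_smul, one_smul]
    abel

/-- On the axis the powers of `t` act as integral translations in units of `w`, and `⌊·⌋` selects
the unique one that ends in the half-open segment. -/
theorem axis_regular {t m : Elt W} {w : ℝ × ℝ} (hw : w ≠ 0) (hm : m * m = 1) (htm : t * m = m * t)
    (ht : ∀ v : ℝ × ℝ, t • v = v + w)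
    (ha : ∀ p v : ℝ × ℝ, m • p = p → m • v = v → ∃ a : ℝ, v = p + a • w) :
    (TopInv.axis t m).Regular := by
  refine ⟨hm, Subgroup.zpowers t, ?_, ?_⟩
  · rintro _ ⟨n, rfl⟩
    exact ((show Commute t m from htm).zpow_left n).eq
  · rintro _ ⟨p, hp, rfl⟩ v hv
    obtain ⟨a, rfl⟩ := ha p v hp hv
    simp only [ht, add_sub_cancel_left]
    refine ⟨t ^ (-⌊a⌋), ⟨⟨_, rfl⟩, a + ((-⌊a⌋ : ℤ) : ℝ), add_neg_floor_mem a, ?_⟩, ?_⟩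
    · rw [zpow_smul_of_add ht, add_smul, add_assoc]
    · rintro _ ⟨⟨n, rfl⟩, b, hb, hn⟩
      simp only [zpow_smul_of_add ht] at hn
      rw [add_assoc, ← add_smul, add_right_inj] at hn
      obtain rfl := smul_left_injective ℝ hw hn
      simp only [eq_neg_floor hb]

theorem T₁_smul (v : ℝ × ℝ) : (T₁ : Elt W) • v = v + (1, 0) := by
  rw [T₁, trans_smul, add_comm]
  simp [castP]

theorem T₂_smul (v : ℝ × ℝ) : (T₂ : Elt W) • v = v + (0, 1) := by
  rw [T₂, trans_smul, add_comm]
  simp [castP]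

theorem cell_regular : (TopInv.cell (T₁ : Elt W) T₂).Regular := by
  refine ⟨(transHom W).range, ?_⟩
  rintro _ ⟨p, rfl⟩ v
  have hmem (x y : ℤ) : (⟨x, y, 0, 0⟩ : Elt W) • v ∈
      parallelogram p ((T₁ : Elt W) • p - p) ((T₂ : Elt W) • p - p) ↔
        v.1 - p.1 + x ∈ Set.Ico (0 : ℝ) 1 ∧ v.2 - p.2 + y ∈ Set.Ico (0 : ℝ) 1 := by
    rw [T₁_smul, T₂_smul, add_sub_cancel_left, add_sub_cancel_left, trans_smul]
    constructor
    · rintro ⟨a, ha, b, hb, h⟩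
      have h1 := congrArg Prod.fst h
      have h2 := congrArg Prod.snd h
      simp [castP] at h1 h2
      rw [show v.1 - p.1 + x = a by linarith, show v.2 - p.2 + y = b by linarith]
      exact ⟨ha, hb⟩
    · rintro ⟨ha, hb⟩
      refine ⟨_, ha, _, hb, ?_⟩
      ext <;> simp [castP] <;> ring
  refine ⟨⟨-⌊v.1 - p.1⌋, -⌊v.2 - p.2⌋, 0, 0⟩, ⟨⟨Multiplicative.ofAdd (_, _), rfl⟩, ?_⟩, ?_⟩
  · exact (hmem _ _).2 ⟨add_neg_floor_mem _, add_neg_floor_mem _⟩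
  · rintro _ ⟨⟨u, rfl⟩, hu⟩
    have := (hmem u.toAdd.1 u.toAdd.2).1 hu
    change (⟨_, _, 0, 0⟩ : Elt W) = _
    rw [eq_neg_floor this.1, eq_neg_floor this.2]

theorem pg_smul_zero (x y : ℤ) (c : Fin 1) (v : ℝ × ℝ) :
    (⟨x, y, c, 0⟩ : Elt pg) • v = (x + v.1, y + v.2) := by
  rw [Subsingleton.elim c 0, trans_smul]
  ext <;> simp [castP]

theorem pg_smul_one (x y : ℤ) (c : Fin 1) (v : ℝ × ℝ) :
    (⟨x, y, c, 1⟩ : Elt pg) • v = (x - v.1, y + v.2 + 1 / 2) := by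
  rw [Subsingleton.elim c 0]
  ext <;> simp [smul_eq, castP, pointAct, mirAff, mirGen, glide] <;> ring

/-- The parallelogram is a fundamental domain of all of `pg`: its second edge rises by half a
translation unit, as the glide reflection does. -/
theorem glideCell_regular : (TopInv.glideCell (T₁ : Elt pg) M).Regular := by
  refine ⟨⊤, ?_⟩
  rintro _ ⟨p, rfl⟩ v
  have hM : (M : Elt pg) • p - p = (-2 * p.1, 1 / 2) := by
    rw [M, pg_smul_one]
    ext <;> simp <;> ring
  rw [T₁_smul, add_sub_cancel_left, hM]
  -- The coordinates of `q` in the skew frame: the height gives the coefficient of the glide edge,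
  -- and the abscissa is corrected by the slant `-2 p.1` of that edge.
  have hmem (q : ℝ × ℝ) : q ∈ parallelogram p (1, 0) (-2 * p.1, 1 / 2) ↔
      q.1 - p.1 + 2 * p.1 * (2 * (q.2 - p.2)) ∈ Set.Ico (0 : ℝ) 1 ∧
        2 * (q.2 - p.2) ∈ Set.Ico (0 : ℝ) 1 := by
    constructor
    · rintro ⟨a, ha, b, hb, rfl⟩
      simp only [Prod.fst_add, Prod.snd_add, Prod.smul_fst, Prod.smul_snd, smul_eq_mul]
      rw [show 2 * (p.2 + a * 0 + b * (1 / 2) - p.2) = b by ring]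
      rw [show p.1 + a * 1 + b * (-2 * p.1) - p.1 + 2 * p.1 * b = a by ring]
      exact ⟨ha, hb⟩
    · rintro ⟨ha, hb⟩
      refine ⟨_, ha, _, hb, ?_⟩
      ext <;> simp <;> ring
  simp only [hmem, Subgroup.mem_top, true_and]
  set s := 2 * (v.2 - p.2) with hs
  -- In half units of height, `g` translates by `2 y + m`. The height condition fixes this number,
  -- its parity decides between translation and glide, and the abscissa then fixes `x`.
  have hk (g : Elt pg) (hg : 2 * ((g • v).2 - p.2) ∈ Set.Ico (0 : ℝ) 1) :
      2 * g.y + g.m.val = -⌊s⌋ := by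
    apply eq_neg_floor
    obtain ⟨x, y, c, m⟩ := g
    fin_cases m
    · have e : s + ((2 * y + 0 : ℤ) : ℝ) =
          2 * (((⟨x, y, c, 0⟩ : Elt pg) • v).2 - p.2) := by
        rw [pg_smul_zero, hs]
        push_cast
        ring
      exact e ▸ hg
    · have e : s + ((2 * y + 1 : ℤ) : ℝ) =
          2 * (((⟨x, y, c, 1⟩ : Elt pg) • v).2 - p.2) := by
        rw [pg_smul_one, hs]
        push_cast
        ring
      exact e ▸ hg
  have hf := add_neg_floor_mem s
  rcases Int.even_or_odd' (-⌊s⌋) with ⟨y, hy | hy⟩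
  · have e : 2 * (y + v.2 - p.2) = s + ((-⌊s⌋ : ℤ) : ℝ) := by
      rw [hy, hs]
      push_cast
      ring
    refine ⟨⟨-⌊v.1 - p.1 + 2 * p.1 * (2 * (y + v.2 - p.2))⌋, y, 0, 0⟩, ?_, ?_⟩
    · simp only [pg_smul_zero]
      refine ⟨?_, e ▸ hf⟩
      convert add_neg_floor_mem (v.1 - p.1 + 2 * p.1 * (2 * (y + v.2 - p.2))) using 1
      ring
    · rintro ⟨x', y', c', m'⟩ ⟨h1, h2⟩
      have h3 := hk _ h2
      rw [hy] at h3
      simp only at h3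
      have hm' : m' = 0 := by
        fin_cases m'
        · rfl
        · simp at h3
          omega
      subst hm'
      obtain rfl : y' = y := by simp at h3; omega
      rw [Subsingleton.elim c' (0 : Fin 1)]
      congr 1
      apply eq_neg_floor
      simp only [pg_smul_zero] at h1
      convert h1 using 1
      ring
  · have e : 2 * (y + v.2 + 1 / 2 - p.2) = s + ((-⌊s⌋ : ℤ) : ℝ) := by
      rw [hy, hs]
      push_cast
      ring
    refine ⟨⟨-⌊-v.1 - p.1 + 2 * p.1 * (2 * (y + v.2 + 1 / 2 - p.2))⌋, y, 0, 1⟩, ?_, ?_⟩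
    · simp only [pg_smul_one]
      refine ⟨?_, e ▸ hf⟩
      convert add_neg_floor_mem (-v.1 - p.1 + 2 * p.1 * (2 * (y + v.2 + 1 / 2 - p.2))) using 1
      ring
    · rintro ⟨x', y', c', m'⟩ ⟨h1, h2⟩
      have h3 := hk _ h2
      rw [hy] at h3
      simp only at h3
      have hm' : m' = 1 := by
        fin_cases m'
        · simp at h3
          omega
        · rfl
      subst hm'
      obtain rfl : y' = y := by simp at h3; omega
      rw [Subsingleton.elim c' (0 : Fin 1)]
      congr 1
      apply eq_neg_floor
      simp only [pg_smul_one] at h1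
      convert h1 using 1
      ring

theorem smul_M (v : ℝ × ℝ) : (M : Elt W) • v = (mirAff W)^[(1 : Fin W.mir).val] v := by
  simp [smul_eq, M, castP, pointAct]

theorem inv_regular (i : Fin W.num) : (inv W i).Regular := by
  have hw : ((0, 1) : ℝ × ℝ) ≠ 0 := by simp
  have hd : ((1, 1) : ℝ × ℝ) ≠ 0 := by simp
  have hT (v : ℝ × ℝ) : (T₁ * T₂ : Elt W) • v = v + (1, 1) := by
    rw [mul_smul, T₂_smul, T₁_smul, add_assoc]
    simp
  revert i
  cases W
  case p1 | p3 =>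
    intro i
    fin_cases i
    exact cell_regular
  case p3m1 =>
    intro i
    fin_cases i
    exacts [cell_regular, trivial]
  case pg =>
    intro i
    fin_cases i
    exact glideCell_regular
  case pm =>
    intro i
    fin_cases i
    · refine axis_regular (t := T₂) (m := M) hw rfl rfl T₂_smul fun p v hp hv => ?_
      rw [smul_M] at hp hv
      have hp1 := congrArg Prod.fst hp
      have hv1 := congrArg Prod.fst hv
      simp [mirAff, mirGen, glide] at hp1 hv1
      exact ⟨v.2 - p.2, by ext <;> simp <;> linarith⟩
    · refine axis_regular (t := T₂) (m := T₁ * M) hw rfl rfl T₂_smul fun p v hp hv => ?_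
      rw [mul_smul, smul_M, T₁_smul] at hp hv
      have hp1 := congrArg Prod.fst hp
      have hv1 := congrArg Prod.fst hv
      simp [mirAff, mirGen, glide] at hp1 hv1
      exact ⟨v.2 - p.2, by ext <;> simp <;> linarith⟩
    · trivial
    · trivial
  case cm | p31m =>
    intro i
    fin_cases i
    · refine axis_regular (t := T₁ * T₂) (m := M) hd rfl rfl hT fun p v hp hv => ?_
      rw [smul_M] at hp hv
      have hp1 := congrArg Prod.fst hp
      have hv1 := congrArg Prod.fst hv
      simp [mirAff, mirGen, glide] at hp1 hv1
      exact ⟨v.2 - p.2, by ext <;> simp <;> linarith⟩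
    · trivial
  case pmg =>
    intro i
    fin_cases i
    · exact ⟨rfl, rfl, by decide⟩
    · exact ⟨rfl, rfl, by decide⟩
    · refine axis_regular (t := T₂) (m := M) hw rfl rfl T₂_smul fun p v hp hv => ?_
      rw [smul_M] at hp hv
      have hp1 := congrArg Prod.fst hp
      have hv1 := congrArg Prod.fst hv
      simp [mirAff, mirGen, glide] at hp1 hv1
      exact ⟨v.2 - p.2, by ext <;> simp <;> linarith⟩
    · trivial
  all_goals
    intro i
    fin_cases i
    all_goals first
      | exact trivial
      | exact ⟨by decide +kernel, by decide +kernel, by decide +kernel⟩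

theorem exists_compact_of_mem_regions {α : TopInv W} {R : Set (ℝ × ℝ)} (hR : R ∈ α.regions) :
    ∃ K, IsCompact K ∧ R ⊆ K := by
  have h2 (p u v : ℝ × ℝ) : ∃ K, IsCompact K ∧ parallelogram p u v ⊆ K := by
    refine ⟨(fun a : ℝ × ℝ => p + a.1 • u + a.2 • v) '' (Set.Icc 0 1 ×ˢ Set.Icc 0 1),
      (isCompact_Icc.prod isCompact_Icc).image (by fun_prop), ?_⟩
    rintro q ⟨a, ha, b, hb, rfl⟩
    exact ⟨(a, b), ⟨⟨ha.1, ha.2.le⟩, ⟨hb.1, hb.2.le⟩⟩, rfl⟩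
  cases α with
  | rotation g =>
    obtain ⟨p, -, rfl⟩ := hR
    exact ⟨{p}, isCompact_singleton, subset_rfl⟩
  | axis t m =>
    obtain ⟨p, -, rfl⟩ := hR
    refine ⟨(fun a : ℝ => p + a • (t • p - p)) '' Set.Icc 0 1,
      isCompact_Icc.image (by fun_prop), ?_⟩
    rintro q ⟨a, ha, rfl⟩
    exact ⟨a, ⟨ha.1, ha.2.le⟩, rfl⟩
  | cell t₁ t₂ | glideCell t₁ t₂ =>
    obtain ⟨p, rfl⟩ := hR
    exact h2 _ _ _
  | mirror m => exact absurd hR (Set.notMem_empty R)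

/-- As `t` commutes with `m`, it preserves the axis; both ends of the segment are fixed by the
affine map `m`. -/
theorem axis_subset {t m : Elt W} (htm : t * m = m * t) {R : Set (ℝ × ℝ)}
    (hR : R ∈ (TopInv.axis t m).regions) {q : ℝ × ℝ} (hq : q ∈ R) : m • q = q := by
  obtain ⟨p, hp, rfl⟩ := hR
  obtain ⟨a, -, rfl⟩ := hq
  have e : p + a • (t • p - p) = (1 - a) • p + a • (t • p) := by
    rw [smul_sub, sub_smul, one_smul]
    abel
  rw [e, smul_combo m _ _ (by ring), ← mul_smul, ← htm, mul_smul, hp]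

/-- The total projective representation in the regions of an invariant is unchanged by
deformations. -/
theorem regionSum_eq_of_deforms {σ τ : ℝ × ℝ → ZMod 2} (h : Deforms W σ τ) {α : TopInv W}
    (hα : α.Regular) (hv : α.Valid) {R R' : Set (ℝ × ℝ)} (hR : R ∈ α.regions)
    (hR' : R' ∈ α.regions) : ∑ᶠ q ∈ R, σ q = ∑ᶠ q ∈ R', τ q := by
  obtain ⟨ι, _, γ, -, hg, hfin, h0, h1⟩ := h
  have hf (s : unitInterval) {R : Set (ℝ × ℝ)} (hR : R ∈ α.regions) : {i | γ i s ∈ R}.Finite := by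
    obtain ⟨K, hK, hRK⟩ := exists_compact_of_mem_regions hR
    exact (hfin K hK).subset fun i hi => ⟨s, hRK hi⟩
  simp only [h0, h1]
  rw [finsum_ncard_fiber (fun i => γ i 0) R (hf 0 hR),
    finsum_ncard_fiber (fun i => γ i 1) R' (hf 1 hR')]
  cases α with
  | rotation g =>
    obtain ⟨h2, hm, hne⟩ := hα
    have huniq (p q : ℝ × ℝ) (hp : g • p = p) (hq : g • q = q) : p = q := by
      rw [smul_of_involution hm h2 hne, sub_eq_iff_eq_add] at hp hq
      have h3 : p + p = q + q := hp.symm.trans hq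
      rw [← two_smul ℝ p, ← two_smul ℝ q] at h3
      exact smul_right_injective _ two_ne_zero h3
    obtain ⟨p, hp, rfl⟩ := id hR
    obtain ⟨p', hp', rfl⟩ := id hR'
    obtain rfl := huniq p p' hp hp'
    -- The rotation permutes the labels at `p`, and mod 2 only its fixed labels count. By uniqueness
    -- of the fixed point these sit at `p` at all times, so their number is independent of `s`.
    have hinv (s : unitInterval) : ({i | γ i s ∈ ({p} : Set (ℝ × ℝ))}.ncard : ZMod 2) =
        ({i : ι | g • i = i}.ncard : ZMod 2) := by
      rw [ncard_eq_ncard_fixed (hf s hR) (g • ·)]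
      · congr 2
        ext i
        refine ⟨fun h => h.2, fun h => ⟨huniq _ _ ?_ hp, h⟩⟩
        rw [← hg, show g • i = i from h]
      · intro i hi
        have hi : γ i s = p := hi
        change γ (g • i) s = p
        rw [hg, hi, hp]
      · intro i _
        rw [← mul_smul, h2, one_smul]
    rw [hinv, hinv]
  | axis t m =>
    obtain ⟨h2, H, hH, hD⟩ := hα
    -- Labels that are exchanged by the mirror cancel in pairs. Those fixed by it never leave the
    -- axis, where the regions are fundamental domains of `H`.
    have hinv (s : unitInterval) {R : Set (ℝ × ℝ)} (hR : R ∈ (TopInv.axis t m).regions) :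
        ({i | γ i s ∈ R}.ncard : ZMod 2) =
        ({i | i ∈ {i | m • i = i} ∧ γ i s ∈ R}.ncard : ZMod 2) := by
      rw [ncard_eq_ncard_fixed (hf s hR) (m • ·)]
      · congr 2
        ext i
        exact and_comm
      · intro i hi
        have hi : γ i s ∈ R := hi
        change γ (m • i) s ∈ R
        rw [hg, axis_subset hv hR hi]
        exact hi
      · intro i _
        rw [← mul_smul, h2, one_smul]
    rw [hinv 0 hR, hinv 1 hR']
    have hfix (i : ι) (hi : m • i = i) (s : unitInterval) : m • γ i s = γ i s := by rw [← hg, hi]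
    rw [ncard_fundamental H {i | m • i = i} (fun h hh i hi => ?_) (fun i => γ i 0) (fun i => γ i 1)
      (fun g i => hg g i 0) (fun g i => hg g i 1) R R' (fun i hi => hD R hR _ (hfix i hi 0))
      (fun i hi => hD R' hR' _ (hfix i hi 1))]
    change m • h • i = h • i
    rw [← mul_smul, ← hH h hh, mul_smul, show m • i = i from hi]
  | cell t₁ t₂ | glideCell t₁ t₂ =>
    obtain ⟨H, hD⟩ := hα
    have := ncard_fundamental H Set.univ (fun _ _ _ _ => trivial) (fun i => γ i 0) (fun i => γ i 1)
      (fun g i => hg g i 0) (fun g i => hg g i 1) R R' (fun i _ => hD R hR _)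
      (fun i _ => hD R' hR' _)
    simp only [Set.mem_univ, true_and] at this
    rw [this]
  | mirror m => exact absurd hR (Set.notMem_empty R)

/-- The labels are the support points, at rest. Combined with `regionSum_eq_of_deforms` this shows
that all regions of an invariant have the same sum. -/
theorem deforms_refl (σ : Distribution W) : Deforms W σ σ := by
  have hmem (g : Elt W) (p : ℝ × ℝ) (hp : (σ : ℝ × ℝ → ZMod 2) p ≠ 0) :
      (σ : ℝ × ℝ → ZMod 2) (g • p) ≠ 0 := by rwa [σ.2.1 g p]
  let _ : MulAction (Elt W) {p : ℝ × ℝ // (σ : ℝ × ℝ → ZMod 2) p ≠ 0} :=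
    { smul := fun g p => ⟨g • p.1, hmem g p.1 p.2⟩
      one_smul := fun p => Subtype.ext (one_smul _ p.1)
      mul_smul := fun g h p => Subtype.ext (mul_smul g h p.1) }
  have hcount (p : ℝ × ℝ) : (σ : ℝ × ℝ → ZMod 2) p =
      ({i : {p : ℝ × ℝ // (σ : ℝ × ℝ → ZMod 2) p ≠ 0} | i.1 = p}.ncard : ZMod 2) := by
    by_cases hp : (σ : ℝ × ℝ → ZMod 2) p = 0
    · have : {i : {p : ℝ × ℝ // (σ : ℝ × ℝ → ZMod 2) p ≠ 0} | i.1 = p} = ∅ := by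
        ext i
        simp only [Set.mem_ofPred_eq, Set.mem_empty_iff_false, iff_false]
        exact fun hi => i.2 (hi ▸ hp)
      simp [this, hp]
    · have : {i : {p : ℝ × ℝ // (σ : ℝ × ℝ → ZMod 2) p ≠ 0} | i.1 = p} = {⟨p, hp⟩} := by
        ext i
        simp [Subtype.ext_iff]
      have key : ∀ a : ZMod 2, a ≠ 0 → a = 1 := by decide
      simp [this, key _ hp]
  refine ⟨{p : ℝ × ℝ // (σ : ℝ × ℝ → ZMod 2) p ≠ 0}, inferInstance, fun p _ => p.1,
    fun _ => continuous_const, fun _ _ _ => rfl,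
    fun K hK => ?_, hcount, hcount⟩
  refine Set.Finite.of_finite_image ((σ.2.2 K hK).subset ?_) Subtype.val_injective.injOn
  rintro _ ⟨p, ⟨_, hp⟩, rfl⟩
  exact ⟨hp, p.2⟩

end regions

/-! ### Centres -/

section centres

/-- The point with coordinates `Q / 4`. -/
noncomputable def quarter (Q : ℤ × ℤ) : ℝ × ℝ := ((Q.1 : ℝ) / 4, (Q.2 : ℝ) / 4)

theorem quarter_injective : Function.Injective quarter := by
  rintro ⟨a, b⟩ ⟨a', b'⟩ h
  simp only [quarter, Prod.mk.injEq] at h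
  ext
  · exact_mod_cast (div_left_inj' (by norm_num : (4 : ℝ) ≠ 0)).1 h.1
  · exact_mod_cast (div_left_inj' (by norm_num : (4 : ℝ) ≠ 0)).1 h.2

/-- The action of the point group on quarter-integral points. -/
def pointQuarter (W : WallpaperGroup) (c : Fin W.rot) (m : Fin W.mir) (Q : ℤ × ℤ) : ℤ × ℤ :=
  lin W c m Q + (2 : ℤ) • pointPart W c m

/-- The action on quarter-integral points. -/
def actQuarter (g : Elt W) (Q : ℤ × ℤ) : ℤ × ℤ :=
  (4 * g.x + (pointQuarter W g.c g.m Q).1, 4 * g.y + (pointQuarter W g.c g.m Q).2)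

/-- All base points are quarter-integral, the quarters being needed for the mirror axis of `pmg`.
After scaling by 4 the action is integer arithmetic, and questions about base points become
decidable mod 4. -/
theorem smul_quarter (g : Elt W) (Q : ℤ × ℤ) : g • quarter Q = quarter (actQuarter g Q) := by
  have h : pointAct W g.c g.m (quarter Q) = quarter (pointQuarter W g.c g.m Q) := by
    obtain ⟨x, y, c, m⟩ := g
    obtain ⟨a, b⟩ := Q
    cases W <;> fin_cases c <;> fin_cases m <;>
      simp [pointAct, quarter, pointQuarter, lin, pointPart, glideInt, rotGen, mirAff, mirGen, glide]
    all_goals first | ring1 | (constructor <;> ring1)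
  rw [smul_eq, h]
  ext <;> simp [castP, quarter, actQuarter] <;> ring

/-- Four times the base points of the regions of the LSM-type invariants. -/
def centreInt : (W : WallpaperGroup) → Fin W.num → ℤ × ℤ
  | p1 | pg | p3 => ![(0, 0)]
  | p2 => ![(0, 0), (2, 0), (0, 2), (2, 2)]
  | pm => ![(0, 0), (2, 0), 0, 0]
  | cm | p3m1 | p31m => ![(0, 0), 0]
  | pmm => ![(0, 0), (2, 2), (2, 0), (0, 2), 0, 0, 0, 0]
  | pmg => ![(0, 0), (2, 2), (1, 0), 0]
  | pgg | p6 => ![(0, 0), (2, 0)]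
  | cmm => ![(0, 0), (2, 2), (2, 0), 0, 0]
  | p4 => ![(0, 0), (2, 2), (2, 0)]
  | p4m => ![(0, 0), (2, 2), (2, 0), 0, 0, 0]
  | p4g => ![(0, 0), (2, 0), 0]
  | p6m => ![(0, 0), (2, 0), 0, 0]

/-- The base point of a region of an LSM-type invariant. -/
noncomputable def centre (W : WallpaperGroup) (i : Fin W.num) : ℝ × ℝ := quarter (centreInt W i)

/-- `q` is equivalent to the base point of a region of an LSM-type invariant. -/
def IsCentral (W : WallpaperGroup) (q : ℝ × ℝ) : Prop :=
  ∃ j, (inv W j).IsLSM ∧ ∃ g : Elt W, g • centre W j = q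

/-- A decidable criterion for `IsCentral`. -/
def IsCentralInt (W : WallpaperGroup) (Q : ℤ × ℤ) : Prop :=
  ∃ j, (inv W j).IsLSM ∧ ∃ c m, (Q.1 - (pointQuarter W c m (centreInt W j)).1) % 4 = 0 ∧
    (Q.2 - (pointQuarter W c m (centreInt W j)).2) % 4 = 0

instance (Q : ℤ × ℤ) : Decidable (IsCentralInt W Q) := by
  unfold IsCentralInt
  infer_instance

theorem isCentral_quarter {Q : ℤ × ℤ} (h : IsCentralInt W Q) : IsCentral W (quarter Q) := by
  obtain ⟨j, hj, c, m, h1, h2⟩ := h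
  obtain ⟨a, ha⟩ := Int.dvd_of_emod_eq_zero h1
  obtain ⟨b, hb⟩ := Int.dvd_of_emod_eq_zero h2
  refine ⟨j, hj, ⟨a, b, c, m⟩, ?_⟩
  rw [centre, smul_quarter]
  congr 1
  ext
  · simp only [actQuarter]
    omega
  · simp only [actQuarter]
    omega

theorem isCentralInt_congr {Q Q' : ℤ × ℤ} (h₁ : Q.1 ≡ Q'.1 [ZMOD 4]) (h₂ : Q.2 ≡ Q'.2 [ZMOD 4])
    (h : IsCentralInt W Q') : IsCentralInt W Q := by
  obtain ⟨j, hj, c, m, e1, e2⟩ := h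
  refine ⟨j, hj, c, m, ?_, ?_⟩
  · rw [Int.ModEq] at h₁
    omega
  · rw [Int.ModEq] at h₂
    omega

theorem isCentralInt_half (h : W.rot % 2 = 0) (x y : ℤ) : IsCentralInt W (2 * x, 2 * y) := by
  have key : W.rot % 2 = 0 → ∀ a b : Fin 4, IsCentralInt W (2 * a.val, 2 * b.val) := by
    cases W <;> decide +kernel
  obtain ⟨a, ha⟩ := exists_fin_modEq x
  obtain ⟨b, hb⟩ := exists_fin_modEq y
  exact isCentralInt_congr (ha.mul_left 2) (hb.mul_left 2) (key h a b)

/-- The fixed point of an orientation-preserving involution is central. -/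
theorem isCentral_of_involution {g : Elt W} (hm : g.m = 0) (h2 : g * g = 1) (h1 : g ≠ 1)
    {q : ℝ × ℝ} (hq : g • q = q) : IsCentral W q := by
  -- A rotation group of odd order has no involution, and a translation with a fixed point is
  -- trivial.
  have hrot : W.rot % 2 = 0 := by
    by_contra hr
    have key : W.rot % 2 ≠ 0 → ∀ c : Fin W.rot, c + c = 0 → c = 0 := by
      cases W <;> decide
    have hcc : g.c + flip g.m g.c = 0 := congrArg Elt.c h2
    rw [hm, flip_zero] at hcc
    exact h1 (eq_one_of_fixed (key hr _ hcc) hm hq)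
  -- A half-turn `v ↦ (x, y) - v` has its centre at half of the integral point `(x, y)`.
  rw [smul_of_involution hm h2 h1, sub_eq_iff_eq_add, ← two_smul ℝ q] at hq
  have e : q = quarter (2 * g.x, 2 * g.y) := by
    have e1 := congrArg Prod.fst hq
    have e2 := congrArg Prod.snd hq
    simp only [castP, Prod.smul_fst, Prod.smul_snd, smul_eq_mul] at e1 e2
    ext
    · simp only [quarter]
      push_cast
      linarith
    · simp only [quarter]
      push_cast
      linarith
  rw [e]
  exact isCentral_quarter (isCentralInt_half hrot _ _)

/-- Four times a central point on the axis of the reflection `T₁ ^ x * T₂ ^ y * C ^ c * M`. -/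
def mirrorPoint (x y : ℤ) : (W : WallpaperGroup) → Fin W.rot → ℤ × ℤ
  | pm => fun _ => (2 * x, 0)
  | cm => fun _ => (4 * x, 0)
  | pmm | cmm | p4m | p6m => fun _ => (2 * x, 2 * y)
  | pmg => ![(2 * x + 1, 0), 0]
  | p4g => ![(4 * x + 2, 0), 0, (4 * x - 2, 0), 0]
  | p3m1 => ![(4 * x, 0), (-4 * y, 0), (0, -4 * x)]
  | p31m => ![(4 * x, 0), (4 * y, 0), (0, 4 * x)]
  | _ => fun _ => 0

theorem isCentralInt_mirrorPoint (x y : ℤ) (c : Fin W.rot) :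
    IsCentralInt W (mirrorPoint x y W c) := by
  have key : ∀ (c : Fin W.rot) (a b : Fin 4), IsCentralInt W (mirrorPoint a.val b.val W c) := by
    cases W <;> decide +kernel
  obtain ⟨a, ha⟩ := exists_fin_modEq x
  obtain ⟨b, hb⟩ := exists_fin_modEq y
  rw [Int.ModEq] at ha hb
  refine isCentralInt_congr ?_ ?_ (key c a b) <;>
    cases W <;> fin_cases c <;> simp [mirrorPoint, Int.ModEq] <;> omega

/-- The equation `h * h = 1` says that the glide component vanishes, which is the linear condition
for the tabulated point to lie on the axis. For classes that consist of proper glide reflections it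
is contradictory, so their zero entries in the table are placeholders. -/
theorem actQuarter_mirrorPoint {h : Elt W} (hm : h.m ≠ 0) (h2 : h * h = 1) :
    actQuarter h (mirrorPoint h.x h.y W h.c) = mirrorPoint h.x h.y W h.c := by
  obtain ⟨x, y, c, m⟩ := h
  have hx := congrArg Elt.x h2
  have hy := congrArg Elt.y h2
  rw [mul_def', one_def'] at hx hy
  simp only at hx hy hm ⊢
  clear h2
  cases W <;> fin_cases c <;> fin_cases m <;>
    simp [lin, shift, rotGen, mirGen, actQuarter, pointQuarter, pointPart, glideInt, mirrorPoint,
      Fin.val_neg', rot] at hx hy hm ⊢ <;> omega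

theorem exists_isCentral_of_reflection {h : Elt W} (hm : h.m ≠ 0) (h2 : h * h = 1) :
    ∃ q, h • q = q ∧ IsCentral W q :=
  ⟨quarter (mirrorPoint h.x h.y W h.c), by rw [smul_quarter, actQuarter_mirrorPoint hm h2],
    isCentral_quarter (isCentralInt_mirrorPoint _ _ _)⟩

/-! ### Regions and orbits of base points as dual bases. -/

/-- The region of an invariant with base point `p`. -/
def TopInv.region (p : ℝ × ℝ) : TopInv W → Set (ℝ × ℝ)
  | rotation _ => {p}
  | axis t _ => {q | ∃ a ∈ Set.Ico (0 : ℝ) 1, q = p + a • (t • p - p)}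
  | cell t₁ t₂ => parallelogram p (t₁ • p - p) (t₂ • p - p)
  | glideCell t s => parallelogram p (t • p - p) (s • p - p)
  | mirror _ => ∅

/-- The point `Q / 4` can be the base point of a region. -/
def TopInv.IsBase (Q : ℤ × ℤ) : TopInv W → Prop
  | rotation g => actQuarter g Q = Q
  | axis _ m => actQuarter m Q = Q
  | _ => True

instance (Q : ℤ × ℤ) (α : TopInv W) : Decidable (α.IsBase Q) := by
  cases α <;> unfold TopInv.IsBase <;> infer_instance

theorem isBase_centreInt (i : Fin W.num) : (inv W i).IsBase (centreInt W i) := by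
  revert i
  cases W <;> decide +kernel

theorem region_mem_regions {α : TopInv W} (hα : α.IsLSM) {Q : ℤ × ℤ} (h : α.IsBase Q) :
    α.region (quarter Q) ∈ α.regions := by
  cases α with
  | rotation g => exact ⟨_, by rw [smul_quarter, show actQuarter g Q = Q from h], rfl⟩
  | axis t m => exact ⟨_, by rw [smul_quarter, show actQuarter m Q = Q from h], rfl⟩
  | cell t₁ t₂ => exact ⟨_, rfl⟩
  | glideCell t s => exact ⟨_, rfl⟩
  | mirror m => exact hα.elim

theorem mem_region {α : TopInv W} (hα : α.IsLSM) (p : ℝ × ℝ) : p ∈ α.region p := by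
  cases α with
  | rotation g => exact rfl
  | axis t m => exact ⟨0, by simp, by simp⟩
  | cell t₁ t₂ => exact ⟨0, by simp, 0, by simp, by simp⟩
  | glideCell t s => exact ⟨0, by simp, 0, by simp, by simp⟩
  | mirror m => exact hα.elim

/-- The quarter-integral points in the region with base point `Q / 4`, inside the unit square. -/
def TopInv.InRegion (Q Z : ℤ × ℤ) : TopInv W → Prop
  | rotation _ => Z = Q
  | axis _ m => actQuarter m Z = Z
  | cell _ _ => True
  | glideCell _ _ => Z.2 < 2
  | mirror _ => False

instance (Q Z : ℤ × ℤ) (α : TopInv W) : Decidable (α.InRegion Q Z) := by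
  cases α <;> unfold TopInv.InRegion <;> infer_instance

theorem inRegion_fin (i j : Fin W.num) (hi : (inv W i).IsLSM) (hj : (inv W j).IsLSM)
    (c : Fin W.rot) (m : Fin W.mir) (X Y : Fin 4)
    (h : (inv W i).InRegion (centreInt W i) (finVec X Y))
    (h₁ : (X.val - (pointQuarter W c m (centreInt W j)).1) % 4 = 0)
    (h₂ : (Y.val - (pointQuarter W c m (centreInt W j)).2) % 4 = 0) :
    i = j ∧ finVec X Y = centreInt W i := by
  revert i j c m X Y
  cases W <;> decide +kernel

/-- Confining the standard regions to the half-open unit square leaves only sixteen quarter-integral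
points to examine. -/
theorem region_bounds (i : Fin W.num) {q : ℝ × ℝ} (hq : q ∈ (inv W i).region (centre W i)) :
    (0 ≤ q.1 ∧ q.1 < 1) ∧ (0 ≤ q.2 ∧ q.2 < 1) := by
  have hT (v : ℝ × ℝ) : (T₁ * T₂ : Elt W) • v = v + (1, 1) := by
    rw [mul_smul, T₂_smul, T₁_smul, add_assoc]
    simp
  revert i
  cases W
  case p1 | p3 =>
    intro i hq
    fin_cases i
    obtain ⟨a, ha, b, hb, rfl⟩ := hq
    rw [T₁_smul, T₂_smul]
    simpa [centre, quarter, centreInt] using ⟨ha, hb⟩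
  case pg =>
    intro i hq
    fin_cases i
    obtain ⟨a, ha, b, hb, rfl⟩ := hq
    rw [T₁_smul, M, pg_smul_one]
    simp only [Set.mem_Ico] at ha hb
    simp [centre, quarter, centreInt]
    constructor <;> constructor <;> linarith
  case p3m1 =>
    intro i hq
    fin_cases i
    · obtain ⟨a, ha, b, hb, rfl⟩ := hq
      rw [T₁_smul, T₂_smul]
      simpa [centre, quarter, centreInt] using ⟨ha, hb⟩
    · exact absurd hq (Set.notMem_empty q)
  case cm | p31m =>
    intro i hq
    fin_cases i
    · obtain ⟨a, ha, rfl⟩ := hq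
      rw [hT]
      simpa [centre, quarter, centreInt] using ha
    · exact absurd hq (Set.notMem_empty q)
  case pm =>
    intro i hq
    fin_cases i
    · obtain ⟨a, ha, rfl⟩ := hq
      rw [T₂_smul]
      simpa [centre, quarter, centreInt] using ha
    · obtain ⟨a, ha, rfl⟩ := hq
      rw [T₂_smul]
      simp only [Set.mem_Ico] at ha
      norm_num [centre, quarter, centreInt, ha]
    · exact absurd hq (Set.notMem_empty q)
    · exact absurd hq (Set.notMem_empty q)
  case pmg =>
    intro i hq
    fin_cases i
    · obtain rfl : q = _ := hq
      norm_num [centre, quarter, centreInt]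
    · obtain rfl : q = _ := hq
      norm_num [centre, quarter, centreInt]
    · obtain ⟨a, ha, rfl⟩ := hq
      rw [T₂_smul]
      simp only [Set.mem_Ico] at ha
      norm_num [centre, quarter, centreInt, ha]
    · exact absurd hq (Set.notMem_empty q)
  all_goals
    intro i hq
    fin_cases i
    all_goals first
      | exact absurd hq (Set.notMem_empty q)
      | (obtain rfl : q = _ := hq
         norm_num [centre, quarter, centreInt])

theorem inRegion_of_mem (i : Fin W.num) {Z : ℤ × ℤ}
    (hZ : quarter Z ∈ (inv W i).region (centre W i)) :
    (inv W i).InRegion (centreInt W i) Z := by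
  have hv := inv_valid i
  have hb := isBase_centreInt i
  by_cases hi : (inv W i).IsLSM
  · have hR := region_mem_regions hi hb
    by_cases hg : ∃ t s, inv W i = .glideCell t s
    · clear hv hb hi hR
      revert i
      cases W
      case pg =>
        intro i hZ _
        fin_cases i
        obtain ⟨a, ha, b, hb, h⟩ := hZ
        rw [T₁_smul, M, pg_smul_one] at h
        have h2 := congrArg Prod.snd h
        simp [centre, quarter, centreInt] at h2
        have h3 : (Z.2 : ℝ) < 2 := by linarith [hb.2]
        exact_mod_cast h3
      all_goals
        intro i hZ hg
        obtain ⟨t, s, hts⟩ := hg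
        fin_cases i <;> cases hts
    · rw [centre] at hZ
      generalize inv W i = α at *
      cases α with
      | rotation g => exact quarter_injective hZ
      | axis t m =>
        have := axis_subset hv hR hZ
        rw [smul_quarter] at this
        exact quarter_injective this
      | cell t₁ t₂ => trivial
      | glideCell t s => exact absurd ⟨t, s, rfl⟩ hg
      | mirror m => exact hi
  · generalize inv W i = α at *
    cases α with
    | mirror m => exact absurd hZ (Set.notMem_empty _)
    | _ => exact absurd trivial hi

/-- The orbits of the base points meet the regions as dual bases. -/
theorem smul_centre_mem_region {i j : Fin W.num} (hi : (inv W i).IsLSM) (hj : (inv W j).IsLSM)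
    {g : Elt W} (h : g • centre W j ∈ (inv W i).region (centre W i)) :
    i = j ∧ g • centre W j = centre W i := by
  have hb := region_bounds i h
  have hj' : g • centre W j = quarter (actQuarter g (centreInt W j)) := smul_quarter g _
  rw [hj'] at h hb
  have hr := inRegion_of_mem i h
  rw [hj', centre]
  set Z := actQuarter g (centreInt W j) with hZ
  have h1 : 0 ≤ Z.1 ∧ Z.1 < 4 := by
    have e := hb.1
    simp only [quarter] at e
    constructor
    · have : (0 : ℝ) ≤ Z.1 := by linarith [e.1]
      exact_mod_cast this
    · have : (Z.1 : ℝ) < 4 := by linarith [e.2]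
      exact_mod_cast this
  have h2 : 0 ≤ Z.2 ∧ Z.2 < 4 := by
    have e := hb.2
    simp only [quarter] at e
    constructor
    · have : (0 : ℝ) ≤ Z.2 := by linarith [e.1]
      exact_mod_cast this
    · have : (Z.2 : ℝ) < 4 := by linarith [e.2]
      exact_mod_cast this
  -- With coordinates in `{0, 1, 2, 3}`, membership in the orbit is a congruence mod 4, in which the
  -- translation part of `g` disappears.
  have e : Z = finVec ⟨Z.1.toNat, by omega⟩ ⟨Z.2.toNat, by omega⟩ := by
    ext <;> simp [finVec] <;> omega
  rw [e] at hr
  have e1 : Z.1 = 4 * g.x + (pointQuarter W g.c g.m (centreInt W j)).1 := rfl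
  have e2 : Z.2 = 4 * g.y + (pointQuarter W g.c g.m (centreInt W j)).2 := rfl
  have := inRegion_fin i j hi hj g.c g.m _ _ hr (by simp only; omega) (by simp only; omega)
  rw [← e] at this
  exact ⟨this.1, congrArg quarter this.2⟩

end centres

/-! ### Lattice homotopy classes -/

section latticeHomotopy

/-- The distribution with a nontrivial projective representation at the points of one orbit. -/
noncomputable def orbitDist (W : WallpaperGroup) (q : ℝ × ℝ) : Distribution W :=
  ⟨(MulAction.orbit (Elt W) q).indicator 1, fun g p => by
    have h : g • p ∈ MulAction.orbit (Elt W) q ↔ p ∈ MulAction.orbit (Elt W) q :=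
      ⟨fun ⟨k, hk⟩ => ⟨g⁻¹ * k, by
          change (g⁻¹ * k) • q = p
          rw [mul_smul, inv_smul_eq_iff]
          exact hk⟩,
        fun ⟨k, hk⟩ => ⟨g * k, by
          change (g * k) • q = g • p
          rw [mul_smul]
          exact congrArg (g • ·) hk⟩⟩
    by_cases hp : p ∈ MulAction.orbit (Elt W) q
    · rw [Set.indicator_of_mem hp, Set.indicator_of_mem (h.2 hp)]
      rfl
    · rw [Set.indicator_of_notMem hp, Set.indicator_of_notMem (mt h.1 hp)], fun K hK => by
    refine ((finite_smul_inter (W := W) (isCompact_singleton (x := q)) hK).image (· • q)).subset ?_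
    rintro p ⟨hp, hp'⟩
    obtain ⟨g, rfl⟩ := Set.mem_of_indicator_ne_zero hp'
    exact ⟨g, ⟨q, rfl, hp⟩, rfl⟩⟩

theorem orbitDist_apply_of_mem {p q : ℝ × ℝ} (h : p ∈ MulAction.orbit (Elt W) q) :
    (orbitDist W q : ℝ × ℝ → ZMod 2) p = 1 := Set.indicator_of_mem h _

theorem orbitDist_apply_of_notMem {p q : ℝ × ℝ} (h : p ∉ MulAction.orbit (Elt W) q) :
    (orbitDist W q : ℝ × ℝ → ZMod 2) p = 0 := Set.indicator_of_notMem h _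

theorem orbitDist_smul (g : Elt W) (q : ℝ × ℝ) : orbitDist W (g • q) = orbitDist W q := by
  apply Subtype.ext
  change Set.indicator _ _ = Set.indicator _ _
  rw [MulAction.orbit_smul]

theorem lhClass_add (σ τ : Distribution W) : lhClass (σ + τ) = lhClass σ + lhClass τ := rfl

theorem lhClass_nsmul (n : ℕ) (σ : Distribution W) : lhClass (n • σ) = n • lhClass σ := rfl

theorem lhClass_eq_of_deforms {σ τ : Distribution W} (h : Deforms W σ τ) :
    lhClass σ = lhClass τ := by
  rw [← sub_eq_zero]
  exact (QuotientAddGroup.eq_zero_iff (σ - τ)).2 (AddSubgroup.subset_closure ⟨σ, τ, h, rfl⟩)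

theorem two_nsmul_lhClass (σ : Distribution W) : 2 • lhClass σ = 0 := by
  have h : 2 • σ = 0 := by
    ext p
    change 2 • (σ : ℝ × ℝ → ZMod 2) p = 0
    rw [nsmul_eq_mul]
    exact zero_mul _
  rw [← lhClass_nsmul, h]
  rfl

/-- A point fixed by `S` gives a well-defined position for each coset of `S`, whatever
representatives are chosen. -/
theorem out_smul_of_fixed {S : Subgroup (Elt W)} {q : ℝ × ℝ} (hq : ∀ s ∈ S, s • q = q)
    (g : Elt W) : ((g : Elt W ⧸ S)).out • q = g • q := by
  obtain ⟨s, hs⟩ := QuotientGroup.mk_out_eq_mul S g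
  rw [hs, mul_smul, hq s s.2]

theorem smul_out_smul {S : Subgroup (Elt W)} {q : ℝ × ℝ} (hq : ∀ s ∈ S, s • q = q) (g : Elt W)
    (x : Elt W ⧸ S) : (g • x).out • q = g • x.out • q := by
  induction x using QuotientGroup.induction_on with | H k => ?_
  rw [out_smul_of_fixed hq, ← mul_smul]
  exact out_smul_of_fixed hq (g * k)

/-- The fibres of the coset labels over the points of an orbit are translates of each other, so all
have the same multiplicity. -/
theorem nsmul_orbitDist_apply {S : Subgroup (Elt W)} {q : ℝ × ℝ} (hq : ∀ s ∈ S, s • q = q)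
    (p : ℝ × ℝ) :
    (({x : Elt W ⧸ S | x.out • q = q}.ncard • orbitDist W q : Distribution W) : ℝ × ℝ → ZMod 2) p =
      ({x : Elt W ⧸ S | x.out • q = p}.ncard : ZMod 2) := by
  change (_ : ℕ) • (orbitDist W q : ℝ × ℝ → ZMod 2) p = _
  by_cases hp : p ∈ MulAction.orbit (Elt W) q
  · rw [orbitDist_apply_of_mem hp, nsmul_one]
    obtain ⟨g, rfl⟩ := hp
    congr 1
    rw [← Set.ncard_image_of_injective _ (MulAction.injective g)]
    congr 1
    ext x
    constructor
    · rintro ⟨y, hy, rfl⟩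
      change (g • y).out • q = g • q
      rw [smul_out_smul hq, show y.out • q = q from hy]
    · intro hx
      refine ⟨g⁻¹ • x, ?_, smul_inv_smul g x⟩
      change (g⁻¹ • x).out • q = q
      rw [smul_out_smul hq, inv_smul_eq_iff]
      exact hx
  · rw [orbitDist_apply_of_notMem hp, smul_zero]
    have h : {x : Elt W ⧸ S | x.out • q = p} = ∅ :=
      Set.eq_empty_iff_forall_notMem.2 fun x hx => hp ⟨x.out, hx⟩
    rw [h, Set.ncard_empty, Nat.cast_zero]

/-! ### Moving orbits to central points. -/

/-- Moving the points of an orbit along segments that are fixed by a common subgroup of the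
stabilizers. -/
theorem nsmul_lhClass_orbitDist (S : Subgroup (Elt W)) {q q' : ℝ × ℝ} (hq : ∀ s ∈ S, s • q = q)
    (hq' : ∀ s ∈ S, s • q' = q') :
    {x : Elt W ⧸ S | x.out • q = q}.ncard • lhClass (orbitDist W q) =
      {x : Elt W ⧸ S | x.out • q' = q'}.ncard • lhClass (orbitDist W q') := by
  rw [← lhClass_nsmul, ← lhClass_nsmul]
  apply lhClass_eq_of_deforms
  let γ (t : unitInterval) : ℝ × ℝ := (1 - t.val) • q + t.val • q'
  have hγ : Continuous γ := by fun_prop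
  -- The whole segment is fixed by `S`, so the motion of one label extends equivariantly to all
  -- cosets.
  have hS (t) (s) (hs : s ∈ S) : s • γ t = γ t := by
    rw [smul_combo s q q' (sub_add_cancel _ _), hq s hs, hq' s hs]
  refine ⟨Elt W ⧸ S, inferInstance, fun x t => x.out • γ t,
    fun x => (continuous_smul' x.out).comp hγ, fun g x t => smul_out_smul (hS t) g x,
    fun K hK => ?_, fun p => ?_, fun p => ?_⟩
  · refine ((finite_smul_inter (W := W) (isCompact_range hγ) hK).image
      (QuotientGroup.mk : Elt W → Elt W ⧸ S)).subset ?_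
    rintro x ⟨t, ht⟩
    exact ⟨x.out, ⟨γ t, ⟨t, rfl⟩, ht⟩, QuotientGroup.out_eq' x⟩
  · have h : γ 0 = q := by simp [γ]
    simp only [h]
    exact nsmul_orbitDist_apply hq p
  · have h : γ 1 = q' := by simp [γ]
    simp only [h]
    exact nsmul_orbitDist_apply hq' p

/-- The labels located at `q` are the cosets of `P` inside the stabilizer of `q`. -/
theorem ncard_fixed_eq_index (q : ℝ × ℝ) (P : Subgroup (MulAction.stabilizer (Elt W) q)) :
    {x : Elt W ⧸ P.map (MulAction.stabilizer (Elt W) q).subtype | x.out • q = q}.ncard =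
      P.index := by
  set S := P.map (MulAction.stabilizer (Elt W) q).subtype
  have hq : ∀ s ∈ S, s • q = q := by
    rintro _ ⟨s, -, rfl⟩
    exact s.2
  let f : MulAction.stabilizer (Elt W) q ⧸ P → Elt W ⧸ S :=
    Quotient.map' Subtype.val fun a b h => by
      rw [QuotientGroup.leftRel_apply] at h ⊢
      exact ⟨_, h, rfl⟩
  have hf : Function.Injective f := by
    intro a b
    induction a using QuotientGroup.induction_on with | H a => ?_
    induction b using QuotientGroup.induction_on with | H b => ?_
    intro h
    obtain ⟨c, hc, hc'⟩ := QuotientGroup.eq.1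
      (show ((a.1 : Elt W) : Elt W ⧸ S) = (b.1 : Elt W) from h)
    refine QuotientGroup.eq.2 ?_
    have e : c = a⁻¹ * b := Subtype.ext hc'
    exact e ▸ hc
  have hr : {x : Elt W ⧸ S | x.out • q = q} = Set.range f := by
    ext x
    constructor
    · intro hx
      exact ⟨((⟨x.out, hx⟩ : MulAction.stabilizer (Elt W) q) :
        MulAction.stabilizer (Elt W) q ⧸ P), QuotientGroup.out_eq' x⟩
    · rintro ⟨a, rfl⟩
      induction a using QuotientGroup.induction_on with | H a => ?_
      exact (out_smul_of_fixed hq a.1).trans a.2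
  rw [hr, ← Nat.card_coe_set_eq, Nat.card_range_of_injective hf]
  rfl

theorem m_add_eq_zero {a b : Fin W.mir} (ha : a ≠ 0) (hb : b ≠ 0) : a + b = 0 := by
  revert a b
  cases W <;> decide

theorem pow_m_eq_zero {s : Elt W} (hs : s.m = 0) (k : ℕ) : (s ^ k).m = 0 := by
  induction k with
  | zero => rfl
  | succ k ih =>
    rw [pow_succ]
    change (s ^ k).m + s.m = 0
    rw [ih, hs, add_zero]

/-- The span of the classes of the orbits of the base points. -/
def centreSpan (W : WallpaperGroup) : AddSubgroup (LatticeHomotopy W) :=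
  AddSubgroup.closure
    (Set.range fun j : {j : Fin W.num // (inv W j).IsLSM} => lhClass (orbitDist W (centre W j)))

theorem mem_centreSpan_of_isCentral {q : ℝ × ℝ} (h : IsCentral W q) :
    lhClass (orbitDist W q) ∈ centreSpan W := by
  obtain ⟨j, hj, g, rfl⟩ := h
  rw [orbitDist_smul]
  exact AddSubgroup.subset_closure ⟨⟨j, hj⟩, rfl⟩

theorem exists_isCentral (W : WallpaperGroup) : ∃ q, IsCentral W q := by
  have h : ∃ j, (inv W j).IsLSM := by cases W <;> decide
  obtain ⟨j, hj⟩ := h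
  exact ⟨centre W j, j, hj, 1, one_smul _ _⟩

/-- Centres of half-turns are themselves central. At any other point a Sylow 2-subgroup of the
stabilizer is trivial or generated by one reflection, so its fixed set contains a segment to a
central point. Moving along it costs multiplicities, but the one at `q` is the odd Sylow index, and
classes have order dividing two. -/
theorem lhClass_orbitDist_mem_centreSpan (q : ℝ × ℝ) :
    lhClass (orbitDist W q) ∈ centreSpan W := by
  by_cases hA : ∃ g : Elt W, g • q = q ∧ g.m = 0 ∧ g * g = 1 ∧ g ≠ 1
  · obtain ⟨g, hq, hm, h2, h1⟩ := hA
    exact mem_centreSpan_of_isCentral (isCentral_of_involution hm h2 h1 hq)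
  push Not at hA
  obtain ⟨P⟩ : Nonempty (Sylow 2 (MulAction.stabilizer (Elt W) q)) := inferInstance
  set S := (P : Subgroup (MulAction.stabilizer (Elt W) q)).map
    (MulAction.stabilizer (Elt W) q).subtype with hSdef
  have hq : ∀ s ∈ S, s • q = q := by
    rintro _ ⟨s, -, rfl⟩
    exact s.2
  -- Elements of `S` have 2-power order; a nontrivial orientation-preserving one would have a power
  -- that is an involution fixing `q`, contrary to `hA`.
  have hS1 : ∀ s ∈ S, s.m = 0 → s = 1 := by
    intro s hs hm
    have hk : ∃ k : ℕ, s ^ 2 ^ k = 1 := by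
      obtain ⟨a, ha, rfl⟩ := hs
      obtain ⟨k, hk⟩ := P.isPGroup' ⟨a, ha⟩
      refine ⟨k, ?_⟩
      have := congrArg (fun b : P => ((b : MulAction.stabilizer (Elt W) q) : Elt W)) hk
      simpa using this
    obtain ⟨k, hk⟩ := hk
    induction k with
    | zero => simpa using hk
    | succ k ih =>
      refine ih (hA (s ^ 2 ^ k) (hq _ (S.pow_mem hs _)) (pow_m_eq_zero hm _) ?_)
      rw [← pow_two, ← pow_mul, ← pow_succ, hk]
  have hq' : ∃ q', (∀ s ∈ S, s • q' = q') ∧ IsCentral W q' := by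
    by_cases hS : ∃ h ∈ S, h ≠ 1
    · obtain ⟨h, hh, h1⟩ := hS
      -- The product of two orientation-reversing elements of `S` preserves orientation, hence is
      -- trivial: `h` is a reflection and is the only nontrivial element.
      have hm : h.m ≠ 0 := fun h0 => h1 (hS1 h hh h0)
      have hmul (s : Elt W) (hs : s ∈ S) (hsm : s.m ≠ 0) : s * h = 1 :=
        hS1 _ (S.mul_mem hs hh) (m_add_eq_zero hsm hm)
      obtain ⟨q', hq1, hq2⟩ := exists_isCentral_of_reflection hm (hmul h hh hm)
      refine ⟨q', fun s hs => ?_, hq2⟩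
      by_cases hsm : s.m = 0
      · rw [hS1 s hs hsm, one_smul]
      · rw [mul_right_cancel ((hmul s hs hsm).trans (hmul h hh hm).symm), hq1]
    · push Not at hS
      obtain ⟨q', h⟩ := exists_isCentral W
      exact ⟨q', fun s hs => by rw [hS s hs, one_smul], h⟩
  obtain ⟨q', hq1, hq2⟩ := hq'
  have hmove := nsmul_lhClass_orbitDist S hq hq1
  have hodd : ¬2 ∣ {x : Elt W ⧸ S | x.out • q = q}.ncard := by
    rw [ncard_fixed_eq_index]
    exact P.not_dvd_index
  obtain ⟨k, hk⟩ : Odd {x : Elt W ⧸ S | x.out • q = q}.ncard := by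
    rwa [← Nat.not_even_iff_odd, even_iff_two_dvd]
  rw [hk, add_nsmul, one_nsmul, mul_nsmul, two_nsmul_lhClass, smul_zero, zero_add] at hmove
  rw [hmove]
  exact nsmul_mem (mem_centreSpan_of_isCentral hq2) _

theorem exists_trans_mem_square (p : ℝ × ℝ) :
    ∃ g : Elt W, g • p ∈ Set.Icc (0 : ℝ) 1 ×ˢ Set.Icc (0 : ℝ) 1 := by
  refine ⟨⟨-⌊p.1⌋, -⌊p.2⌋, 0, 0⟩, ?_⟩
  rw [trans_smul, add_comm]
  exact ⟨⟨(add_neg_floor_mem p.1).1, (add_neg_floor_mem p.1).2.le⟩,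
    ⟨(add_neg_floor_mem p.2).1, (add_neg_floor_mem p.2).2.le⟩⟩

/-- The orbits of the base points span all classes. -/
theorem lhClass_mem_centreSpan (σ : Distribution W) : lhClass σ ∈ centreSpan W := by
  set K : Set (ℝ × ℝ) := Set.Icc (0 : ℝ) 1 ×ˢ Set.Icc (0 : ℝ) 1
  have hK : IsCompact K := isCompact_Icc.prod isCompact_Icc
  -- Every orbit meets the unit square, so adding the orbit of a support point, which removes it mod
  -- 2, lowers the finite number of support points there.
  induction hn : (K ∩ Function.support (σ : ℝ × ℝ → ZMod 2)).ncard using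
    Nat.strong_induction_on generalizing σ with | _ n ih => ?_
  by_cases hσ : σ = 0
  · rw [hσ]
    exact (centreSpan W).zero_mem
  obtain ⟨p, hp⟩ : ∃ p, (σ : ℝ × ℝ → ZMod 2) p ≠ 0 := by
    by_contra h
    push Not at h
    exact hσ (Subtype.ext (funext h))
  obtain ⟨g, hg⟩ := exists_trans_mem_square (W := W) p
  have hgp : (σ : ℝ × ℝ → ZMod 2) (g • p) ≠ 0 := by rwa [σ.2.1]
  have key : ∀ a : ZMod 2, a ≠ 0 → a + 1 = 0 := by decide
  have horb {q : ℝ × ℝ} (hq : q ∈ MulAction.orbit (Elt W) p) :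
      ((σ + orbitDist W p : Distribution W) : ℝ × ℝ → ZMod 2) q = 0 := by
    change (σ : ℝ × ℝ → ZMod 2) q + (orbitDist W p : ℝ × ℝ → ZMod 2) q = 0
    rw [orbitDist_apply_of_mem hq]
    obtain ⟨k, rfl⟩ := hq
    exact key _ (by rwa [σ.2.1])
  have hlt : (K ∩ Function.support ((σ + orbitDist W p : Distribution W) :
      ℝ × ℝ → ZMod 2)).ncard < n := by
    rw [← hn]
    refine Set.ncard_lt_ncard ⟨?_, fun h => ?_⟩ (σ.2.2 K hK)
    · rintro q ⟨hqK, hq⟩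
      refine ⟨hqK, fun h0 => hq ?_⟩
      by_cases ho : q ∈ MulAction.orbit (Elt W) p
      · exact horb ho
      · change (σ : ℝ × ℝ → ZMod 2) q + (orbitDist W p : ℝ × ℝ → ZMod 2) q = 0
        rw [h0, orbitDist_apply_of_notMem ho, add_zero]
    · exact (h ⟨hg, hgp⟩).2 (horb ⟨g, rfl⟩)
  have h1 := ih _ hlt (σ + orbitDist W p) rfl
  rw [lhClass_add] at h1
  exact ((centreSpan W).add_mem_cancel_right (lhClass_orbitDist_mem_centreSpan p)).1 h1

/-! ### Region sums as coordinates on lattice homotopy classes. -/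

/-- The total projective representations in the regions of the LSM-type invariants. -/
noncomputable def regionSum (W : WallpaperGroup) :
    Distribution W →+ ({i : Fin W.num // (inv W i).IsLSM} → ZMod 2) where
  toFun σ i := ∑ᶠ q ∈ (inv W i).region (centre W i), (σ : ℝ × ℝ → ZMod 2) q
  map_zero' := by
    ext i
    exact finsum_mem_zero _
  map_add' σ τ := by
    ext i
    obtain ⟨K, hK, hR⟩ := exists_compact_of_mem_regions
      (region_mem_regions i.2 (isBase_centreInt i.1))
    exact finsum_mem_add_distrib' ((σ.2.2 K hK).subset (Set.inter_subset_inter_left _ hR))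
      ((τ.2.2 K hK).subset (Set.inter_subset_inter_left _ hR))

theorem regionSum_eq (σ : Distribution W) (i : {i : Fin W.num // (inv W i).IsLSM})
    {R : Set (ℝ × ℝ)} (hR : R ∈ (inv W i).regions) :
    regionSum W σ i = ∑ᶠ q ∈ R, (σ : ℝ × ℝ → ZMod 2) q :=
  regionSum_eq_of_deforms (deforms_refl σ) (inv_regular i.1) (inv_valid i.1)
    (region_mem_regions i.2 (isBase_centreInt i.1)) hR

/-- By `smul_centre_mem_region` the orbit of a base point meets its own region only at the base
point itself, and misses the other regions. -/
theorem regionSum_centre (j : {i : Fin W.num // (inv W i).IsLSM}) :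
    regionSum W (orbitDist W (centre W j)) = Pi.single j 1 := by
  ext i
  change ∑ᶠ q ∈ (inv W i).region (centre W i),
    (orbitDist W (centre W j) : ℝ × ℝ → ZMod 2) q = _
  by_cases h : i = j
  · subst h
    rw [Pi.single_eq_same, finsum_mem_inter_support_eq' _ _ {centre W i}, finsum_mem_singleton,
      orbitDist_apply_of_mem (MulAction.mem_orbit_self _)]
    intro q hq
    refine ⟨fun hqR => ?_, fun h => by rw [show q = centre W i from h]; exact mem_region i.2 _⟩
    obtain ⟨g, rfl⟩ := Set.mem_of_indicator_ne_zero hq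
    exact (smul_centre_mem_region i.2 i.2 hqR).2
  · rw [Pi.single_eq_of_ne h]
    refine finsum_mem_eq_zero_of_forall_eq_zero fun q hq => orbitDist_apply_of_notMem ?_
    rintro ⟨g, rfl⟩
    exact h (Subtype.ext (smul_centre_mem_region i.2 j.2 hq).1)

/-- The total projective representations in the regions, for classes. -/
noncomputable def classSum (W : WallpaperGroup) :
    LatticeHomotopy W →+ ({i : Fin W.num // (inv W i).IsLSM} → ZMod 2) :=
  QuotientAddGroup.lift _ (regionSum W) (by
    rw [AddSubgroup.closure_le]
    rintro _ ⟨σ, τ, h, rfl⟩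
    change regionSum W (σ - τ) = 0
    rw [map_sub, sub_eq_zero]
    ext i
    have hR := region_mem_regions i.2 (isBase_centreInt i.1)
    exact regionSum_eq_of_deforms h (inv_regular i.1) (inv_valid i.1) hR hR)

theorem classSum_lhClass (σ : Distribution W) : classSum W (lhClass σ) = regionSum W σ := rfl

/-- The class with given total projective representations in the regions. -/
noncomputable def ofClassSum (W : WallpaperGroup) :
    ({i : Fin W.num // (inv W i).IsLSM} → ZMod 2) →+ LatticeHomotopy W :=
  ∑ j : {i : Fin W.num // (inv W i).IsLSM},
    (ZMod.lift 2 ⟨zmultiplesHom _ (lhClass (orbitDist W (centre W j))), by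
    rw [zmultiplesHom_apply, natCast_zsmul]
    exact two_nsmul_lhClass _⟩).comp (Pi.evalAddMonoidHom _ j)

theorem ofClassSum_single (j : {i : Fin W.num // (inv W i).IsLSM}) :
    ofClassSum W (Pi.single j 1) = lhClass (orbitDist W (centre W j)) := by
  have h1 (c : LatticeHomotopy W) (h : zmultiplesHom _ c ((2 : ℕ) : ℤ) = 0) :
      ZMod.lift 2 ⟨zmultiplesHom _ c, h⟩ 1 = c := by
    have := ZMod.lift_coe 2 ⟨zmultiplesHom _ c, h⟩ 1
    simpa using this
  rw [ofClassSum, AddMonoidHom.finsetSum_apply, Finset.sum_eq_single j]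
  · rw [AddMonoidHom.comp_apply, Pi.evalAddMonoidHom_apply, Pi.single_eq_same, h1]
  · intro i _ hi
    rw [AddMonoidHom.comp_apply, Pi.evalAddMonoidHom_apply, Pi.single_eq_of_ne hi, map_zero]
  · exact fun h => absurd (Finset.mem_univ j) h

/-- Both sides are additive, so it suffices to compare them on the orbits of base points, which
span. -/
theorem ofClassSum_classSum (x : LatticeHomotopy W) : ofClassSum W (classSum W x) = x := by
  have hx : x ∈ centreSpan W := by
    induction x using QuotientAddGroup.induction_on with | H σ => exact lhClass_mem_centreSpan σ
  induction hx using AddSubgroup.closure_induction with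
  | mem y hy =>
    obtain ⟨j, rfl⟩ := hy
    simp only [classSum_lhClass, regionSum_centre, ofClassSum_single]
  | zero => rw [map_zero, map_zero]
  | add y z _ _ hy hz => rw [map_add, map_add, hy, hz]
  | neg y _ hy => rw [map_neg, map_neg, hy]

theorem classSum_ofClassSum (a : {i : Fin W.num // (inv W i).IsLSM} → ZMod 2) :
    classSum W (ofClassSum W a) = a := by
  have h : (classSum W).comp (ofClassSum W) = AddMonoidHom.id _ := by
    refine AddMonoidHom.functions_ext _ _ _ fun j b => ?_
    have hb : b = 0 ∨ b = 1 := by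
      revert b
      decide
    rcases hb with rfl | rfl
    · simp
    · rw [AddMonoidHom.comp_apply, ofClassSum_single, classSum_lhClass, regionSum_centre]
      rfl
  exact DFunLike.congr_fun h a

/-- Lattice homotopy classes are identified with `(ℤ/2)ᵏ` by the regions of the LSM-type
invariants. -/
noncomputable def classSumEquiv (W : WallpaperGroup) :
    LatticeHomotopy W ≃+ ({i : Fin W.num // (inv W i).IsLSM} → ZMod 2) :=
  { classSum W with
    invFun := ofClassSum W
    left_inv := ofClassSum_classSum
    right_inv := classSum_ofClassSum }

theorem kerEquiv_cls {f : groupCohomology.cocycles₂ (Z2 W)} (hf : cls f ∈ kerITilde W)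
    (i : {i : Fin W.num // (inv W i).IsLSM}) :
    kerEquiv W ⟨cls f, hf⟩ i = (inv W i).val f := valEquiv_cls f i

theorem val_eq_regionSum {σ : Distribution W} {f : groupCohomology.cocycles₂ (Z2 W)}
    (h : cls f = ((classSumEquiv W).trans (kerEquiv W).symm) (lhClass σ))
    (i : {i : Fin W.num // (inv W i).IsLSM}) : (inv W i).val f = regionSum W σ i := by
  have hf : cls f ∈ kerITilde W := h ▸ Subtype.prop _
  have e : (⟨cls f, hf⟩ : kerITilde W) = (kerEquiv W).symm (classSumEquiv W (lhClass σ)) :=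
    Subtype.ext h
  rw [← kerEquiv_cls hf, e, AddEquiv.apply_symm_apply]
  rfl

end latticeHomotopy

end WallpaperGroup

/-! ### Assembly of the theorem. -/

open WallpaperGroup groupCohomology in
theorem mainTheorem2 (W : WallpaperGroup) :
    -- the invariants are unchanged under coboundaries
    (∀ i, ∀ f ∈ cocycles₂ (Z2 W), ∀ b ∈ coboundaries₂ (Z2 W),
      (inv W i).eval (sgn (f + b)) = (inv W i).eval (sgn f)) ∧
    -- the invariants separate the classes
    (∀ f f' : cocycles₂ (Z2 W),
      (∀ i, (inv W i).eval (sgn f) = (inv W i).eval (sgn f')) → cls f = cls f') ∧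
    -- the invariants identify `H²(G_s, ℤ/2)` with `(ℤ/2)ⁿ`
    (∃ e : groupCohomology (Z2 W) 2 ≃+ (Fin W.num → ZMod 2), ∀ (f : cocycles₂ (Z2 W)) (i),
      (inv W i).eval (sgn f) = (-1) ^ e (cls f) i) ∧
    -- the kernel consists of the classes with trivial mirror-type invariants
    (∀ f : cocycles₂ (Z2 W), cls f ∈ kerITilde W ↔
      ∀ i, ¬(inv W i).IsLSM → (inv W i).eval (sgn f) = 1) ∧
    -- the basis cochains are cocycles, are dual to the invariants, and those dual to the
    -- remaining invariants generate the kernel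
    (∃ hl : ∀ j, lam W j ∈ cocycles₂ (Z2 W),
      (∀ i j, (inv W i).eval (sgn (lam W j)) = if i = j then -1 else 1) ∧
      kerITilde W = AddSubgroup.closure {h | ∃ j, (inv W j).IsLSM ∧ h = cls ⟨lam W j, hl j⟩}) ∧
    -- lattice homotopy classes are the elements of the kernel, and the invariants measure the
    -- total projective representation in the corresponding regions
    (∃ Φ : LatticeHomotopy W ≃+ kerITilde W,
      ∀ (σ : Distribution W) (f : cocycles₂ (Z2 W)), cls f = Φ (lhClass σ) →
        ∀ i, (inv W i).IsLSM → ∀ R ∈ (inv W i).regions,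
          (inv W i).eval (sgn f) = (-1) ^ ∑ᶠ q ∈ R, (σ : ℝ × ℝ → ZMod 2) q) := by
  have hone (i : Fin W.num) (f : Elt W × Elt W → ZMod 2) :
      (inv W i).eval (sgn f) = 1 ↔ (inv W i).val f = 0 := by
    rw [TopInv.eval_sgn, ← neg_one_uzpow_injective.eq_iff, uzpow_zero]
  refine ⟨fun i f _ b hb => ?_, fun f f' h => ?_, ⟨valEquiv W, fun f i => ?_⟩, fun f => ?_,
    ⟨lam_mem_cocycles₂, fun i j => ?_, kerITilde_eq_closure⟩,
    ⟨(classSumEquiv W).trans (kerEquiv W).symm, fun σ f h i hi R hR => ?_⟩⟩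
  · have hb0 := val_eq_zero_of_mem_coboundaries₂ hb i
    rw [TopInv.eval_sgn, TopInv.eval_sgn]
    congr 1
    exact (TopInv.val_add f b (inv W i)).trans (by rw [hb0, add_zero])
  · rw [cls_eq_iff]
    intro i
    have hi := h i
    rw [TopInv.eval_sgn, TopInv.eval_sgn] at hi
    exact neg_one_uzpow_injective hi
  · rw [TopInv.eval_sgn, valEquiv_cls]
  · simp only [cls_mem_kerITilde_iff_val, hone]
  · rw [TopInv.eval_sgn, val_lam]
    split_ifs
    · exact uzpow_one _
    · exact uzpow_zero _
  · rw [TopInv.eval_sgn, val_eq_regionSum h ⟨i, hi⟩, regionSum_eq σ ⟨i, hi⟩ hR]
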